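/- There is an absolute constant $C_1>0$, and for every $\alpha$ there are constants $C_0,C_2>0$ depending only on $\alpha$, such that the following holds. Let $m,n,d$ be nonnegative integers with $m\ge 1$ divisible by $3$, let $A\in\mathbb R^{n\times d}$, and let $C\in\mathbb R^{d\times d}$ be positive semidefinite such that $H=A^\top A+C$ is invertible. Put $$U=AH^{-1/2},\qquad d_{\rm eff}=\mathrm{tr}(U^\top U),\qquad \tilde d_{\rm eff}=\mathrm{tr}\big((U^\top U)^2\big).$$ Let $s$ be a random vector in $\mathbb R^n$ with $\mathbb E[ss^\top]=I_n$, and let $S$ be a random $m\times n$ matrix with i.i.d. rows distributed as $\frac1{\sqrt{m-d_{\rm eff}}}\,s^\top$. Let $\eta\le \frac12$ and $\delta\le \frac1{m^3}$, and assume: 1. (Subspace embedding.) If $\tilde S$ is the matrix of the first $m/3$ rows of $S$ multiplied by $\sqrt3$, then $\|U^\top\tilde S^\top\tilde SU-U^\top U\|\le\eta$ with probability at least $1-\delta/3$. 2. (Variance.) For every positive semidefinite $B\in\mathbb R^{d\times d}$, the variable $s^\top UBU^\top s$ is square integrable and $\mathrm{Var}[s^\top UBU^\top s]\le\alpha\,\mathrm{tr}(UB^2U^\top)$.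 If $m\ge C_0\,d_{\rm eff}$, then there is an event $\mathcal E$ of probability at least $1-\delta$ on which $A^\top S^\top SA+C$ is invertible and the matrix $$Q=H^{1/2}\big(A^\top S^\top SA+C\big)^{-1}H^{1/2}$$ satisfies $\|Q-I\|\le C_1\eta$; moreover the conditional expectations $\mathbb E_{\mathcal E}[Q]=\mathbb E[Q\mid\mathcal E]$ and $\mathbb E_{\mathcal E}[Q^2]=\mathbb E[Q^2\mid\mathcal E]$ exist and satisfy $$\big\|\mathbb E_{\mathcal E}[Q]-I\big\|\le C_2\frac{\sqrt{d_{\rm eff}}}{m},\qquad \Big\|\mathbb E_{\mathcal E}[Q^2]-\Big(I+\frac{d_{\rm eff}}{m-\tilde d_{\rm eff}}\,U^\top U\Big)\Big\|\le C_2\frac{\sqrt{d_{\rm eff}}}{m}.$$ Here $\|\cdot\|$ is the spectral norm and square roots of positive semidefinite matrices are the positive semidefinite ones. -/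

import Mathlib

open MeasureTheory ProbabilityTheory Matrix
open scoped MatrixOrder Matrix.Norms.L2Operator

noncomputable section

/-- The regularized Hessian `H = AᵀA + C`. -/
def hessian {n d : ℕ} (A : Matrix (Fin n) (Fin d) ℝ) (C : Matrix (Fin d) (Fin d) ℝ) :
    Matrix (Fin d) (Fin d) ℝ :=
  Aᵀ * A + C

/-- The normalized matrix `U = A H^{-1/2}`. -/
def normalized {n d : ℕ} (A : Matrix (Fin n) (Fin d) ℝ) (C : Matrix (Fin d) (Fin d) ℝ) :
    Matrix (Fin n) (Fin d) ℝ :=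
  A * (CFC.sqrt (hessian A C))⁻¹

/-- The effective dimension `tr(UᵀU)`. -/
def effDim {n d : ℕ} (A : Matrix (Fin n) (Fin d) ℝ) (C : Matrix (Fin d) (Fin d) ℝ) : ℝ :=
  ((normalized A C)ᵀ * normalized A C).trace

/-- The second effective dimension `tr((UᵀU)²)`. -/
def effDim₂ {n d : ℕ} (A : Matrix (Fin n) (Fin d) ℝ) (C : Matrix (Fin d) (Fin d) ℝ) : ℝ :=
  (((normalized A C)ᵀ * normalized A C) ^ 2).trace

/-- The sketched Hessian `AᵀSᵀSA + C`. -/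
def sketchedHessian {m n d : ℕ} (A : Matrix (Fin n) (Fin d) ℝ) (C : Matrix (Fin d) (Fin d) ℝ)
    (S : Matrix (Fin m) (Fin n) ℝ) : Matrix (Fin d) (Fin d) ℝ :=
  Aᵀ * Sᵀ * S * A + C

/-- `Q = H^{1/2} (AᵀSᵀSA + C)⁻¹ H^{1/2}`. -/
def sketchedInverse {m n d : ℕ} (A : Matrix (Fin n) (Fin d) ℝ) (C : Matrix (Fin d) (Fin d) ℝ)
    (S : Matrix (Fin m) (Fin n) ℝ) : Matrix (Fin d) (Fin d) ℝ :=
  CFC.sqrt (hessian A C) * (sketchedHessian A C S)⁻¹ * CFC.sqrt (hessian A C)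

/-- The matrix of the first `m / 3` rows of `S`, scaled by `√3`. -/
def firstThird {m n : ℕ} (S : Matrix (Fin m) (Fin n) ℝ) : Matrix (Fin (m / 3)) (Fin n) ℝ :=
  √3 • S.submatrix (Fin.castLE (Nat.div_le_self m 3)) id

/-- Subspace embedding: `‖UᵀSᵀSU - UᵀU‖ ≤ η` (spectral norm) with probability at least `p`. -/
def SubspaceEmbedding {Ω : Type*} [MeasurableSpace Ω] (P : Measure Ω) {k n d : ℕ}
    (U : Matrix (Fin n) (Fin d) ℝ) (S : Ω → Matrix (Fin k) (Fin n) ℝ) (η p : ℝ) : Prop :=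
  p ≤ P.real {ω | ‖Uᵀ * (S ω)ᵀ * S ω * U - Uᵀ * U‖ ≤ η}

/-- `Var[sᵀ U B Uᵀ s] ≤ α tr(U B² Uᵀ)` for all positive semidefinite `B`
(in particular, the variance is finite). -/
def VarianceCondition {Ω : Type*} [MeasurableSpace Ω] (P : Measure Ω) {n d : ℕ}
    (U : Matrix (Fin n) (Fin d) ℝ) (s : Ω → Fin n → ℝ) (α : ℝ) : Prop :=
  ∀ B : Matrix (Fin d) (Fin d) ℝ, B.PosSemidef →
    MemLp (fun ω => s ω ⬝ᵥ ((U * B * Uᵀ) *ᵥ s ω)) 2 P ∧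
    Var[fun ω => s ω ⬝ᵥ ((U * B * Uᵀ) *ᵥ s ω); P] ≤ α * (U * B ^ 2 * Uᵀ).trace

/-- `E[s sᵀ] = I`. -/
def Isotropic {Ω : Type*} [MeasurableSpace Ω] (P : Measure Ω) {n : ℕ}
    (s : Ω → Fin n → ℝ) : Prop :=
  ∀ i j, Integrable (fun ω => s ω i * s ω j) P ∧
    ∫ ω, s ω i * s ω j ∂P = (1 : Matrix (Fin n) (Fin n) ℝ) i j

/-- The random matrix `S` has independent rows, each distributed as `c • sᵀ`. -/
structure HasIIDRows {Ω Ω' : Type*} [MeasurableSpace Ω] [MeasurableSpace Ω']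
    (P : Measure Ω) (P' : Measure Ω') {m n : ℕ}
    (S : Ω → Matrix (Fin m) (Fin n) ℝ) (c : ℝ) (s : Ω' → Fin n → ℝ) : Prop where
  measurable_row : ∀ i, Measurable (fun ω => S ω i)
  indep : iIndepFun (fun i ω => S ω i) P
  identDistrib : ∀ i, IdentDistrib (fun ω => S ω i) (fun ω' => c • s ω') P P'

/-- All entries of the random matrix `M` are integrable. -/
def EntrywiseIntegrable {Ω : Type*} [MeasurableSpace Ω] (P : Measure Ω) {d : ℕ}
    (M : Ω → Matrix (Fin d) (Fin d) ℝ) : Prop :=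
  ∀ i j, Integrable (fun ω => M ω i j) P

/-- The (entrywise) expectation of a random matrix. -/
def matrixExp {Ω : Type*} [MeasurableSpace Ω] (P : Measure Ω) {d : ℕ}
    (M : Ω → Matrix (Fin d) (Fin d) ℝ) : Matrix (Fin d) (Fin d) ℝ :=
  Matrix.of fun i j => ∫ ω, M ω i j ∂P

end

/-! ### Matrix norms, resolvent bounds and rank one updates -/

section LinearAlgebra

variable {d : ℕ}

/-! Conjugating by `H^{-1/2}` turns the sketched Hessian into `M = γ Σ xᵢxᵢᵀ + (1 - G)` with `G =
UᵀU`, `k = tr G`, `γ = 1/(m - k)` and i.i.d. rows `xᵢ` of second moment `G`; then `Q = M⁻¹`. From `Q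
- 1 = Q(1 - M)`, every test matrix `W` satisfies `tr W(Q - 1) = Σᵢ (tr(WQG)/m - γ xᵢᵀWQxᵢ)`, and `Q²
- Q = Q²(1 - M)` gives the analogue with `Q²` (`sum_rowTerm`, `sum_rowTermSq`).

Each summand is treated by leaving one row out: `Q` is the Sherman–Morrison update of the inverse
`B` without row `i`, and `xᵢ` is integrated with `B` frozen. The weight `γ / (1 + γ xᵀBx)` is close
to `γ / (1 + γk) = 1/m`, which makes the summand of `Q - 1` centered to first order
(`inv_sub_stepSize_div`). The mean left over is of order `ρ m⁻² (√(ak) + |tr(BG) - k| + 1)`, where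
`ρ` bounds the `L²` norms of the forms `xᵀLWRx` (`hasMomentBounds_rowTerm`); summing over rows costs
a factor `m`.

The fluctuation `tr(BG) - k` is controlled by the same identity: with `W = G` and weight `ψ = tr G(Q
- 1)`, the left side is the second moment of `ψ`, the right side is a small multiple of it plus
`O(ak)`, and the small multiple is absorbed (`setIntegral_trace_sq_le`). For `W = v uᵀ` one has `ρ²
= 2a min(1, k)`, so `ρ` and `ρ√(ak)` are both `O(√k)`; this is the bound on the mean of `Q - 1`.

For `Q²` a term `tr(B²G) tr(WBG)/m²` survives in every row. Taking `W = G` shows that `tr(GQ²)` is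
close to the solution `mc` of `mc = k + c tr(G²)`, that is `c = k / (m - tr(G²))`. A second
absorption argument bounds the fluctuation around it (`setIntegral_centeredTrace_sq_le`), and the
surviving term becomes `c G`.

The event asks that all three thirds of the rows embed the subspace. The two thirds avoiding row `i`
already give `M - γxᵢxᵢᵀ ≥ 1/3` (`le_gramErase_of_thirds`), so the event can be replaced by a larger
one independent of row `i`; the exchange costs probability `δ`, negligible because `δ ≤ m⁻³`. On the
event `‖Q‖ ≤ 3`, hence `‖Q - 1‖ = ‖Q(1 - M)‖ ≤ 3η`. -/

theorem abs_dotProduct_le_norm (x y : Fin d → ℝ) :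
    |x ⬝ᵥ y| ≤ ‖WithLp.toLp 2 x‖ * ‖WithLp.toLp 2 y‖ := by
  have h := abs_real_inner_le_norm (WithLp.toLp 2 y) (WithLp.toLp 2 x)
  rw [EuclideanSpace.inner_eq_star_dotProduct] at h
  simpa [mul_comm] using h

theorem norm_toLp_sq (x : Fin d → ℝ) : ‖WithLp.toLp 2 x‖ ^ 2 = x ⬝ᵥ x := by
  rw [EuclideanSpace.norm_sq_eq]
  simp [dotProduct, sq]

theorem norm_toLp_le_one {x : Fin d → ℝ} (hx : x ⬝ᵥ x ≤ 1) : ‖WithLp.toLp 2 x‖ ≤ 1 := by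
  rw [← norm_toLp_sq] at hx
  nlinarith [norm_nonneg (WithLp.toLp 2 x)]

theorem norm_toLp_mulVec_le (K : Matrix (Fin d) (Fin d) ℝ) (x : Fin d → ℝ) :
    ‖WithLp.toLp 2 (K *ᵥ x)‖ ≤ ‖K‖ * ‖WithLp.toLp 2 x‖ :=
  Matrix.l2_opNorm_mulVec K (WithLp.toLp 2 x)

theorem mulVec_dotProduct_self_le {K : Matrix (Fin d) (Fin d) ℝ} (hK : ‖K‖ ≤ 1) {x : Fin d → ℝ}
    (hx : x ⬝ᵥ x ≤ 1) : (K *ᵥ x) ⬝ᵥ (K *ᵥ x) ≤ 1 := by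
  rw [← norm_toLp_sq]
  have h1 := norm_toLp_mulVec_le K x
  have h2 := norm_toLp_le_one hx
  have : ‖WithLp.toLp 2 (K *ᵥ x)‖ ≤ 1 :=
    h1.trans (mul_le_one₀ hK (norm_nonneg _) h2)
  exact pow_le_one₀ (norm_nonneg _) this

theorem abs_dotProduct_mulVec_le (K : Matrix (Fin d) (Fin d) ℝ) (x y : Fin d → ℝ) :
    |x ⬝ᵥ K *ᵥ y| ≤ ‖K‖ * (‖WithLp.toLp 2 x‖ * ‖WithLp.toLp 2 y‖) := by
  refine (abs_dotProduct_le_norm _ _).trans ?_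
  have := mul_le_mul_of_nonneg_left (norm_toLp_mulVec_le K y) (norm_nonneg (WithLp.toLp 2 x))
  linarith

theorem abs_dotProduct_mulVec_self_le (K : Matrix (Fin d) (Fin d) ℝ) (x : Fin d → ℝ) :
    |x ⬝ᵥ K *ᵥ x| ≤ ‖K‖ * (x ⬝ᵥ x) := by
  have := abs_dotProduct_mulVec_le K x x
  rwa [← sq, norm_toLp_sq] at this

theorem dotProduct_self_nonneg' (x : Fin d → ℝ) : 0 ≤ x ⬝ᵥ x := by
  rw [← norm_toLp_sq]; positivity

theorem l2_opNorm_le_of_bilin {K : Matrix (Fin d) (Fin d) ℝ} {ε : ℝ} (hε : 0 ≤ ε)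
    (h : ∀ u v : Fin d → ℝ, u ⬝ᵥ u ≤ 1 → v ⬝ᵥ v ≤ 1 → |u ⬝ᵥ K *ᵥ v| ≤ ε) : ‖K‖ ≤ ε := by
  rw [Matrix.cstar_norm_def]
  refine ContinuousLinearMap.opNorm_le_of_re_inner_le hε ?_
  intro x y hx hy
  have h2 := h y.ofLp x.ofLp (by rw [← norm_toLp_sq]; simp [hy]) (by rw [← norm_toLp_sq]; simp [hx])
  rw [← Matrix.inner_toEuclideanCLM, real_inner_comm] at h2
  exact (le_abs_self _).trans h2

theorem Matrix.PosSemidef.dotProduct_nonneg {K : Matrix (Fin d) (Fin d) ℝ} (hK : K.PosSemidef)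
    (x : Fin d → ℝ) : 0 ≤ x ⬝ᵥ K *ᵥ x := by
  simpa using hK.dotProduct_mulVec_nonneg x

theorem Matrix.PosSemidef.transpose_eq {K : Matrix (Fin d) (Fin d) ℝ} (hK : K.PosSemidef) :
    Kᵀ = K := by
  simpa using hK.isHermitian.eq

theorem dotProduct_mulVec_comm_of_transpose_eq {K : Matrix (Fin d) (Fin d) ℝ} (h : Kᵀ = K)
    (x y : Fin d → ℝ) : x ⬝ᵥ K *ᵥ y = (K *ᵥ x) ⬝ᵥ y := by
  rw [Matrix.dotProduct_mulVec, ← Matrix.mulVec_transpose, h]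

/-- Polarization: nonnegativity at `u ± v` gives `2|uᵀKv| ≤ uᵀKu + vᵀKv`, so the quadratic form
controls the bilinear one. -/
theorem Matrix.PosSemidef.l2_opNorm_le {K : Matrix (Fin d) (Fin d) ℝ} (hK : K.PosSemidef)
    {c : ℝ} (hc : 0 ≤ c) (h : ∀ x : Fin d → ℝ, x ⬝ᵥ K *ᵥ x ≤ c * (x ⬝ᵥ x)) : ‖K‖ ≤ c := by
  refine l2_opNorm_le_of_bilin hc fun u v hu hv => ?_
  have h1 := hK.dotProduct_nonneg (u - v)
  have h2 := hK.dotProduct_nonneg (u + v)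
  have h3 : v ⬝ᵥ K *ᵥ u = u ⬝ᵥ K *ᵥ v := by
    rw [dotProduct_mulVec_comm_of_transpose_eq hK.transpose_eq, dotProduct_comm]
  simp only [Matrix.mulVec_sub, Matrix.mulVec_add, sub_dotProduct, add_dotProduct, dotProduct_sub,
    dotProduct_add, h3] at h1 h2
  have h4 := h u
  have h5 := h v
  rw [abs_le]
  constructor <;> nlinarith

/-- The bounds satisfied by the inverse of a symmetric matrix bounded below by `1 / 3`. -/
structure IsResolvent (B : Matrix (Fin d) (Fin d) ℝ) : Prop where
  posSemidef : B.PosSemidef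
  norm_le : ‖B‖ ≤ 3
  sq_le : ∀ x : Fin d → ℝ, x ⬝ᵥ (B * B) *ᵥ x ≤ 3 * (x ⬝ᵥ B *ᵥ x)

theorem posDef_of_le {M : Matrix (Fin d) (Fin d) ℝ} (hM : Mᵀ = M) {c : ℝ} (hc : 0 < c)
    (h : ∀ x : Fin d → ℝ, c * (x ⬝ᵥ x) ≤ x ⬝ᵥ M *ᵥ x) : M.PosDef := by
  refine Matrix.PosDef.of_dotProduct_mulVec_pos (by simpa [Matrix.IsHermitian] using hM) ?_
  intro x hx
  have : 0 < x ⬝ᵥ x := by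
    rw [← norm_toLp_sq]
    have : WithLp.toLp 2 x ≠ 0 := by simpa using hx
    positivity
  have := h x
  simp only [star_trivial]
  nlinarith

/-- Testing the lower bound at `M⁻¹x` gives `|M⁻¹x|² ≤ 3 xᵀM⁻¹x`; Cauchy–Schwarz on the right then
yields `|M⁻¹x| ≤ 3|x|`. -/
theorem isResolvent_inv {M : Matrix (Fin d) (Fin d) ℝ} (hM : Mᵀ = M)
    (h : ∀ x : Fin d → ℝ, (1 / 3) * (x ⬝ᵥ x) ≤ x ⬝ᵥ M *ᵥ x) : IsResolvent M⁻¹ := by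
  have hpd := posDef_of_le hM (by norm_num) h
  have hu := (Matrix.isUnit_iff_isUnit_det _).1 hpd.isUnit
  have key : ∀ x : Fin d → ℝ, (1 / 3) * (x ⬝ᵥ (M⁻¹ * M⁻¹) *ᵥ x) ≤ x ⬝ᵥ M⁻¹ *ᵥ x := by
    intro x
    have h1 := h (M⁻¹ *ᵥ x)
    rw [Matrix.mulVec_mulVec, Matrix.mul_nonsing_inv _ hu, Matrix.one_mulVec] at h1
    rw [← Matrix.mulVec_mulVec,
      dotProduct_mulVec_comm_of_transpose_eq hpd.posSemidef.inv.transpose_eq,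
      dotProduct_comm x]
    exact h1
  refine ⟨hpd.posSemidef.inv, ?_, fun x => by linarith [key x]⟩
  refine hpd.posSemidef.inv.l2_opNorm_le (by norm_num) fun x => ?_
  have h1 := key x
  rw [← Matrix.mulVec_mulVec, dotProduct_mulVec_comm_of_transpose_eq
    hpd.posSemidef.inv.transpose_eq, ← norm_toLp_sq] at h1
  have h2 := (le_abs_self _).trans (abs_dotProduct_le_norm x (M⁻¹ *ᵥ x))
  rw [← norm_toLp_sq]
  set a := ‖WithLp.toLp 2 x‖
  set b := ‖WithLp.toLp 2 (M⁻¹ *ᵥ x)‖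
  have ha : 0 ≤ a := norm_nonneg _
  have hb : 0 ≤ b := norm_nonneg _
  have : b ≤ 3 * a := by
    by_contra hcon
    push Not at hcon
    nlinarith
  nlinarith

/-- The inverse of `B⁻¹ + γ x xᵀ` by the Sherman–Morrison formula. -/
noncomputable def rankOneUpdate (γ : ℝ) (B : Matrix (Fin d) (Fin d) ℝ) (x : Fin d → ℝ) :
    Matrix (Fin d) (Fin d) ℝ :=
  B - (γ / (1 + γ * (x ⬝ᵥ B *ᵥ x))) • vecMulVec (B *ᵥ x) (B *ᵥ x)

theorem inv_add_rankOne {M : Matrix (Fin d) (Fin d) ℝ} (hM : M.PosDef) {γ : ℝ} (hγ : 0 ≤ γ)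
    (x : Fin d → ℝ) : (M + γ • vecMulVec x x)⁻¹ = rankOneUpdate γ M⁻¹ x := by
  have hu := (Matrix.isUnit_iff_isUnit_det _).1 hM.isUnit
  have hg : 1 + γ * (x ⬝ᵥ M⁻¹ *ᵥ x) ≠ 0 := by
    have := hM.posSemidef.inv.dotProduct_nonneg x
    positivity
  refine Matrix.inv_eq_right_inv ?_
  rw [rankOneUpdate]
  set g := 1 + γ * (x ⬝ᵥ M⁻¹ *ᵥ x) with hgdef
  have hx : (M⁻¹ *ᵥ x) = x ᵥ* M⁻¹ := by
    rw [← Matrix.mulVec_transpose, hM.posSemidef.inv.transpose_eq]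
  have e1 : M * vecMulVec (M⁻¹ *ᵥ x) (M⁻¹ *ᵥ x) = vecMulVec x (M⁻¹ *ᵥ x) := by
    rw [Matrix.mul_vecMulVec, Matrix.mulVec_mulVec, Matrix.mul_nonsing_inv _ hu, Matrix.one_mulVec]
  have e2 : vecMulVec x x * M⁻¹ = vecMulVec x (M⁻¹ *ᵥ x) := by
    rw [Matrix.vecMulVec_mul, ← hx]
  have e3 : vecMulVec x x * vecMulVec (M⁻¹ *ᵥ x) (M⁻¹ *ᵥ x) =
      (x ⬝ᵥ M⁻¹ *ᵥ x) • vecMulVec x (M⁻¹ *ᵥ x) := by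
    rw [Matrix.vecMulVec_mul_vecMulVec, Matrix.vecMulVec_smul]
  rw [add_mul, mul_sub, mul_sub, Matrix.mul_nonsing_inv _ hu, Matrix.mul_smul, e1, Matrix.smul_mul,
    e2, Matrix.smul_mul, Matrix.mul_smul, e3]
  have h3 : γ - γ / g - γ * (γ / g * (x ⬝ᵥ M⁻¹ *ᵥ x)) = 0 := by
    generalize x ⬝ᵥ M⁻¹ *ᵥ x = b at hgdef
    field_simp
    rw [hgdef]; ring
  set V := vecMulVec x (M⁻¹ *ᵥ x)
  calc _ = 1 + (γ - γ / g - γ * (γ / g * (x ⬝ᵥ M⁻¹ *ᵥ x))) • V := by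
        simp only [sub_smul, smul_smul]; abel
    _ = 1 := by rw [h3]; simp

/-! ### Exact expansions of traces and quadratic forms under a rank one update -/

section Expansion

variable {γ : ℝ} {B : Matrix (Fin d) (Fin d) ℝ}

theorem trace_mul_vecMulVec_mul (W G : Matrix (Fin d) (Fin d) ℝ) (p q : Fin d → ℝ) :
    (W * vecMulVec p q * G).trace = q ⬝ᵥ (G * W) *ᵥ p := by
  rw [Matrix.mul_vecMulVec, Matrix.vecMulVec_mul, Matrix.trace_vecMulVec, dotProduct_comm,
    ← Matrix.dotProduct_mulVec, Matrix.mulVec_mulVec]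

theorem trace_rankOneUpdate (hB : Bᵀ = B) (W G : Matrix (Fin d) (Fin d) ℝ) (x : Fin d → ℝ) :
    (W * rankOneUpdate γ B x * G).trace = (W * B * G).trace -
      γ / (1 + γ * (x ⬝ᵥ B *ᵥ x)) * (x ⬝ᵥ (B * G * W * B) *ᵥ x) := by
  rw [rankOneUpdate, mul_sub, sub_mul, Matrix.trace_sub, Matrix.mul_smul, Matrix.smul_mul,
    Matrix.trace_smul, trace_mul_vecMulVec_mul, smul_eq_mul]
  congr 2
  rw [← dotProduct_mulVec_comm_of_transpose_eq hB]
  simp only [Matrix.mulVec_mulVec, mul_assoc]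

/-- On the updating vector itself the update merely rescales `Bx`. The quadratic forms in `x` below
get their damping denominators from this. -/
theorem rankOneUpdate_mulVec_self {x : Fin d → ℝ} (hg : 1 + γ * (x ⬝ᵥ B *ᵥ x) ≠ 0) :
    rankOneUpdate γ B x *ᵥ x = (1 + γ * (x ⬝ᵥ B *ᵥ x))⁻¹ • (B *ᵥ x) := by
  rw [rankOneUpdate, Matrix.sub_mulVec, Matrix.smul_mulVec, Matrix.vecMulVec_mulVec,
    dotProduct_comm (B *ᵥ x) x]
  ext i
  simp only [Pi.sub_apply, Pi.smul_apply, smul_eq_mul, MulOpposite.smul_eq_mul_unop,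
    MulOpposite.unop_op]
  generalize x ⬝ᵥ B *ᵥ x = b at *
  field_simp
  ring

theorem quadForm_rankOneUpdate {x : Fin d → ℝ} (hg : 1 + γ * (x ⬝ᵥ B *ᵥ x) ≠ 0)
    (W : Matrix (Fin d) (Fin d) ℝ) :
    x ⬝ᵥ (W * rankOneUpdate γ B x) *ᵥ x = (x ⬝ᵥ (W * B) *ᵥ x) / (1 + γ * (x ⬝ᵥ B *ᵥ x)) := by
  rw [← Matrix.mulVec_mulVec, rankOneUpdate_mulVec_self hg, Matrix.mulVec_smul, dotProduct_smul,
    Matrix.mulVec_mulVec, smul_eq_mul, div_eq_inv_mul]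

theorem quadForm_rankOneUpdate_sq (hB : Bᵀ = B) {x : Fin d → ℝ}
    (hg : 1 + γ * (x ⬝ᵥ B *ᵥ x) ≠ 0) (W : Matrix (Fin d) (Fin d) ℝ) :
    x ⬝ᵥ (W * (rankOneUpdate γ B x * rankOneUpdate γ B x)) *ᵥ x =
      (x ⬝ᵥ (W * (B * B)) *ᵥ x) / (1 + γ * (x ⬝ᵥ B *ᵥ x)) -
      γ / (1 + γ * (x ⬝ᵥ B *ᵥ x)) ^ 2 * (x ⬝ᵥ (B * B) *ᵥ x) * (x ⬝ᵥ (W * B) *ᵥ x) := by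
  have h2 : (B *ᵥ x) ⬝ᵥ (B *ᵥ x) = x ⬝ᵥ (B * B) *ᵥ x := by
    rw [← dotProduct_mulVec_comm_of_transpose_eq hB, Matrix.mulVec_mulVec]
  have h1 : rankOneUpdate γ B x *ᵥ (B *ᵥ x) = (B * B) *ᵥ x -
      (γ / (1 + γ * (x ⬝ᵥ B *ᵥ x)) * (x ⬝ᵥ (B * B) *ᵥ x)) • (B *ᵥ x) := by
    rw [rankOneUpdate, Matrix.sub_mulVec, Matrix.smul_mulVec, Matrix.vecMulVec_mulVec,
      Matrix.mulVec_mulVec, h2]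
    ext i
    simp only [Pi.sub_apply, Pi.smul_apply, smul_eq_mul, MulOpposite.smul_eq_mul_unop,
      MulOpposite.unop_op]
    ring
  rw [← Matrix.mulVec_mulVec, ← Matrix.mulVec_mulVec, rankOneUpdate_mulVec_self hg,
    Matrix.mulVec_smul, h1, Matrix.mulVec_smul, dotProduct_smul, Matrix.mulVec_sub,
    Matrix.mulVec_smul, dotProduct_sub, dotProduct_smul, Matrix.mulVec_mulVec,
    Matrix.mulVec_mulVec]
  simp only [smul_eq_mul]
  generalize x ⬝ᵥ B *ᵥ x = b at *
  field_simp

theorem rankOneUpdate_mul_self (hB : Bᵀ = B) (x : Fin d → ℝ) :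
    rankOneUpdate γ B x * rankOneUpdate γ B x = B * B -
      (γ / (1 + γ * (x ⬝ᵥ B *ᵥ x))) • (vecMulVec ((B * B) *ᵥ x) (B *ᵥ x) +
        vecMulVec (B *ᵥ x) ((B * B) *ᵥ x)) +
      ((γ / (1 + γ * (x ⬝ᵥ B *ᵥ x))) ^ 2 * (x ⬝ᵥ (B * B) *ᵥ x)) •
        vecMulVec (B *ᵥ x) (B *ᵥ x) := by
  have h2 : (B *ᵥ x) ⬝ᵥ (B *ᵥ x) = x ⬝ᵥ (B * B) *ᵥ x := by
    rw [← dotProduct_mulVec_comm_of_transpose_eq hB, Matrix.mulVec_mulVec]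
  have h3 : (B *ᵥ x) ᵥ* B = (B * B) *ᵥ x := by
    rw [← Matrix.mulVec_transpose, hB, Matrix.mulVec_mulVec]
  rw [rankOneUpdate, sub_mul, mul_sub, mul_sub, Matrix.mul_smul, Matrix.smul_mul, Matrix.smul_mul,
    Matrix.mul_smul, Matrix.mul_vecMulVec, Matrix.vecMulVec_mul, Matrix.vecMulVec_mul_vecMulVec,
    h2, h3, Matrix.mulVec_mulVec, Matrix.vecMulVec_smul]
  module

theorem trace_rankOneUpdate_sq (hB : Bᵀ = B) (W G : Matrix (Fin d) (Fin d) ℝ) (x : Fin d → ℝ) :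
    (W * (rankOneUpdate γ B x * rankOneUpdate γ B x) * G).trace = (W * (B * B) * G).trace -
      γ / (1 + γ * (x ⬝ᵥ B *ᵥ x)) * (x ⬝ᵥ (B * G * W * (B * B)) *ᵥ x +
        x ⬝ᵥ (B * B * G * W * B) *ᵥ x) +
      (γ / (1 + γ * (x ⬝ᵥ B *ᵥ x))) ^ 2 * (x ⬝ᵥ (B * B) *ᵥ x) *
        (x ⬝ᵥ (B * G * W * B) *ᵥ x) := by
  have hBB : (B * B)ᵀ = B * B := by rw [Matrix.transpose_mul, hB]
  rw [rankOneUpdate_mul_self hB]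
  simp only [mul_add, mul_sub, add_mul, sub_mul, Matrix.trace_sub, Matrix.trace_add,
    Matrix.mul_smul, Matrix.smul_mul, Matrix.trace_smul, trace_mul_vecMulVec_mul, smul_eq_mul]
  rw [← dotProduct_mulVec_comm_of_transpose_eq hB, ← dotProduct_mulVec_comm_of_transpose_eq hB,
    ← dotProduct_mulVec_comm_of_transpose_eq hBB]
  simp only [Matrix.mulVec_mulVec, mul_assoc]

end Expansion

end LinearAlgebra

/-! ### Cauchy–Schwarz and moments of the law of one row -/

theorem integral_abs_mul_le {X : Type*} [MeasurableSpace X] {μ : Measure X} {f g : X → ℝ}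
    (hf : MemLp f 2 μ) (hg : MemLp g 2 μ) {A B : ℝ} (hA : 0 ≤ A) (hB : 0 ≤ B)
    (hfA : ∫ x, f x ^ 2 ∂μ ≤ A ^ 2) (hgB : ∫ x, g x ^ 2 ∂μ ≤ B ^ 2) :
    ∫ x, |f x * g x| ∂μ ≤ A * B := by
  have h := integral_mul_norm_le_Lp_mul_Lq (μ := μ) (f := f) (g := g) (p := 2) (q := 2)
    (by constructor <;> norm_num) (by simpa using hf) (by simpa using hg)
  simp only [Real.norm_eq_abs, ← abs_mul, Real.rpow_two, sq_abs] at h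
  refine h.trans ?_
  have h1 : (∫ x, f x ^ 2 ∂μ) ^ (1 / 2 : ℝ) ≤ A := by
    rw [← Real.sqrt_eq_rpow]; exact Real.sqrt_le_iff.2 ⟨hA, hfA⟩
  have h2 : (∫ x, g x ^ 2 ∂μ) ^ (1 / 2 : ℝ) ≤ B := by
    rw [← Real.sqrt_eq_rpow]; exact Real.sqrt_le_iff.2 ⟨hB, hgB⟩
  have h3 : 0 ≤ ∫ x, g x ^ 2 ∂μ := integral_nonneg fun _ => sq_nonneg _
  exact mul_le_mul h1 h2 (by positivity) hA

theorem integral_abs_le_of_sq {X : Type*} [MeasurableSpace X] {μ : Measure X}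
    [IsProbabilityMeasure μ] {f : X → ℝ}
    (hf : MemLp f 2 μ) {A : ℝ} (hA : 0 ≤ A) (hfA : ∫ x, f x ^ 2 ∂μ ≤ A ^ 2) :
    ∫ x, |f x| ∂μ ≤ A := by
  have := integral_abs_mul_le (g := fun _ => 1) hf (memLp_const 1) hA zero_le_one hfA (by simp)
  simpa using this

section RowLaw

variable {d : ℕ}

/-- A probability law on `ℝᵈ` with second moment matrix `0 ≤ G ≤ 1`, whose positive semidefinite
quadratic forms satisfy the variance bound with constant `a`. -/
structure RowLaw (μ : Measure (Fin d → ℝ)) (G : Matrix (Fin d) (Fin d) ℝ) (a : ℝ) : Prop where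
  isProb : IsProbabilityMeasure μ
  posSemidef : G.PosSemidef
  le_one : ∀ x : Fin d → ℝ, x ⬝ᵥ G *ᵥ x ≤ x ⬝ᵥ x
  one_le : 1 ≤ a
  integrable_mul : ∀ i j, Integrable (fun x : Fin d → ℝ => x i * x j) μ
  integral_mul : ∀ i j, ∫ x, x i * x j ∂μ = G i j
  memLp_of_posSemidef : ∀ B : Matrix (Fin d) (Fin d) ℝ, B.PosSemidef →
    MemLp (fun x : Fin d → ℝ => x ⬝ᵥ B *ᵥ x) 2 μ
  variance_le : ∀ B : Matrix (Fin d) (Fin d) ℝ, B.PosSemidef →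
    Var[fun x : Fin d → ℝ => x ⬝ᵥ B *ᵥ x; μ] ≤ a * (B * B * G).trace

/-- The effective second moment `k² + a k`, where `k = tr G`. -/
noncomputable def normBound (G : Matrix (Fin d) (Fin d) ℝ) (a : ℝ) : ℝ :=
  √(G.trace ^ 2 + a * G.trace)

/-- The quadratic forms `x ↦ xᵀ L W R x` with `‖L‖, ‖R‖ ≤ 1` have `L²` norm at most `ρ`. -/
def TestBound (μ : Measure (Fin d → ℝ)) (W : Matrix (Fin d) (Fin d) ℝ) (ρ : ℝ) : Prop :=
  ∀ L R : Matrix (Fin d) (Fin d) ℝ, ‖L‖ ≤ 1 → ‖R‖ ≤ 1 →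
    ∫ x, (x ⬝ᵥ (L * W * R) *ᵥ x) ^ 2 ∂μ ≤ ρ ^ 2

@[fun_prop]
theorem measurable_quadForm (K : Matrix (Fin d) (Fin d) ℝ) :
    Measurable (fun x : Fin d → ℝ => x ⬝ᵥ K *ᵥ x) := by
  simp only [dotProduct, Matrix.mulVec]
  fun_prop

theorem dotProduct_mulVec_eq_sum (K : Matrix (Fin d) (Fin d) ℝ) (x y : Fin d → ℝ) :
    x ⬝ᵥ K *ᵥ y = ∑ i, ∑ j, K i j * (x i * y j) := by
  simp only [dotProduct, Matrix.mulVec, Finset.mul_sum]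
  exact Finset.sum_congr rfl fun i _ => Finset.sum_congr rfl fun j _ => by ring

namespace RowLaw

variable {μ : Measure (Fin d → ℝ)} {G : Matrix (Fin d) (Fin d) ℝ} {a : ℝ}

/-- Since `|xᵀKx| ≤ ‖K‖ xᵀx`, the positive semidefinite case `K = 1` covers all matrices. -/
theorem memLp_quadForm (h : RowLaw μ G a) (K : Matrix (Fin d) (Fin d) ℝ) :
    MemLp (fun x : Fin d → ℝ => x ⬝ᵥ K *ᵥ x) 2 μ := by
  have h1 := (h.memLp_of_posSemidef 1 Matrix.PosSemidef.one).const_mul ‖K‖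
  refine h1.mono (measurable_quadForm K).aestronglyMeasurable (ae_of_all _ fun x => ?_)
  simp only [Real.norm_eq_abs, Matrix.one_mulVec]
  exact (abs_dotProduct_mulVec_self_le K x).trans (le_abs_self _)

theorem memLp_dot_self (h : RowLaw μ G a) : MemLp (fun x : Fin d → ℝ => x ⬝ᵥ x) 2 μ := by
  simpa using h.memLp_quadForm 1

theorem integrable_quadForm (h : RowLaw μ G a) (K : Matrix (Fin d) (Fin d) ℝ) :
    Integrable (fun x : Fin d → ℝ => x ⬝ᵥ K *ᵥ x) μ :=
  have := h.isProb
  (h.memLp_quadForm K).integrable (by norm_num)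

theorem integral_quadForm (h : RowLaw μ G a) (K : Matrix (Fin d) (Fin d) ℝ) :
    ∫ x, x ⬝ᵥ K *ᵥ x ∂μ = (K * G).trace := by
  simp only [dotProduct_mulVec_eq_sum]
  rw [integral_finsetSum (f := fun i (x : Fin d → ℝ) => ∑ j, K i j * (x i * x j)) _
    fun i _ => integrable_finsetSum _ fun j _ => (h.integrable_mul i j).const_mul _]
  rw [Matrix.trace]
  refine Finset.sum_congr rfl fun i _ => ?_
  rw [integral_finsetSum (f := fun j (x : Fin d → ℝ) => K i j * (x i * x j)) _
    fun j _ => (h.integrable_mul i j).const_mul _, Matrix.diag_apply,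
    Matrix.mul_apply]
  refine Finset.sum_congr rfl fun j _ => ?_
  rw [integral_const_mul, h.integral_mul]
  congr 1
  exact congrFun (congrFun h.posSemidef.transpose_eq j) i

theorem integral_dot_self (h : RowLaw μ G a) : ∫ x, x ⬝ᵥ x ∂μ = G.trace := by
  simpa using h.integral_quadForm 1

theorem trace_nonneg (h : RowLaw μ G a) : 0 ≤ G.trace := h.posSemidef.trace_nonneg

/-- `tr(KG)` is the mean of `xᵀKx`, so this trace inequality is the pointwise bound `|xᵀKx| ≤ ‖K‖
xᵀx` integrated. -/
theorem abs_trace_mul_le (h : RowLaw μ G a) (K : Matrix (Fin d) (Fin d) ℝ) :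
    |(K * G).trace| ≤ ‖K‖ * G.trace := by
  rw [← h.integral_quadForm, ← h.integral_dot_self, ← integral_const_mul]
  refine abs_integral_le_integral_abs.trans
    (integral_mono (h.integrable_quadForm K).abs ?_ fun x => abs_dotProduct_mulVec_self_le K x)
  simpa using (h.integrable_quadForm 1).const_mul ‖K‖

theorem norm_le_one (h : RowLaw μ G a) : ‖G‖ ≤ 1 :=
  h.posSemidef.l2_opNorm_le zero_le_one fun x => by simpa using h.le_one x

theorem integral_sub_sq_le (h : RowLaw μ G a) {B : Matrix (Fin d) (Fin d) ℝ}
    (hB : B.PosSemidef) :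
    ∫ x, (x ⬝ᵥ B *ᵥ x - (B * G).trace) ^ 2 ∂μ ≤ a * (B * B * G).trace := by
  have := h.variance_le B hB
  rwa [variance_eq_integral (measurable_quadForm B).aemeasurable, h.integral_quadForm] at this

theorem integral_sub_sq_le_of_norm (h : RowLaw μ G a) {B : Matrix (Fin d) (Fin d) ℝ}
    (hB : B.PosSemidef) {c : ℝ} (hc : ‖B‖ ≤ c) :
    ∫ x, (x ⬝ᵥ B *ᵥ x - (B * G).trace) ^ 2 ∂μ ≤ (c * √(a * G.trace)) ^ 2 := by
  have ha := h.one_le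
  have hk := h.trace_nonneg
  refine (h.integral_sub_sq_le hB).trans ?_
  rw [mul_pow, Real.sq_sqrt (by positivity)]
  have h1 := (le_abs_self _).trans (h.abs_trace_mul_le (B * B))
  have h2 : ‖B * B‖ ≤ c ^ 2 := (norm_mul_le _ _).trans (by nlinarith [norm_nonneg B])
  nlinarith [mul_le_mul_of_nonneg_right h2 hk]

theorem integral_sq_quadForm (h : RowLaw μ G a) {B : Matrix (Fin d) (Fin d) ℝ}
    (hB : B.PosSemidef) :
    ∫ x, (x ⬝ᵥ B *ᵥ x) ^ 2 ∂μ ≤ (B * G).trace ^ 2 + a * (B * B * G).trace := by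
  have := h.isProb
  have := h.variance_le B hB
  rw [variance_eq_sub (h.memLp_quadForm B), h.integral_quadForm] at this
  simp only [Pi.pow_apply] at this
  linarith

theorem normBound_sq (h : RowLaw μ G a) : normBound G a ^ 2 = G.trace ^ 2 + a * G.trace :=
  Real.sq_sqrt (by have := h.one_le; have := h.trace_nonneg; positivity)

theorem integral_dot_self_sq (h : RowLaw μ G a) :
    ∫ x, (x ⬝ᵥ x) ^ 2 ∂μ ≤ normBound G a ^ 2 := by
  rw [h.normBound_sq]
  simpa using h.integral_sq_quadForm Matrix.PosSemidef.one

/-- The coarse test bound, by the size of `xᵀx`. It is applied to `G` and `G²` in the variance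
estimates, where the smallness of `normBound G a / m` compensates for the loss. -/
theorem testBound_of_norm_le_one (h : RowLaw μ G a) {W : Matrix (Fin d) (Fin d) ℝ}
    (hW : ‖W‖ ≤ 1) : TestBound μ W (normBound G a) := by
  intro L R hL hR
  refine le_trans (integral_mono (h.memLp_quadForm _).integrable_sq h.memLp_dot_self.integrable_sq
    fun x => ?_) h.integral_dot_self_sq
  have h1 : ‖L * W * R‖ ≤ 1 := (norm_mul_le _ _).trans (mul_le_one₀
    ((norm_mul_le _ _).trans (mul_le_one₀ hL (norm_nonneg _) hW)) (norm_nonneg _) hR)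
  have h2 := abs_dotProduct_mulVec_self_le (L * W * R) x
  have h3 := dotProduct_self_nonneg' x
  rw [← sq_abs]
  exact pow_le_pow_left₀ (abs_nonneg _) (h2.trans (mul_le_of_le_one_left h3 h1)) 2

/-- The second moment bound at `B = uuᵀ` gives `w² + a|u|²w` with `w = uᵀGu`, and `w` is at most `1`
(as `G ≤ 1`) and at most `tr G`. -/
theorem integral_pow_four_le (h : RowLaw μ G a) {u : Fin d → ℝ} (hu : u ⬝ᵥ u ≤ 1) :
    ∫ x, ((u ⬝ᵥ x) ^ 2) ^ 2 ∂μ ≤ 2 * a * min 1 G.trace := by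
  have hB : (vecMulVec u u).PosSemidef := by
    simpa using Matrix.posSemidef_vecMulVec_self_star u
  have h1 := h.integral_sq_quadForm hB
  have e1 : ∀ x : Fin d → ℝ, x ⬝ᵥ vecMulVec u u *ᵥ x = (u ⬝ᵥ x) ^ 2 := by
    intro x
    rw [Matrix.vecMulVec_mulVec, op_smul_eq_smul, dotProduct_smul, smul_eq_mul,
      dotProduct_comm x, sq]
  have e2 : (vecMulVec u u * G).trace = u ⬝ᵥ G *ᵥ u := by
    have := trace_mul_vecMulVec_mul 1 G u u
    simpa using this
  have e3 : (vecMulVec u u * vecMulVec u u * G).trace = (u ⬝ᵥ u) * (u ⬝ᵥ G *ᵥ u) := by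
    have := trace_mul_vecMulVec_mul 1 G u u
    rw [Matrix.vecMulVec_mul_vecMulVec, Matrix.vecMulVec_smul, Matrix.smul_mul, Matrix.trace_smul,
      e2, smul_eq_mul]
  simp only [e1, e2, e3] at h1
  refine h1.trans ?_
  have hw0 := h.posSemidef.dotProduct_nonneg u
  have hw1 := (h.le_one u).trans hu
  have hwk : u ⬝ᵥ G *ᵥ u ≤ G.trace := by
    rw [← e2]
    refine (le_abs_self _).trans ((h.abs_trace_mul_le _).trans ?_)
    refine mul_le_of_le_one_left h.trace_nonneg (hB.l2_opNorm_le zero_le_one fun x => ?_)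
    rw [e1, one_mul, ← sq_abs, ← norm_toLp_sq x]
    refine pow_le_pow_left₀ (abs_nonneg _) ((abs_dotProduct_le_norm u x).trans ?_) 2
    exact mul_le_of_le_one_left (norm_nonneg _) (norm_toLp_le_one hu)
  have hmin : u ⬝ᵥ G *ᵥ u ≤ min 1 G.trace := le_min hw1 hwk
  have ha := h.one_le
  have hu0 := dotProduct_self_nonneg' u
  nlinarith [mul_le_mul_of_nonneg_left hmin (by linarith : 0 ≤ 2 * a),
    mul_le_mul_of_nonneg_right hu (mul_nonneg (by linarith : 0 ≤ a) hw0)]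

/-- The form `xᵀL(vuᵀ)Rx` is a product of two linear forms, so its square is at most the average of
two fourth powers. This sharp test bound is what produces `√(tr G)` in the bias. -/
theorem testBound_vecMulVec (h : RowLaw μ G a) {u v : Fin d → ℝ} (hu : u ⬝ᵥ u ≤ 1)
    (hv : v ⬝ᵥ v ≤ 1) : TestBound μ (vecMulVec v u) √(2 * a * min 1 G.trace) := by
  intro L R hL hR
  have ha := h.one_le
  have hk := h.trace_nonneg
  rw [Real.sq_sqrt (by positivity)]
  have hR' : ‖Rᵀ‖ ≤ 1 := by
    rw [← Matrix.conjTranspose_eq_transpose_of_trivial, Matrix.l2_opNorm_conjTranspose]; exact hR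
  have h1 := h.integral_pow_four_le (mulVec_dotProduct_self_le hL hv)
  have h2 := h.integral_pow_four_le (mulVec_dotProduct_self_le hR' hu)
  have hint : ∀ w : Fin d → ℝ, Integrable (fun x => ((w ⬝ᵥ x) ^ 2) ^ 2) μ := by
    intro w
    have := (h.memLp_quadForm (vecMulVec w w)).integrable_sq
    refine this.congr (ae_of_all _ fun x => ?_)
    simp only
    rw [Matrix.vecMulVec_mulVec, op_smul_eq_smul, dotProduct_smul, smul_eq_mul,
      dotProduct_comm x, sq (w ⬝ᵥ x)]
  have h3 := integral_mono (μ := μ) (h.memLp_quadForm (L * vecMulVec v u * R)).integrable_sq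
    (((hint (L *ᵥ v)).add (hint (Rᵀ *ᵥ u))).div_const 2) (fun x => by
      have : x ⬝ᵥ (L * vecMulVec v u * R) *ᵥ x = (L *ᵥ v ⬝ᵥ x) * (Rᵀ *ᵥ u ⬝ᵥ x) := by
        rw [Matrix.mul_vecMulVec, Matrix.vecMulVec_mul, Matrix.vecMulVec_mulVec,
          op_smul_eq_smul, dotProduct_smul, smul_eq_mul, Matrix.mulVec_transpose,
          dotProduct_comm x, mul_comm]
      simp only [this, Pi.add_apply]
      nlinarith [sq_nonneg ((L *ᵥ v ⬝ᵥ x) ^ 2 - (Rᵀ *ᵥ u ⬝ᵥ x) ^ 2)])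
  refine h3.trans ?_
  rw [integral_div]
  simp only [Pi.add_apply]
  rw [integral_add (hint _) (hint _)]
  linarith

end RowLaw

namespace TestBound

variable {μ : Measure (Fin d → ℝ)} {W : Matrix (Fin d) (Fin d) ℝ} {ρ : ℝ}

theorem integral_sq_le (hW : TestBound μ W ρ) {L R : Matrix (Fin d) (Fin d) ℝ} {l r : ℝ}
    (hl : 0 < l) (hr : 0 < r) (hL : ‖L‖ ≤ l) (hR : ‖R‖ ≤ r) :
    ∫ x, (x ⬝ᵥ (L * W * R) *ᵥ x) ^ 2 ∂μ ≤ (l * r * ρ) ^ 2 := by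
  have h := hW (l⁻¹ • L) (r⁻¹ • R)
    (by rw [norm_smul, Real.norm_of_nonneg (by positivity)]; field_simp; exact hL)
    (by rw [norm_smul, Real.norm_of_nonneg (by positivity)]; field_simp; exact hR)
  have e : ∀ x : Fin d → ℝ, (x ⬝ᵥ (L * W * R) *ᵥ x) ^ 2 =
      (l * r) ^ 2 * (x ⬝ᵥ (l⁻¹ • L * W * r⁻¹ • R) *ᵥ x) ^ 2 := by
    intro x
    simp only [Matrix.smul_mul, Matrix.mul_smul, Matrix.smul_mulVec, dotProduct_smul, smul_eq_mul]
    field_simp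
  simp only [e]
  rw [integral_const_mul, mul_pow (l * r)]
  exact mul_le_mul_of_nonneg_left h (by positivity)

end TestBound

end RowLaw

/-! ### Contribution of a single row with the other rows frozen -/

section OneRow

variable {d : ℕ}

/-- Contribution of the row `x` to `tr (W (Q - 1))`, where `Q = (B⁻¹ + γ x xᵀ)⁻¹`. -/
noncomputable def rowTerm (m γ : ℝ) (W G B : Matrix (Fin d) (Fin d) ℝ) (x : Fin d → ℝ) : ℝ :=
  (W * rankOneUpdate γ B x * G).trace / m - γ * (x ⬝ᵥ (W * rankOneUpdate γ B x) *ᵥ x)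

/-- Contribution of the row `x` to `tr (W (Q² - Q))`, where `Q = (B⁻¹ + γ x xᵀ)⁻¹`. -/
noncomputable def rowTermSq (m γ : ℝ) (W G B : Matrix (Fin d) (Fin d) ℝ) (x : Fin d → ℝ) : ℝ :=
  (W * (rankOneUpdate γ B x * rankOneUpdate γ B x) * G).trace / m -
    γ * (x ⬝ᵥ (W * (rankOneUpdate γ B x * rankOneUpdate γ B x)) *ᵥ x)

/-- The decomposition behind all mean estimates: `T` is a centered part `N`, a constant `M` and an
error dominated by `U`. Only the error enters the bound, so `N` may be of larger order. -/
theorem abs_integral_sub_le_of_abs_le {X : Type*} [MeasurableSpace X] {μ : Measure X}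
    [IsProbabilityMeasure μ] {T N U : X → ℝ} {M β : ℝ} (hT : Integrable T μ) (hN : Integrable N μ)
    (hU : Integrable U μ) (hN0 : ∫ x, N x ∂μ = 0) (hle : ∀ x, |T x - N x - M| ≤ U x)
    (hβ : ∫ x, U x ∂μ ≤ β) : |∫ x, T x ∂μ - M| ≤ β := by
  have e : ∫ x, T x ∂μ - M = ∫ x, (T x - N x - M) ∂μ := by
    rw [integral_sub (f := fun x => T x - N x) (hT.sub hN) (integrable_const M),
      integral_sub hT hN, hN0]
    simp
  rw [e]
  exact abs_integral_le_integral_abs.trans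
    ((integral_mono ((hT.sub hN).sub (integrable_const M)).abs hU hle).trans hβ)

section Scalar

variable {m γ k b₁ b₂ : ℝ}

theorem stepSize_bounds (hm : 1 ≤ m) (hk : 0 ≤ k) (hkm : 2 * k ≤ m) (hγ : γ * (m - k) = 1) :
    0 < γ ∧ γ ≤ 2 / m ∧ 1 / m ≤ γ := by
  have h1 : 0 < m - k := by linarith
  have h2 : γ = 1 / (m - k) := by field_simp; linarith
  refine ⟨by rw [h2]; positivity, ?_, ?_⟩
  · rw [h2, div_le_div_iff₀ h1 (by linarith)]; linarith
  · rw [h2]; exact one_div_le_one_div_of_le h1 (by linarith)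

/-- The reason for scaling by `m - k` instead of `m`: the Sherman–Morrison weight equals `1/m`
exactly when `b₁ = k`, and the defect carries the factor `b₁ - k`, which is a fluctuation when `b₁ =
xᵀBx`. -/
theorem inv_sub_stepSize_div (hm : 1 ≤ m) (hg : 1 + γ * b₁ ≠ 0) (hγ : γ * (m - k) = 1) :
    1 / m - γ / (1 + γ * b₁) = γ / (1 + γ * b₁) * (b₁ - k) / m := by
  have : m ≠ 0 := by linarith
  field_simp
  linarith

/-- Bounds on `β = γ / (1 + γ b₁)`. -/
theorem step_facts (hm : 1 ≤ m) (hk : 0 ≤ k) (hkm : 2 * k ≤ m) (hγ : γ * (m - k) = 1)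
    (hb₁ : 0 ≤ b₁) (hb₂ : b₂ ≤ 3 * b₁) :
    1 ≤ 1 + γ * b₁ ∧ 0 ≤ γ / (1 + γ * b₁) ∧ γ / (1 + γ * b₁) ≤ 2 / m ∧
      γ / (1 + γ * b₁) * b₂ ≤ 3 := by
  obtain ⟨h0, h1, h2⟩ := stepSize_bounds hm hk hkm hγ
  have hg : 1 ≤ 1 + γ * b₁ := by nlinarith [mul_nonneg h0.le hb₁]
  refine ⟨hg, by positivity, (div_le_self h0.le hg).trans h1, ?_⟩
  -- `γ b₂ ≤ 3 γ b₁ ≤ 3 (1 + γ b₁)`: the denominator tames the quadratic form uniformly, although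
  -- `x` is unbounded.
  rw [div_mul_eq_mul_div, div_le_iff₀ (by linarith)]
  nlinarith

end Scalar

section Bounds

variable {μ : Measure (Fin d → ℝ)} {W G B : Matrix (Fin d) (Fin d) ℝ} {a ρ m γ : ℝ}

theorem IsResolvent.norm_mul_self_le (hB : IsResolvent B) : ‖B * B‖ ≤ 9 :=
  (norm_mul_le _ _).trans (by nlinarith [hB.norm_le, norm_nonneg B])

theorem TestBound.integral_sq_right_le (hW : TestBound μ W ρ) {R : Matrix (Fin d) (Fin d) ℝ}
    {r : ℝ} (hr : 0 < r) (hR : ‖R‖ ≤ r) :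
    ∫ x, (x ⬝ᵥ (W * R) *ᵥ x) ^ 2 ∂μ ≤ (r * ρ) ^ 2 := by
  have h1 : ‖(1 : Matrix (Fin d) (Fin d) ℝ)‖ ≤ 1 :=
    Matrix.PosSemidef.one.l2_opNorm_le zero_le_one (by simp)
  simpa using hW.integral_sq_le one_pos hr h1 hR

theorem RowLaw.abs_trace_le (h : RowLaw μ G a) {K : Matrix (Fin d) (Fin d) ℝ} {A : ℝ}
    (hA : 0 ≤ A) (hK : ∫ x, (x ⬝ᵥ K *ᵥ x) ^ 2 ∂μ ≤ A ^ 2) : |(K * G).trace| ≤ A := by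
  have := h.isProb
  rw [← h.integral_quadForm]
  exact abs_integral_le_integral_abs.trans (integral_abs_le_of_sq (h.memLp_quadForm K) hA hK)

theorem RowLaw.memLp_sub (h : RowLaw μ G a) (K : Matrix (Fin d) (Fin d) ℝ) (c : ℝ) :
    MemLp (fun x : Fin d → ℝ => x ⬝ᵥ K *ᵥ x - c) 2 μ :=
  haveI := h.isProb
  (h.memLp_quadForm K).sub (memLp_const c)

@[fun_prop]
theorem measurable_rowTerm : Measurable (rowTerm m γ W G B) := by
  unfold rowTerm rankOneUpdate
  simp only [Matrix.trace, Matrix.diag, Matrix.mul_apply, dotProduct, Matrix.mulVec,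
    Matrix.sub_apply, Matrix.smul_apply, Matrix.vecMulVec_apply, smul_eq_mul]
  fun_prop

@[fun_prop]
theorem measurable_rowTermSq : Measurable (rowTermSq m γ W G B) := by
  unfold rowTermSq rankOneUpdate
  simp only [Matrix.trace, Matrix.diag, Matrix.mul_apply, dotProduct, Matrix.mulVec,
    Matrix.sub_apply, Matrix.smul_apply, Matrix.vecMulVec_apply, smul_eq_mul]
  fun_prop

/-- A size estimate of order `1/m` without any cancellation, used for square integrability and for
the `L²` norm of the row term. -/
theorem abs_rowTerm_le (h : RowLaw μ G a) (hB : IsResolvent B) (hm : 1 ≤ m)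
    (hkm : 2 * G.trace ≤ m) (hγ : γ * (m - G.trace) = 1) (x : Fin d → ℝ) :
    |rowTerm m γ W G B x| ≤ (1 / m) * (|(W * B * G).trace| + 2 * |x ⬝ᵥ (B * G * W * B) *ᵥ x| +
      2 * |x ⬝ᵥ (W * B) *ᵥ x|) := by
  have hb₁ := hB.posSemidef.dotProduct_nonneg x
  obtain ⟨hg, hβ0, hβ, -⟩ := step_facts hm h.trace_nonneg hkm hγ hb₁ (hB.sq_le x)
  rw [rowTerm, trace_rankOneUpdate hB.posSemidef.transpose_eq,
    quadForm_rankOneUpdate (by positivity)]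
  set g := 1 + γ * (x ⬝ᵥ B *ᵥ x)
  set t := (W * B * G).trace
  set q := x ⬝ᵥ (B * G * W * B) *ᵥ x
  set w := x ⬝ᵥ (W * B) *ᵥ x
  have e : (t - γ / g * q) / m - γ * (w / g) = (1 / m) * (t - γ / g * q) - γ / g * w := by
    ring
  have hm0 : 0 < 1 / m := by positivity
  have hβ2 : γ / g ≤ 2 := hβ.trans ((div_le_iff₀ (by linarith)).2 (by linarith))
  have hβ3 : γ / g ≤ 1 / m * 2 := by rw [one_div_mul_eq_div]; exact hβ
  rw [e]
  calc |1 / m * (t - γ / g * q) - γ / g * w| ≤ 1 / m * (|t| + γ / g * |q|) + γ / g * |w| := by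
        refine (abs_sub _ _).trans ?_
        rw [abs_mul, abs_mul, abs_of_pos hm0, abs_of_nonneg hβ0]
        gcongr
        refine (abs_sub _ _).trans ?_
        rw [abs_mul, abs_of_nonneg hβ0]
    _ ≤ 1 / m * (|t| + 2 * |q|) + (1 / m * 2) * |w| := by gcongr
    _ = _ := by ring

theorem abs_rowTermSq_le (h : RowLaw μ G a) (hB : IsResolvent B) (hm : 1 ≤ m)
    (hkm : 2 * G.trace ≤ m) (hγ : γ * (m - G.trace) = 1) (x : Fin d → ℝ) :
    |rowTermSq m γ W G B x| ≤ (1 / m) * (|(W * (B * B) * G).trace| +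
      2 * |x ⬝ᵥ (B * G * W * (B * B)) *ᵥ x| + 2 * |x ⬝ᵥ (B * B * G * W * B) *ᵥ x| +
      6 * |x ⬝ᵥ (B * G * W * B) *ᵥ x| + 2 * |x ⬝ᵥ (W * (B * B)) *ᵥ x| +
      6 * |x ⬝ᵥ (W * B) *ᵥ x|) := by
  have hb₁ := hB.posSemidef.dotProduct_nonneg x
  have hBB : (B * B).PosSemidef := by
    have := hB.posSemidef.pow 2
    rwa [sq] at this
  have hb₂ := hBB.dotProduct_nonneg x
  obtain ⟨hg, hβ0, hβ, hβb⟩ := step_facts hm h.trace_nonneg hkm hγ hb₁ (hB.sq_le x)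
  rw [rowTermSq, trace_rankOneUpdate_sq hB.posSemidef.transpose_eq,
    quadForm_rankOneUpdate_sq hB.posSemidef.transpose_eq (by positivity)]
  set g := 1 + γ * (x ⬝ᵥ B *ᵥ x)
  set b₂ := x ⬝ᵥ (B * B) *ᵥ x
  set t := (W * (B * B) * G).trace
  set q₁ := x ⬝ᵥ (B * G * W * B) *ᵥ x
  set q₂ := x ⬝ᵥ (B * G * W * (B * B)) *ᵥ x
  set q₃ := x ⬝ᵥ (B * B * G * W * B) *ᵥ x
  set w₁ := x ⬝ᵥ (W * (B * B)) *ᵥ x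
  set w₀ := x ⬝ᵥ (W * B) *ᵥ x
  have e : (t - γ / g * (q₂ + q₃) + (γ / g) ^ 2 * b₂ * q₁) / m -
      γ * (w₁ / g - γ / g ^ 2 * b₂ * w₀) =
      (1 / m) * (t - γ / g * (q₂ + q₃) + (γ / g) * (γ / g * b₂) * q₁) - γ / g * w₁ +
      γ / g * (γ / g * b₂) * w₀ := by
    field_simp
    ring
  have hm0 : 0 < 1 / m := by positivity
  have hβ2 : γ / g ≤ 2 := hβ.trans ((div_le_iff₀ (by linarith)).2 (by linarith))
  have hβ3 : γ / g ≤ 1 / m * 2 := by rw [one_div_mul_eq_div]; exact hβ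
  rw [e]
  set β := γ / g
  have hs0 : 0 ≤ β * b₂ := by positivity
  set s := β * b₂
  calc |1 / m * (t - β * (q₂ + q₃) + β * s * q₁) - β * w₁ + β * s * w₀|
      ≤ 1 / m * (|t| + β * (|q₂| + |q₃|) + β * s * |q₁|) + β * |w₁| + β * s * |w₀| := by
        refine (abs_add_le _ _).trans ?_
        rw [abs_mul (β * s), abs_of_nonneg (mul_nonneg hβ0 hs0)]
        gcongr
        refine (abs_sub _ _).trans ?_
        rw [abs_mul, abs_mul β, abs_of_pos hm0, abs_of_nonneg hβ0]
        gcongr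
        refine (abs_add_le _ _).trans ?_
        rw [abs_mul (β * s), abs_of_nonneg (mul_nonneg hβ0 hs0)]
        gcongr
        refine (abs_sub _ _).trans ?_
        rw [abs_mul, abs_of_nonneg hβ0]
        gcongr
        exact abs_add_le _ _
    _ ≤ 1 / m * (|t| + 2 * (|q₂| + |q₃|) + 2 * 3 * |q₁|) + (1 / m * 2) * |w₁| +
        (1 / m * 2) * 3 * |w₀| := by gcongr
    _ = _ := by ring

/-- After removal of the centered linear part, the coefficient of `xᵀWBx` is `1/m - γ/(1 + γ xᵀBx)`,
itself of order `1/m` times `xᵀBx - k`. Splitting `xᵀBx - k` at `tr(BG)` separates the randomness of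
`x` from that of `B`. The `- 0` records that no mean term survives. -/
theorem abs_rowTerm_sub_le (h : RowLaw μ G a) (hB : IsResolvent B) (hm : 1 ≤ m)
    (hkm : 2 * G.trace ≤ m) (hγ : γ * (m - G.trace) = 1) (x : Fin d → ℝ) :
    |rowTerm m γ W G B x - (1 / m) * ((W * B * G).trace - x ⬝ᵥ (W * B) *ᵥ x) - 0| ≤
      (1 / m ^ 2) * (2 * |(x ⬝ᵥ (W * B) *ᵥ x) * (x ⬝ᵥ B *ᵥ x - (B * G).trace)| +
        2 * |(B * G).trace - G.trace| * |x ⬝ᵥ (W * B) *ᵥ x| +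
        2 * |x ⬝ᵥ (B * G * W * B) *ᵥ x|) := by
  have hb₁ := hB.posSemidef.dotProduct_nonneg x
  obtain ⟨hg, hβ0, hβ, -⟩ := step_facts hm h.trace_nonneg hkm hγ hb₁ (hB.sq_le x)
  have hid := inv_sub_stepSize_div (b₁ := x ⬝ᵥ B *ᵥ x) hm (by positivity) hγ
  rw [rowTerm, trace_rankOneUpdate hB.posSemidef.transpose_eq,
    quadForm_rankOneUpdate (by positivity)]
  set b₁ := x ⬝ᵥ B *ᵥ x
  set g := 1 + γ * b₁
  set t := (W * B * G).trace
  set t₁ := (B * G).trace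
  set q := x ⬝ᵥ (B * G * W * B) *ᵥ x
  set w := x ⬝ᵥ (W * B) *ᵥ x
  have hm0 : 0 < 1 / m := by positivity
  have hβ3 : γ / g ≤ 1 / m * 2 := by rw [one_div_mul_eq_div]; exact hβ
  have e : (t - γ / g * q) / m - γ * (w / g) - 1 / m * (t - w) - 0 =
      γ / g * (1 / m) * (w * (b₁ - t₁)) + γ / g * (1 / m) * ((t₁ - G.trace) * w) -
        γ / g * (1 / m) * q := by
    linear_combination w * hid
  rw [e]
  set β := γ / g
  calc _ ≤ β * (1 / m) * |w * (b₁ - t₁)| + β * (1 / m) * |(t₁ - G.trace) * w| +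
        β * (1 / m) * |q| := by
        have h0 : 0 ≤ β * (1 / m) := by positivity
        refine (abs_sub _ _).trans ?_
        rw [abs_mul _ q, abs_of_nonneg h0]
        gcongr
        refine (abs_add_le _ _).trans ?_
        rw [abs_mul _ (w * _), abs_mul _ (_ * w), abs_of_nonneg h0]
    _ ≤ (1 / m * 2) * (1 / m) * |w * (b₁ - t₁)| +
        (1 / m * 2) * (1 / m) * |(t₁ - G.trace) * w| + (1 / m * 2) * (1 / m) * |q| := by gcongr
    _ = _ := by rw [abs_mul (t₁ - _)]; ring

/-- Here the product `β² (xᵀB²x)(xᵀWBx)` with `β = γ/(1 + γ xᵀBx)` has a mean that does not cancel: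
replacing `β` by `1/m` and `xᵀB²x` by `tr(B²G)` leaves the constant `tr(B²G) tr(WBG)/m²` plus a
centered part. -/
theorem abs_rowTermSq_sub_le (h : RowLaw μ G a) (hB : IsResolvent B) (hm : 1 ≤ m)
    (hkm : 2 * G.trace ≤ m) (hγ : γ * (m - G.trace) = 1) (x : Fin d → ℝ) :
    |rowTermSq m γ W G B x - ((1 / m) * ((W * (B * B) * G).trace - x ⬝ᵥ (W * (B * B)) *ᵥ x) -
        (1 / m ^ 2) * (B * B * G).trace * ((W * B * G).trace - x ⬝ᵥ (W * B) *ᵥ x)) -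
        (1 / m ^ 2) * ((B * B * G).trace * (W * B * G).trace)| ≤
      (1 / m ^ 2) * (2 * |(x ⬝ᵥ (W * (B * B)) *ᵥ x) * (x ⬝ᵥ B *ᵥ x - (B * G).trace)| +
        2 * |(B * G).trace - G.trace| * |x ⬝ᵥ (W * (B * B)) *ᵥ x| +
        2 * |x ⬝ᵥ (B * G * W * (B * B)) *ᵥ x| + 2 * |x ⬝ᵥ (B * B * G * W * B) *ᵥ x| +
        6 * |x ⬝ᵥ (B * G * W * B) *ᵥ x| +
        9 * |(x ⬝ᵥ (W * B) *ᵥ x) * (x ⬝ᵥ B *ᵥ x - (B * G).trace)| +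
        9 * |(B * G).trace - G.trace| * |x ⬝ᵥ (W * B) *ᵥ x| +
        |(x ⬝ᵥ (W * B) *ᵥ x) * (x ⬝ᵥ (B * B) *ᵥ x - (B * B * G).trace)|) := by
  have hb₁ := hB.posSemidef.dotProduct_nonneg x
  have hBB : (B * B).PosSemidef := by
    have := hB.posSemidef.pow 2
    rwa [sq] at this
  have hb₂ := hBB.dotProduct_nonneg x
  obtain ⟨hg, hβ0, hβ, hβb⟩ := step_facts hm h.trace_nonneg hkm hγ hb₁ (hB.sq_le x)
  have hid := inv_sub_stepSize_div (b₁ := x ⬝ᵥ B *ᵥ x) hm (by positivity) hγ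
  rw [rowTermSq, trace_rankOneUpdate_sq hB.posSemidef.transpose_eq,
    quadForm_rankOneUpdate_sq hB.posSemidef.transpose_eq (by positivity)]
  set b₁ := x ⬝ᵥ B *ᵥ x
  set g := 1 + γ * b₁
  set b₂ := x ⬝ᵥ (B * B) *ᵥ x
  set t := (W * B * G).trace
  set t' := (W * (B * B) * G).trace
  set t₁ := (B * G).trace
  set t₂ := (B * B * G).trace
  set k := G.trace
  set q₁ := x ⬝ᵥ (B * G * W * B) *ᵥ x
  set q₂ := x ⬝ᵥ (B * G * W * (B * B)) *ᵥ x
  set q₃ := x ⬝ᵥ (B * B * G * W * B) *ᵥ x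
  set w₁ := x ⬝ᵥ (W * (B * B)) *ᵥ x
  set w₀ := x ⬝ᵥ (W * B) *ᵥ x
  have hm0 : 0 < 1 / m := by positivity
  have hβ3 : γ / g ≤ 1 / m * 2 := by rw [one_div_mul_eq_div]; exact hβ
  have e0 : (t' - γ / g * (q₂ + q₃) + (γ / g) ^ 2 * b₂ * q₁) / m -
      γ * (w₁ / g - γ / g ^ 2 * b₂ * w₀) =
      (1 / m) * (t' - γ / g * (q₂ + q₃) + (γ / g) * (γ / g * b₂) * q₁) - γ / g * w₁ +
      γ / g * (γ / g * b₂) * w₀ := by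
    field_simp
    ring
  rw [e0]
  set β := γ / g
  have hs0 : 0 ≤ β * b₂ := by positivity
  -- Both `1/m - β` and `1/m² - β² = (1/m - β)(1/m + β)` are rewritten through `β (b₁ - k)/m`, which
  -- explains the factor `β + 1/m`.
  have e : 1 / m * (t' - β * (q₂ + q₃) + β * (β * b₂) * q₁) - β * w₁ + β * (β * b₂) * w₀ -
      (1 / m * (t' - w₁) - 1 / m ^ 2 * t₂ * (t - w₀)) - 1 / m ^ 2 * (t₂ * t) =
      (1 / m) * β * (w₁ * (b₁ - t₁)) + (1 / m) * β * ((t₁ - k) * w₁) - (1 / m) * β * q₂ -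
      (1 / m) * β * q₃ + (1 / m) * β * (β * b₂) * q₁ -
      (1 / m) * (β * b₂) * (β + 1 / m) * (w₀ * (b₁ - t₁)) -
      (1 / m) * (β * b₂) * (β + 1 / m) * ((t₁ - k) * w₀) +
      (1 / m ^ 2) * (w₀ * (b₂ - t₂)) := by
    linear_combination (w₁ - b₂ * (β + 1 / m) * w₀) * hid
  rw [e]
  clear_value β
  set s := β * b₂
  calc _ ≤ (1 / m) * β * |w₁ * (b₁ - t₁)| + (1 / m) * β * |(t₁ - k) * w₁| + (1 / m) * β * |q₂| +
      (1 / m) * β * |q₃| + (1 / m) * β * s * |q₁| +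
      (1 / m) * s * (β + 1 / m) * |w₀ * (b₁ - t₁)| +
      (1 / m) * s * (β + 1 / m) * |(t₁ - k) * w₀| +
      (1 / m ^ 2) * |w₀ * (b₂ - t₂)| := by
        have h0 : 0 ≤ 1 / m * β := by positivity
        have h1 : 0 ≤ 1 / m * s * (β + 1 / m) := by positivity
        have h2 : 0 ≤ 1 / m * β * s := by positivity
        have h3 : 0 ≤ 1 / m ^ 2 := by positivity
        simp only [abs_le]
        constructor <;>
        · have a1 := mul_le_mul_of_nonneg_left (le_abs_self (w₁ * (b₁ - t₁))) h0
          have a2 := mul_le_mul_of_nonneg_left (le_abs_self ((t₁ - k) * w₁)) h0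
          have a3 := mul_le_mul_of_nonneg_left (le_abs_self q₂) h0
          have a4 := mul_le_mul_of_nonneg_left (le_abs_self q₃) h0
          have a5 := mul_le_mul_of_nonneg_left (le_abs_self q₁) h2
          have a6 := mul_le_mul_of_nonneg_left (le_abs_self (w₀ * (b₁ - t₁))) h1
          have a7 := mul_le_mul_of_nonneg_left (le_abs_self ((t₁ - k) * w₀)) h1
          have a8 := mul_le_mul_of_nonneg_left (le_abs_self (w₀ * (b₂ - t₂))) h3
          have b1 := mul_le_mul_of_nonneg_left (neg_abs_le (w₁ * (b₁ - t₁))) h0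
          have b2 := mul_le_mul_of_nonneg_left (neg_abs_le ((t₁ - k) * w₁)) h0
          have b3 := mul_le_mul_of_nonneg_left (neg_abs_le q₂) h0
          have b4 := mul_le_mul_of_nonneg_left (neg_abs_le q₃) h0
          have b5 := mul_le_mul_of_nonneg_left (neg_abs_le q₁) h2
          have b6 := mul_le_mul_of_nonneg_left (neg_abs_le (w₀ * (b₁ - t₁))) h1
          have b7 := mul_le_mul_of_nonneg_left (neg_abs_le ((t₁ - k) * w₀)) h1
          have b8 := mul_le_mul_of_nonneg_left (neg_abs_le (w₀ * (b₂ - t₂))) h3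
          linarith
    _ ≤ (1 / m) * (1 / m * 2) * |w₁ * (b₁ - t₁)| + (1 / m) * (1 / m * 2) * |(t₁ - k) * w₁| +
      (1 / m) * (1 / m * 2) * |q₂| +
      (1 / m) * (1 / m * 2) * |q₃| + (1 / m) * (1 / m * 2) * 3 * |q₁| +
      (1 / m) * 3 * (1 / m * 2 + 1 / m) * |w₀ * (b₁ - t₁)| +
      (1 / m) * 3 * (1 / m * 2 + 1 / m) * |(t₁ - k) * w₀| +
      (1 / m ^ 2) * |w₀ * (b₂ - t₂)| := by gcongr
    _ = _ := by
      rw [abs_mul (t₁ - k), abs_mul (t₁ - k)]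
      field_simp
      ring

/-- `T` has `L²` norm at most `A` and its mean is within `β` of `M`. -/
structure HasMomentBounds {X : Type*} [MeasurableSpace X] (μ : Measure X) (T : X → ℝ)
    (M A β : ℝ) : Prop where
  memLp : MemLp T 2 μ
  integral_sq_le : ∫ x, T x ^ 2 ∂μ ≤ A ^ 2
  abs_integral_sub_le : |∫ x, T x ∂μ - M| ≤ β

theorem IsResolvent.norm_mul_moment_le (hB : IsResolvent B) (h : RowLaw μ G a) : ‖B * G‖ ≤ 3 :=
  (norm_mul_le _ _).trans (by
    nlinarith [hB.norm_le, norm_nonneg B, h.norm_le_one, norm_nonneg G])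

theorem IsResolvent.norm_mul_self_mul_moment_le (hB : IsResolvent B) (h : RowLaw μ G a) :
    ‖B * B * G‖ ≤ 9 :=
  (norm_mul_le _ _).trans (by
    nlinarith [hB.norm_mul_self_le, norm_nonneg (B * B), h.norm_le_one, norm_nonneg G])

theorem IsResolvent.posSemidef_mul_self (hB : IsResolvent B) : (B * B).PosSemidef := by
  have := hB.posSemidef.pow 2
  rwa [sq] at this

end Bounds

end OneRow

/-! ### Mean and second moment bounds assembled from `L²` norms -/

section Aux
variable {X : Type*} [MeasurableSpace X] {μ : Measure X}

theorem memLp_const_mul_abs {f : X → ℝ} (hf : MemLp f 2 μ) (c : ℝ) :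
    MemLp (fun x => c * |f x|) 2 μ := by
  have := hf.norm.const_mul c
  simpa only [Real.norm_eq_abs] using this

theorem MeasureTheory.MemLp.add_fun {f g : X → ℝ} (hf : MemLp f 2 μ) (hg : MemLp g 2 μ) :
    MemLp (fun x => f x + g x) 2 μ := hf.add hg

theorem MeasureTheory.Integrable.add_fun {f g : X → ℝ} (hf : Integrable f μ)
    (hg : Integrable g μ) : Integrable (fun x => f x + g x) μ := hf.add hg

theorem integral_const_mul_le {f : X → ℝ} {c A : ℝ} (hc : 0 ≤ c)
    (h : ∫ x, f x ∂μ ≤ A) : ∫ x, c * f x ∂μ ≤ c * A := by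
  rw [integral_const_mul]; exact mul_le_mul_of_nonneg_left h hc

theorem integral_add_le {f g : X → ℝ} {A B : ℝ} (hf : Integrable f μ) (hg : Integrable g μ)
    (hA : ∫ x, f x ∂μ ≤ A) (hB : ∫ x, g x ∂μ ≤ B) : ∫ x, (f x + g x) ∂μ ≤ A + B := by
  rw [integral_add hf hg]; exact add_le_add hA hB

/-- A real function bounded by a nonnegative constant in absolute mean. -/
structure MeanAbsLe (μ : Measure X) (f : X → ℝ) (A : ℝ) : Prop where
  integrable : Integrable f μ
  integral_le : ∫ x, f x ∂μ ≤ A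

theorem MeanAbsLe.add {f g : X → ℝ} {A B : ℝ} (hf : MeanAbsLe μ f A) (hg : MeanAbsLe μ g B) :
    MeanAbsLe μ (fun x => f x + g x) (A + B) :=
  ⟨hf.1.add hg.1, integral_add_le hf.1 hg.1 hf.2 hg.2⟩

theorem MeanAbsLe.const_mul {f : X → ℝ} {A c : ℝ} (hc : 0 ≤ c) (hf : MeanAbsLe μ f A) :
    MeanAbsLe μ (fun x => c * f x) (c * A) :=
  ⟨hf.1.const_mul c, integral_const_mul_le hc hf.2⟩

theorem meanAbsLe_abs [IsProbabilityMeasure μ] {f : X → ℝ} (hf : MemLp f 2 μ) {A : ℝ}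
    (hA : 0 ≤ A) (h : ∫ x, f x ^ 2 ∂μ ≤ A ^ 2) : MeanAbsLe μ (fun x => |f x|) A :=
  ⟨(hf.integrable (by norm_num)).abs, integral_abs_le_of_sq hf hA h⟩

theorem meanAbsLe_abs_mul {f g : X → ℝ} (hf : MemLp f 2 μ) (hg : MemLp g 2 μ) {A B : ℝ}
    (hA : 0 ≤ A) (hB : 0 ≤ B) (h : ∫ x, f x ^ 2 ∂μ ≤ A ^ 2) (h' : ∫ x, g x ^ 2 ∂μ ≤ B ^ 2) :
    MeanAbsLe μ (fun x => |f x * g x|) (A * B) :=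
  ⟨(hf.integrable_mul hg).abs, integral_abs_mul_le hf hg hA hB h h'⟩

theorem meanAbsLe_sq {f : X → ℝ} (hf : MemLp f 2 μ) {A : ℝ} (h : ∫ x, f x ^ 2 ∂μ ≤ A ^ 2) :
    MeanAbsLe μ (fun x => f x ^ 2) (A ^ 2) := ⟨hf.integrable_sq, h⟩

theorem meanAbsLe_const [IsProbabilityMeasure μ] (c : ℝ) : MeanAbsLe μ (fun _ => c) c :=
  ⟨integrable_const c, by simp⟩

theorem MeanAbsLe.integral_le_of_le {f g : X → ℝ} {A : ℝ} (hf : MeanAbsLe μ f A)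
    (hg : Integrable g μ) (h : ∀ x, g x ≤ f x) : ∫ x, g x ∂μ ≤ A :=
  (integral_mono hg hf.1 h).trans hf.2

/-- Cauchy–Schwarz on the product `w v` and `L¹ ≤ L²` on the rest. The constants `250` and `200` are
generous here; they are dictated by the quadratic analogue so that both cases share one bound. -/
theorem hasMomentBounds_of_le [IsProbabilityMeasure μ] {T w q v : X → ℝ} {m t f σ ρ : ℝ}
    (hm : 1 ≤ m) (hρ : 0 ≤ ρ) (hσ : 0 ≤ σ) (hT : Measurable T)
    (hdom : ∀ x, |T x| ≤ 1 / m * (|t| + 2 * |q x| + 2 * |w x|))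
    (hsub : ∀ x, |T x - 1 / m * (t - w x) - 0| ≤
      1 / m ^ 2 * (2 * |w x * v x| + 2 * |f| * |w x| + 2 * |q x|))
    (hw : MemLp w 2 μ) (hq : MemLp q 2 μ) (hv : MemLp v 2 μ)
    (hN : ∫ x, 1 / m * (t - w x) ∂μ = 0) (ht : |t| ≤ 3 * ρ)
    (hw2 : ∫ x, w x ^ 2 ∂μ ≤ (3 * ρ) ^ 2) (hq2 : ∫ x, q x ^ 2 ∂μ ≤ (3 * 3 * ρ) ^ 2)
    (hv2 : ∫ x, v x ^ 2 ∂μ ≤ (3 * σ) ^ 2) :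
    HasMomentBounds μ T 0 (250 * ρ / m) (200 * ρ / m ^ 2 * (σ + |f| + 1)) := by
  have hmem : MemLp T 2 μ := by
    have hd := (((memLp_const (μ := μ) |t|).add_fun (memLp_const_mul_abs hq 2)).add_fun
      (memLp_const_mul_abs hw 2)).const_mul (1 / m)
    refine hd.mono hT.aestronglyMeasurable (ae_of_all _ fun x => ?_)
    rw [Real.norm_eq_abs, Real.norm_eq_abs]
    exact (hdom x).trans (le_abs_self _)
  refine ⟨hmem, ?_, ?_⟩
  · have B2 := ((((meanAbsLe_const (μ := μ) ((3 * ρ) ^ 2)).add ((meanAbsLe_sq hq hq2).const_mul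
      (by norm_num : (0:ℝ) ≤ 4))).add ((meanAbsLe_sq hw hw2).const_mul
      (by norm_num : (0:ℝ) ≤ 4))).const_mul (by norm_num : (0:ℝ) ≤ 3)).const_mul
      (by positivity : 0 ≤ (1 / m) ^ 2)
    refine (B2.integral_le_of_le hmem.integrable_sq fun x => ?_).trans ?_
    · have h1 := pow_le_pow_left₀ (abs_nonneg _) (hdom x) 2
      rw [sq_abs, mul_pow] at h1
      refine h1.trans (mul_le_mul_of_nonneg_left ?_ (by positivity))
      have h2 : |t| ^ 2 ≤ (3 * ρ) ^ 2 := pow_le_pow_left₀ (abs_nonneg _) ht 2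
      rw [← sq_abs (q x), ← sq_abs (w x)]
      nlinarith [sq_nonneg (|t| - 2 * |q x|), sq_nonneg (|t| - 2 * |w x|),
        sq_nonneg (|q x| - |w x|)]
    · have e : (250 * ρ / m) ^ 2 = (1 / m) ^ 2 * (62500 * ρ ^ 2) := by ring
      rw [e]
      refine mul_le_mul_of_nonneg_left ?_ (by positivity)
      nlinarith [sq_nonneg ρ]
  · have B1 := ((((meanAbsLe_abs_mul hw hv (by positivity) (by positivity) hw2 hv2).const_mul
      (by norm_num : (0:ℝ) ≤ 2)).add ((meanAbsLe_abs hw (by positivity) hw2).const_mul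
      (by positivity : 0 ≤ 2 * |f|))).add ((meanAbsLe_abs hq (by positivity) hq2).const_mul
      (by norm_num : (0:ℝ) ≤ 2))).const_mul (by positivity : 0 ≤ 1 / m ^ 2)
    refine abs_integral_sub_le_of_abs_le (hmem.integrable (by norm_num))
      (((integrable_const t).sub (hw.integrable (by norm_num))).const_mul (1 / m)) B1.1 hN hsub
      (B1.2.trans ?_)
    have e : 200 * ρ / m ^ 2 * (σ + |f| + 1) =
        1 / m ^ 2 * (200 * ρ * (σ + |f| + 1)) := by ring
    rw [e]
    refine mul_le_mul_of_nonneg_left ?_ (by positivity)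
    have p1 := mul_nonneg hρ hσ
    have p2 := mul_nonneg hρ (abs_nonneg f)
    nlinarith

theorem hasMomentBounds_of_le_sq [IsProbabilityMeasure μ] {T w₀ w₁ q₁ q₂ q₃ v₁ v₂ : X → ℝ}
    {m t t' t₂ f σ ρ : ℝ} (hm : 1 ≤ m) (hρ : 0 ≤ ρ) (hσ : 0 ≤ σ) (hT : Measurable T)
    (hdom : ∀ x, |T x| ≤ 1 / m * (|t'| + 2 * |q₂ x| + 2 * |q₃ x| + 6 * |q₁ x| + 2 * |w₁ x| +
      6 * |w₀ x|))
    (hsub : ∀ x, |T x - (1 / m * (t' - w₁ x) - 1 / m ^ 2 * t₂ * (t - w₀ x)) -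
        1 / m ^ 2 * (t₂ * t)| ≤
      1 / m ^ 2 * (2 * |w₁ x * v₁ x| + 2 * |f| * |w₁ x| + 2 * |q₂ x| + 2 * |q₃ x| +
        6 * |q₁ x| + 9 * |w₀ x * v₁ x| + 9 * |f| * |w₀ x| + |w₀ x * v₂ x|))
    (hw₀ : MemLp w₀ 2 μ) (hw₁ : MemLp w₁ 2 μ) (hq₁ : MemLp q₁ 2 μ) (hq₂ : MemLp q₂ 2 μ)
    (hq₃ : MemLp q₃ 2 μ) (hv₁ : MemLp v₁ 2 μ) (hv₂ : MemLp v₂ 2 μ)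
    (hN₁ : ∫ x, 1 / m * (t' - w₁ x) ∂μ = 0)
    (hN₂ : ∫ x, 1 / m ^ 2 * t₂ * (t - w₀ x) ∂μ = 0) (ht : |t'| ≤ 9 * ρ)
    (hw₀2 : ∫ x, w₀ x ^ 2 ∂μ ≤ (3 * ρ) ^ 2) (hw₁2 : ∫ x, w₁ x ^ 2 ∂μ ≤ (9 * ρ) ^ 2)
    (hq₁2 : ∫ x, q₁ x ^ 2 ∂μ ≤ (3 * 3 * ρ) ^ 2) (hq₂2 : ∫ x, q₂ x ^ 2 ∂μ ≤ (3 * 9 * ρ) ^ 2)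
    (hq₃2 : ∫ x, q₃ x ^ 2 ∂μ ≤ (9 * 3 * ρ) ^ 2)
    (hv₁2 : ∫ x, v₁ x ^ 2 ∂μ ≤ (3 * σ) ^ 2) (hv₂2 : ∫ x, v₂ x ^ 2 ∂μ ≤ (9 * σ) ^ 2) :
    HasMomentBounds μ T (1 / m ^ 2 * (t₂ * t)) (250 * ρ / m)
      (200 * ρ / m ^ 2 * (σ + |f| + 1)) := by
  have hmem : MemLp T 2 μ := by
    have hd := ((((((memLp_const (μ := μ) |t'|).add_fun (memLp_const_mul_abs hq₂ 2)).add_fun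
      (memLp_const_mul_abs hq₃ 2)).add_fun (memLp_const_mul_abs hq₁ 6)).add_fun
      (memLp_const_mul_abs hw₁ 2)).add_fun (memLp_const_mul_abs hw₀ 6)).const_mul (1 / m)
    refine hd.mono hT.aestronglyMeasurable (ae_of_all _ fun x => ?_)
    rw [Real.norm_eq_abs, Real.norm_eq_abs]
    exact (hdom x).trans (le_abs_self _)
  refine ⟨hmem, ?_, ?_⟩
  · have B2 := (((((((meanAbsLe_const (μ := μ) ((9 * ρ) ^ 2)).add
      ((meanAbsLe_sq hq₂ hq₂2).const_mul (by norm_num : (0:ℝ) ≤ 4))).add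
      ((meanAbsLe_sq hq₃ hq₃2).const_mul (by norm_num : (0:ℝ) ≤ 4))).add
      ((meanAbsLe_sq hq₁ hq₁2).const_mul (by norm_num : (0:ℝ) ≤ 36))).add
      ((meanAbsLe_sq hw₁ hw₁2).const_mul (by norm_num : (0:ℝ) ≤ 4))).add
      ((meanAbsLe_sq hw₀ hw₀2).const_mul
      (by norm_num : (0:ℝ) ≤ 36))).const_mul (by norm_num : (0:ℝ) ≤ 6)).const_mul
      (by positivity : 0 ≤ (1 / m) ^ 2)
    refine (B2.integral_le_of_le hmem.integrable_sq fun x => ?_).trans ?_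
    · have h1 := pow_le_pow_left₀ (abs_nonneg _) (hdom x) 2
      rw [sq_abs, mul_pow] at h1
      refine h1.trans (mul_le_mul_of_nonneg_left ?_ (by positivity))
      have h2 : |t'| ^ 2 ≤ (9 * ρ) ^ 2 := pow_le_pow_left₀ (abs_nonneg _) ht 2
      rw [← sq_abs (q₁ x), ← sq_abs (q₂ x), ← sq_abs (q₃ x), ← sq_abs (w₁ x), ← sq_abs (w₀ x)]
      have key : ∀ c₁ c₂ c₃ c₄ c₅ c₆ : ℝ, (c₁ + c₂ + c₃ + c₄ + c₅ + c₆) ^ 2 ≤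
          6 * (c₁ ^ 2 + c₂ ^ 2 + c₃ ^ 2 + c₄ ^ 2 + c₅ ^ 2 + c₆ ^ 2) := by
        intro c₁ c₂ c₃ c₄ c₅ c₆
        have := sq_sum_le_card_mul_sum_sq (s := Finset.univ) (f := ![c₁, c₂, c₃, c₄, c₅, c₆])
        simpa [Fin.sum_univ_six] using this
      have := key |t'| (2 * |q₂ x|) (2 * |q₃ x|) (6 * |q₁ x|) (2 * |w₁ x|) (6 * |w₀ x|)
      linarith
    -- The six squares, weighted by `6`, add up to `56862 ρ²`, which is below `250² ρ²`.
    · have e : (250 * ρ / m) ^ 2 = (1 / m) ^ 2 * (62500 * ρ ^ 2) := by ring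
      rw [e]
      refine mul_le_mul_of_nonneg_left ?_ (by positivity)
      nlinarith [sq_nonneg ρ]
  · have B1 := (((((((((meanAbsLe_abs_mul hw₁ hv₁ (by positivity) (by positivity) hw₁2
      hv₁2).const_mul (by norm_num : (0:ℝ) ≤ 2)).add
      ((meanAbsLe_abs hw₁ (by positivity) hw₁2).const_mul (by positivity : 0 ≤ 2 * |f|))).add
      ((meanAbsLe_abs hq₂ (by positivity) hq₂2).const_mul (by norm_num : (0:ℝ) ≤ 2))).add
      ((meanAbsLe_abs hq₃ (by positivity) hq₃2).const_mul (by norm_num : (0:ℝ) ≤ 2))).add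
      ((meanAbsLe_abs hq₁ (by positivity) hq₁2).const_mul (by norm_num : (0:ℝ) ≤ 6))).add
      ((meanAbsLe_abs_mul hw₀ hv₁ (by positivity) (by positivity) hw₀2 hv₁2).const_mul
        (by norm_num : (0:ℝ) ≤ 9))).add
      ((meanAbsLe_abs hw₀ (by positivity) hw₀2).const_mul (by positivity : 0 ≤ 9 * |f|))).add
      (meanAbsLe_abs_mul hw₀ hv₂ (by positivity) (by positivity) hw₀2 hv₂2)).const_mul
      (by positivity : 0 ≤ 1 / m ^ 2)
    have hI₁ : Integrable (fun x => 1 / m * (t' - w₁ x)) μ :=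
      ((integrable_const t').sub (hw₁.integrable (by norm_num))).const_mul (1 / m)
    have hI₂ : Integrable (fun x => 1 / m ^ 2 * t₂ * (t - w₀ x)) μ :=
      ((integrable_const t).sub (hw₀.integrable (by norm_num))).const_mul _
    refine abs_integral_sub_le_of_abs_le (hmem.integrable (by norm_num)) (hI₁.sub hI₂) B1.1 ?_ hsub
      (B1.2.trans ?_)
    · simp only [Pi.sub_apply]
      rw [integral_sub hI₁ hI₂, hN₁, hN₂, sub_zero]
    -- The terms add up to `162 ρσ + 45 ρ|f| + 162 ρ`, hence the constant `200`.
    have e : 200 * ρ / m ^ 2 * (σ + |f| + 1) =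
        1 / m ^ 2 * (200 * ρ * (σ + |f| + 1)) := by ring
    rw [e]
    refine mul_le_mul_of_nonneg_left ?_ (by positivity)
    have p1 := mul_nonneg hρ hσ
    have p2 := mul_nonneg hρ (abs_nonneg f)
    nlinarith

end Aux

/-! ### Moment bounds for the two row terms -/

section Bounds

variable {d : ℕ} {μ : Measure (Fin d → ℝ)} {W G B : Matrix (Fin d) (Fin d) ℝ} {a ρ m γ : ℝ}

theorem RowLaw.integral_trace_sub (h : RowLaw μ G a) (K : Matrix (Fin d) (Fin d) ℝ) (c : ℝ) :
    ∫ x, c * ((K * G).trace - x ⬝ᵥ K *ᵥ x) ∂μ = 0 := by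
  have := h.isProb
  rw [integral_const_mul, integral_sub (integrable_const _) (h.integrable_quadForm _),
    h.integral_quadForm]
  simp

theorem hasMomentBounds_rowTerm (h : RowLaw μ G a) (hB : IsResolvent B) (hW : TestBound μ W ρ)
    (hρ : 0 ≤ ρ) (hm : 1 ≤ m) (hkm : 2 * G.trace ≤ m) (hγ : γ * (m - G.trace) = 1) :
    HasMomentBounds μ (rowTerm m γ W G B) 0 (250 * ρ / m)
      (200 * ρ / m ^ 2 * (√(a * G.trace) + |(B * G).trace - G.trace| + 1)) := by
  have := h.isProb
  have hw₀ := hW.integral_sq_right_le (by norm_num : (0:ℝ) < 3) hB.norm_le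
  have hq₁ := hW.integral_sq_le (by norm_num : (0:ℝ) < 3) (by norm_num : (0:ℝ) < 3)
    (hB.norm_mul_moment_le h) hB.norm_le
  exact hasMomentBounds_of_le hm hρ (Real.sqrt_nonneg _) measurable_rowTerm
    (abs_rowTerm_le h hB hm hkm hγ) (abs_rowTerm_sub_le h hB hm hkm hγ) (h.memLp_quadForm _)
    (h.memLp_quadForm _) (h.memLp_sub _ _) (h.integral_trace_sub _ _)
    (h.abs_trace_le (by positivity) hw₀) hw₀ hq₁
    (h.integral_sub_sq_le_of_norm hB.posSemidef hB.norm_le)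

theorem hasMomentBounds_rowTermSq (h : RowLaw μ G a) (hB : IsResolvent B)
    (hW : TestBound μ W ρ) (hρ : 0 ≤ ρ) (hm : 1 ≤ m) (hkm : 2 * G.trace ≤ m)
    (hγ : γ * (m - G.trace) = 1) :
    HasMomentBounds μ (rowTermSq m γ W G B)
      (1 / m ^ 2 * ((B * B * G).trace * (W * B * G).trace)) (250 * ρ / m)
      (200 * ρ / m ^ 2 * (√(a * G.trace) + |(B * G).trace - G.trace| + 1)) := by
  have := h.isProb
  have h3 : (0:ℝ) < 3 := by norm_num
  have h9 : (0:ℝ) < 9 := by norm_num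
  have hw₀ := hW.integral_sq_right_le h3 hB.norm_le
  have hw₁ := hW.integral_sq_right_le h9 hB.norm_mul_self_le
  have hq₁ := hW.integral_sq_le h3 h3 (hB.norm_mul_moment_le h) hB.norm_le
  have hq₂ := hW.integral_sq_le h3 h9 (hB.norm_mul_moment_le h) hB.norm_mul_self_le
  have hq₃ := hW.integral_sq_le h9 h3 (hB.norm_mul_self_mul_moment_le h) hB.norm_le
  exact hasMomentBounds_of_le_sq hm hρ (Real.sqrt_nonneg _) measurable_rowTermSq
    (abs_rowTermSq_le h hB hm hkm hγ) (abs_rowTermSq_sub_le h hB hm hkm hγ) (h.memLp_quadForm _)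
    (h.memLp_quadForm _) (h.memLp_quadForm _) (h.memLp_quadForm _) (h.memLp_quadForm _)
    (h.memLp_sub _ _) (h.memLp_sub _ _) (h.integral_trace_sub _ _) (h.integral_trace_sub _ _)
    (h.abs_trace_le (by positivity) hw₁) hw₀ hw₁ hq₁ hq₂ hq₃
    (h.integral_sub_sq_le_of_norm hB.posSemidef hB.norm_le)
    (h.integral_sub_sq_le_of_norm hB.posSemidef_mul_self hB.norm_mul_self_le)

end Bounds

/-! ### Restricting to an event and freezing a slowly varying weight -/

/-- Two replacements are made: the weight `Φ` by the constant `φ`, which costs `D τ A` by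
Cauchy–Schwarz, and the event `S` by the whole space, which costs `|φ|` times the integral of `|T|`
over `Sᶜ`. -/
theorem abs_integral_indicator_mul_sub_le {X : Type*} [MeasurableSpace X] {μ : Measure X}
    [IsProbabilityMeasure μ] {T Φ N : X → ℝ} {M A β φ D τ ρ : ℝ} {S : Set X}
    (hT : HasMomentBounds μ T M A β) (hS : MeasurableSet S) (hΦ : Measurable Φ)
    (hN : MemLp N 2 μ) (hN2 : ∫ x, N x ^ 2 ∂μ ≤ τ ^ 2) (hN0 : ∀ x, 0 ≤ N x) (hτ : 0 ≤ τ)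
    (hA : 0 ≤ A) (hD : 0 ≤ D) (hle : ∀ x ∈ S, |Φ x - φ| ≤ D * N x) (hρ : 0 < ρ) :
    |∫ x, S.indicator (fun x => Φ x * T x) x ∂μ - φ * M| ≤
      |φ| * (β + ρ * μ.real Sᶜ + A ^ 2 / ρ) + D * τ * A := by
  have hTi : Integrable T μ := hT.memLp.integrable (by norm_num)
  have hdom : ∀ x, |S.indicator (fun x => Φ x * T x) x - φ * T x| ≤
      |φ| * (ρ * Sᶜ.indicator 1 x + ρ⁻¹ * T x ^ 2) + D * |N x * T x| := by
    intro x
    by_cases hx : x ∈ S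
    · rw [Set.indicator_of_mem hx, Set.indicator_of_notMem (by simpa using hx), ← sub_mul, abs_mul,
        abs_mul (N x), abs_of_nonneg (hN0 x)]
      have h1 := mul_le_mul_of_nonneg_right (hle x hx) (abs_nonneg (T x))
      have h2 : 0 ≤ |φ| * (ρ * 0 + ρ⁻¹ * T x ^ 2) := by positivity
      linarith
    · rw [Set.indicator_of_notMem hx, Set.indicator_of_mem (by simpa using hx), zero_sub, abs_neg,
        abs_mul, Pi.one_apply, mul_one]
      -- Young's inequality rather than Cauchy–Schwarz: the bound stays linear in the probability of
      -- `Sᶜ`, so it can be averaged over the other rows afterwards.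
      have h1 : |T x| ≤ ρ + ρ⁻¹ * T x ^ 2 := by
        rw [← sq_abs]
        generalize |T x| = b
        have : ρ + ρ⁻¹ * b ^ 2 - b = ρ⁻¹ * ((b - ρ / 2) ^ 2 + 3 / 4 * ρ ^ 2) := by
          field_simp; ring
        have h3 : 0 ≤ ρ⁻¹ * ((b - ρ / 2) ^ 2 + 3 / 4 * ρ ^ 2) := by positivity
        linarith
      have h2 := mul_le_mul_of_nonneg_left h1 (abs_nonneg φ)
      have h3 : 0 ≤ D * |N x * T x| := by positivity
      linarith
  have hind : MeanAbsLe μ (Sᶜ.indicator (1 : X → ℝ)) (μ.real Sᶜ) :=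
    ⟨(integrable_const (1:ℝ)).indicator hS.compl, by rw [integral_indicator_one hS.compl]⟩
  have B := ((((hind.const_mul hρ.le).add ((meanAbsLe_sq hT.memLp hT.integral_sq_le).const_mul
    (by positivity : 0 ≤ ρ⁻¹))).const_mul (abs_nonneg φ)).add
    ((meanAbsLe_abs_mul hN hT.memLp hτ hA hN2 hT.integral_sq_le).const_mul hD))
  have hmeas : AEStronglyMeasurable (S.indicator (fun x => Φ x * T x)) μ :=
    (hΦ.aestronglyMeasurable.mul hT.memLp.1).indicator hS
  have hdiff : Integrable (fun x => S.indicator (fun x => Φ x * T x) x - φ * T x) μ := by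
    refine B.1.mono (hmeas.sub (hT.memLp.1.const_mul φ)) (ae_of_all _ fun x => ?_)
    rw [Real.norm_eq_abs, Real.norm_eq_abs]
    exact (hdom x).trans (le_abs_self _)
  have hint : Integrable (S.indicator (fun x => Φ x * T x)) μ := by
    have := hdiff.add (hTi.const_mul φ)
    refine this.congr (ae_of_all _ fun x => ?_)
    simp
  have e : ∫ x, S.indicator (fun x => Φ x * T x) x ∂μ - φ * M =
      ∫ x, (S.indicator (fun x => Φ x * T x) x - φ * T x) ∂μ + φ * (∫ x, T x ∂μ - M) := by
    rw [integral_sub hint (hTi.const_mul φ), integral_const_mul]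
    ring
  rw [e]
  refine (abs_add_le _ _).trans ?_
  rw [abs_mul φ]
  have h1 := abs_integral_le_integral_abs.trans ((integral_mono hdiff.abs B.1 hdom).trans B.2)
  have h2 := mul_le_mul_of_nonneg_left hT.abs_integral_sub_le (abs_nonneg φ)
  rw [div_eq_inv_mul]
  linarith

/-! ### Resampling one coordinate of a product measure -/

section Resample

theorem measurable_update_prod {X : Type*} [MeasurableSpace X] {m : ℕ} (i : Fin m) :
    Measurable (fun p : (Fin m → X) × X => Function.update p.1 i p.2) := by
  rw [measurable_pi_iff]
  intro j
  by_cases hj : j = i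
  · subst hj; simpa using measurable_snd
  · simp only [Function.update_of_ne hj]; fun_prop

variable {X : Type*} [MeasurableSpace X] {μ : Measure X} [IsProbabilityMeasure μ] {m : ℕ}

/-- Checked on boxes: the preimage of a box is the box with its `i`-th side freed, times that side,
and the freed side has mass one. -/
theorem map_update_pi_prod (i : Fin m) :
    ((Measure.pi fun _ : Fin m => μ).prod μ).map
      (fun p : (Fin m → X) × X => Function.update p.1 i p.2) = Measure.pi fun _ : Fin m => μ := by
  have hmeas := measurable_update_prod (X := X) i
  symm
  refine Measure.pi_eq fun s hs => ?_
  rw [Measure.map_apply hmeas (MeasurableSet.univ_pi hs)]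
  have : (fun p : (Fin m → X) × X => Function.update p.1 i p.2) ⁻¹' Set.univ.pi s =
      (Set.univ.pi (Function.update s i Set.univ)) ×ˢ s i := by
    ext ⟨y, t⟩
    simp only [Set.mem_preimage, Set.mem_univ_pi, Set.mem_prod]
    constructor
    · intro h
      refine ⟨fun j => ?_, by simpa using h i⟩
      by_cases hj : j = i
      · subst hj; simp
      · simpa [hj] using h j
    · rintro ⟨h1, h2⟩ j
      by_cases hj : j = i
      · subst hj; simpa using h2
      · simpa [hj] using h1 j
  rw [this, Measure.prod_prod, Measure.pi_pi, ← Finset.mul_prod_erase _ _ (Finset.mem_univ i),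
    ← Finset.mul_prod_erase Finset.univ (fun j => μ (s j)) (Finset.mem_univ i)]
  simp only [Function.update_self, measure_univ, one_mul]
  rw [mul_comm]
  congr 1
  refine Finset.prod_congr rfl fun j hj => ?_
  rw [Function.update_of_ne (Finset.ne_of_mem_erase hj)]

theorem integrable_comp_update {F : (Fin m → X) → ℝ}
    (hF : Integrable F (Measure.pi fun _ : Fin m => μ)) (i : Fin m) :
    Integrable (fun p : (Fin m → X) × X => F (Function.update p.1 i p.2))
      ((Measure.pi fun _ : Fin m => μ).prod μ) := by
  rw [← map_update_pi_prod i] at hF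
  exact hF.comp_measurable (measurable_update_prod i)

/-- Fubini in a form suited to leaving one row out: the inner integral ranges over row `i` alone and
ignores the old value `y i`. -/
theorem integral_eq_integral_update {F : (Fin m → X) → ℝ}
    (hF : Integrable F (Measure.pi fun _ : Fin m => μ)) (i : Fin m) :
    ∫ y, F y ∂(Measure.pi fun _ : Fin m => μ) =
      ∫ y, ∫ t, F (Function.update y i t) ∂μ ∂(Measure.pi fun _ : Fin m => μ) := by
  rw [← integral_prod _ (integrable_comp_update hF i)]
  conv_lhs => rw [← map_update_pi_prod i]
  refine integral_map (measurable_update_prod i).aemeasurable ?_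
  rw [map_update_pi_prod i]
  exact hF.1

end Resample

/-! ### Measurability of matrix inversion and of the rank one update -/

section MeasurableMatrix

variable {d : ℕ}

/-- The product σ-algebra on matrices. -/
@[reducible] def matrixMeasurableSpace {d : ℕ} : MeasurableSpace (Matrix (Fin d) (Fin d) ℝ) :=
  inferInstanceAs (MeasurableSpace (Fin d → Fin d → ℝ))

attribute [local instance] matrixMeasurableSpace

theorem matrixBorelSpace {d : ℕ} : BorelSpace (Matrix (Fin d) (Fin d) ℝ) :=
  inferInstanceAs (BorelSpace (Fin d → Fin d → ℝ))

attribute [local instance] matrixBorelSpace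

/-- The total inverse is `det⁻¹ • adjugate`, where the convention `0⁻¹ = 0` matches the value `0` at
singular matrices; no restriction to invertible matrices is needed. -/
theorem measurable_matrix_inv :
    Measurable (fun M : Matrix (Fin d) (Fin d) ℝ => M⁻¹) := by
  have h1 : Measurable (fun M : Matrix (Fin d) (Fin d) ℝ => M.det⁻¹) :=
    (continuous_id.matrix_det.measurable).inv
  have h2 : Measurable (fun M : Matrix (Fin d) (Fin d) ℝ => M.adjugate) :=
    continuous_id.matrix_adjugate.measurable
  have h3 := h1.smul h2
  convert h3 using 1
  funext M
  simp [Matrix.inv_def, Ring.inverse_eq_inv']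

theorem measurable_rankOneUpdate (γ : ℝ) :
    Measurable (fun p : Matrix (Fin d) (Fin d) ℝ × (Fin d → ℝ) => rankOneUpdate γ p.1 p.2) := by
  unfold rankOneUpdate
  have h1 : Measurable (fun p : Matrix (Fin d) (Fin d) ℝ × (Fin d → ℝ) =>
      p.2 ⬝ᵥ p.1 *ᵥ p.2) := by
    refine Continuous.measurable ?_
    fun_prop
  have h2 : Measurable (fun p : Matrix (Fin d) (Fin d) ℝ × (Fin d → ℝ) =>
      vecMulVec (p.1 *ᵥ p.2) (p.1 *ᵥ p.2)) := by
    refine Continuous.measurable ?_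
    fun_prop
  exact measurable_fst.sub ((measurable_const.div (measurable_const.add
    (measurable_const.mul h1))).smul h2)

end MeasurableMatrix

attribute [local instance] matrixMeasurableSpace matrixBorelSpace

/-! ### Leave-one-out events and the one-row comparison -/

section LeaveOneOut

variable {m d : ℕ}

/-- The sketched Hessian in normalized coordinates, as a function of the rows `y`. -/
def sketchGram (γ : ℝ) (G : Matrix (Fin d) (Fin d) ℝ) (y : Fin m → Fin d → ℝ) :
    Matrix (Fin d) (Fin d) ℝ :=
  γ • ∑ j, vecMulVec (y j) (y j) + (1 - G)

/-- The matrix `sketchGram γ G y` without the contribution of row `i`. -/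
def gramErase (γ : ℝ) (G : Matrix (Fin d) (Fin d) ℝ) (i : Fin m) (y : Fin m → Fin d → ℝ) :
    Matrix (Fin d) (Fin d) ℝ :=
  γ • ∑ j ∈ Finset.univ.erase i, vecMulVec (y j) (y j) + (1 - G)

theorem gram_eq_gramErase_add (γ : ℝ) (G : Matrix (Fin d) (Fin d) ℝ) (i : Fin m)
    (y : Fin m → Fin d → ℝ) :
    sketchGram γ G y = gramErase γ G i y + γ • vecMulVec (y i) (y i) := by
  rw [sketchGram, gramErase, ← Finset.add_sum_erase _ _ (Finset.mem_univ i), smul_add]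
  abel

theorem gramErase_update (γ : ℝ) (G : Matrix (Fin d) (Fin d) ℝ) (i : Fin m)
    (y : Fin m → Fin d → ℝ) (t : Fin d → ℝ) :
    gramErase γ G i (Function.update y i t) = gramErase γ G i y := by
  rw [gramErase, gramErase]
  congr 2
  refine Finset.sum_congr rfl fun j hj => ?_
  rw [Function.update_of_ne (Finset.ne_of_mem_erase hj)]

theorem transpose_smul_sum_add {G : Matrix (Fin d) (Fin d) ℝ} (hG : Gᵀ = G) (γ : ℝ)
    (s : Finset (Fin m)) (y : Fin m → Fin d → ℝ) :
    (γ • ∑ j ∈ s, vecMulVec (y j) (y j) + (1 - G))ᵀ =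
      γ • ∑ j ∈ s, vecMulVec (y j) (y j) + (1 - G) := by
  simp [Matrix.transpose_sum, hG, Matrix.transpose_vecMulVec]

@[fun_prop]
theorem measurable_sketchGram (γ : ℝ) (G : Matrix (Fin d) (Fin d) ℝ) :
    Measurable (fun y : Fin m → Fin d → ℝ => sketchGram γ G y) := by
  unfold sketchGram
  refine Continuous.measurable ?_
  fun_prop

@[fun_prop]
theorem measurable_gramErase (γ : ℝ) (G : Matrix (Fin d) (Fin d) ℝ) (i : Fin m) :
    Measurable (fun y : Fin m → Fin d → ℝ => gramErase γ G i y) := by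
  unfold gramErase
  refine Continuous.measurable ?_
  fun_prop

/-- An event `E` and, for every row `i`, a larger event `Ei i` that does not depend on row `i` and
on which the matrix without row `i` is bounded below. -/
structure LeaveOneOut (μ : Measure (Fin d → ℝ)) (G : Matrix (Fin d) (Fin d) ℝ) (γ δ : ℝ)
    (E : Set (Fin m → Fin d → ℝ)) (Ei : Fin m → Set (Fin m → Fin d → ℝ)) : Prop where
  stepSize_nonneg : 0 ≤ γ
  transpose_eq : Gᵀ = G
  measurableSet : MeasurableSet E
  measurableSet_erase : ∀ i, MeasurableSet (Ei i)
  subset : ∀ i, E ⊆ Ei i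
  update_mem_iff : ∀ i y t, Function.update y i t ∈ Ei i ↔ y ∈ Ei i
  le_gramErase : ∀ i, ∀ y ∈ Ei i, ∀ x : Fin d → ℝ,
    (1 / 3) * (x ⬝ᵥ x) ≤ x ⬝ᵥ gramErase γ G i y *ᵥ x
  prob_compl_le : (Measure.pi fun _ : Fin m => μ).real Eᶜ ≤ δ

namespace LeaveOneOut

variable {μ : Measure (Fin d → ℝ)} {G : Matrix (Fin d) (Fin d) ℝ} {γ δ : ℝ}
  {E : Set (Fin m → Fin d → ℝ)} {Ei : Fin m → Set (Fin m → Fin d → ℝ)}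

theorem posDef_gramErase (hE : LeaveOneOut μ G γ δ E Ei) {i : Fin m} {y : Fin m → Fin d → ℝ}
    (hy : y ∈ Ei i) : (gramErase γ G i y).PosDef :=
  posDef_of_le (transpose_smul_sum_add hE.transpose_eq γ _ y) (by norm_num) (hE.le_gramErase i y hy)

theorem isResolvent_gramErase (hE : LeaveOneOut μ G γ δ E Ei) {i : Fin m}
    {y : Fin m → Fin d → ℝ} (hy : y ∈ Ei i) : IsResolvent (gramErase γ G i y)⁻¹ :=
  isResolvent_inv (transpose_smul_sum_add hE.transpose_eq γ _ y) (hE.le_gramErase i y hy)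

theorem le_gram (hE : LeaveOneOut μ G γ δ E Ei) {i : Fin m} {y : Fin m → Fin d → ℝ}
    (hy : y ∈ Ei i) (x : Fin d → ℝ) : (1 / 3) * (x ⬝ᵥ x) ≤ x ⬝ᵥ sketchGram γ G y *ᵥ x := by
  rw [gram_eq_gramErase_add γ G i, Matrix.add_mulVec, dotProduct_add, Matrix.smul_mulVec,
    dotProduct_smul, Matrix.vecMulVec_mulVec, op_smul_eq_smul, dotProduct_smul, smul_eq_mul,
    smul_eq_mul, dotProduct_comm x (y i)]
  have := hE.le_gramErase i y hy x
  have := mul_nonneg hE.stepSize_nonneg (mul_self_nonneg (y i ⬝ᵥ x))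
  linarith

theorem posDef_gram (hE : LeaveOneOut μ G γ δ E Ei) {i : Fin m} {y : Fin m → Fin d → ℝ}
    (hy : y ∈ Ei i) : (sketchGram γ G y).PosDef :=
  posDef_of_le (transpose_smul_sum_add hE.transpose_eq γ _ y) (by norm_num) (hE.le_gram hy)

theorem isResolvent_gram (hE : LeaveOneOut μ G γ δ E Ei) {i : Fin m}
    {y : Fin m → Fin d → ℝ} (hy : y ∈ Ei i) : IsResolvent (sketchGram γ G y)⁻¹ :=
  isResolvent_inv (transpose_smul_sum_add hE.transpose_eq γ _ y) (hE.le_gram hy)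

theorem inv_gram (hE : LeaveOneOut μ G γ δ E Ei) {i : Fin m} {y : Fin m → Fin d → ℝ}
    (hy : y ∈ Ei i) : (sketchGram γ G y)⁻¹ = rankOneUpdate γ (gramErase γ G i y)⁻¹ (y i) := by
  rw [gram_eq_gramErase_add γ G i]
  exact inv_add_rankOne (hE.posDef_gramErase hy) hE.stepSize_nonneg (y i)

theorem prob_diff_le [IsProbabilityMeasure μ] (hE : LeaveOneOut μ G γ δ E Ei) (i : Fin m) :
    (Measure.pi fun _ : Fin m => μ).real (Ei i \ E) ≤ δ :=
  (measureReal_mono (fun _ hy => hy.2)).trans hE.prob_compl_le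

theorem integrable_row {a : ℝ} (h : RowLaw μ G a) (i : Fin m) :
    Integrable (fun y : Fin m → Fin d → ℝ => y i ⬝ᵥ y i) (Measure.pi fun _ : Fin m => μ) := by
  have := h.isProb
  have h1 : Integrable (fun x : Fin d → ℝ => x ⬝ᵥ x) μ := by simpa using h.integrable_quadForm 1
  exact (measurePreserving_eval (fun _ : Fin m => μ) i).integrable_comp_of_integrable h1

/-- The one-row estimate is averaged over the remaining rows: conditionally on these, `B` is fixed,
`Q` is its update by a fresh row, and the weight `ψ(Q)` is traded for `ψ(B)`. The growth constants
`c`, `cM`, `cβ` serve integrability only and do not reach the conclusion. -/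
theorem abs_setIntegral_sub_le {a A c cM cβ D φ ρ : ℝ} (h : RowLaw μ G a)
    (hE : LeaveOneOut μ G γ δ E Ei) (i : Fin m)
    {T : Matrix (Fin d) (Fin d) ℝ → (Fin d → ℝ) → ℝ} {M β ψ : Matrix (Fin d) (Fin d) ℝ → ℝ}
    (hA : 0 ≤ A) (hD : 0 ≤ D) (hρ : 0 < ρ) (hφ : 0 ≤ φ)
    (hT : ∀ B, IsResolvent B → HasMomentBounds μ (T B) (M B) A (β B))
    (hTm : Measurable fun p : Matrix (Fin d) (Fin d) ℝ × (Fin d → ℝ) => T p.1 p.2)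
    (hTb : ∀ B, IsResolvent B → ∀ x, |T B x| ≤ c * (1 + x ⬝ᵥ x))
    (hψm : Measurable ψ) (hψb : ∀ B, IsResolvent B → |ψ B| ≤ φ)
    (hψd : ∀ B, IsResolvent B → ∀ x, |ψ (rankOneUpdate γ B x) - ψ B| ≤ D * (x ⬝ᵥ x))
    (hMm : Measurable M) (hMb : ∀ B, IsResolvent B → |M B| ≤ cM)
    (hβm : Measurable β) (hβb : ∀ B, IsResolvent B → |β B| ≤ cβ) :
    |∫ y in E, ψ (sketchGram γ G y)⁻¹ * T (gramErase γ G i y)⁻¹ (y i) ∂(Measure.pi fun _ : Fin m => μ) -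
      ∫ y in Ei i, ψ (gramErase γ G i y)⁻¹ * M (gramErase γ G i y)⁻¹
        ∂(Measure.pi fun _ : Fin m => μ)| ≤
      ∫ y in Ei i, |ψ (gramErase γ G i y)⁻¹| * (β (gramErase γ G i y)⁻¹ + A ^ 2 / ρ)
        ∂(Measure.pi fun _ : Fin m => μ) + φ * ρ * δ + D * normBound G a * A := by
  have := h.isProb
  set π := Measure.pi fun _ : Fin m => μ
  have hinv : Measurable fun y : Fin m → Fin d → ℝ => (gramErase γ G i y)⁻¹ :=
    measurable_matrix_inv.comp (measurable_gramErase γ G i)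
  have hinv' : Measurable fun y : Fin m → Fin d → ℝ => (sketchGram γ G y)⁻¹ :=
    measurable_matrix_inv.comp (measurable_sketchGram γ G)
  have hTy : Measurable fun y : Fin m → Fin d → ℝ => T (gramErase γ G i y)⁻¹ (y i) :=
    hTm.comp (hinv.prodMk (measurable_pi_apply i))
  set F : (Fin m → Fin d → ℝ) → ℝ :=
    E.indicator fun y => ψ (sketchGram γ G y)⁻¹ * T (gramErase γ G i y)⁻¹ (y i) with hFdef
  set J : (Fin m → Fin d → ℝ) → ℝ :=
    (Ei i).indicator fun y => ψ (gramErase γ G i y)⁻¹ * M (gramErase γ G i y)⁻¹ with hJdef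
  set K : (Fin m → Fin d → ℝ) → ℝ :=
    (Ei i).indicator fun y => |ψ (gramErase γ G i y)⁻¹| * (β (gramErase γ G i y)⁻¹ + A ^ 2 / ρ)
    with hKdef
  have hFi : Integrable F π := by
    have hd := ((integrable_const (1:ℝ)).add_fun (integrable_row h i)).const_mul (|φ| * |c|)
    refine hd.mono ((((hψm.comp hinv').mul hTy).indicator hE.measurableSet).aestronglyMeasurable)
      (ae_of_all _ fun y => ?_)
    have h0 := dotProduct_self_nonneg' (y i)
    rw [Real.norm_eq_abs, Real.norm_of_nonneg (by positivity)]
    by_cases hy : y ∈ E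
    · rw [hFdef, Set.indicator_of_mem hy, abs_mul, mul_assoc]
      refine mul_le_mul ((hψb _ (hE.isResolvent_gram (hE.subset i hy))).trans (le_abs_self _))
        ((hTb _ (hE.isResolvent_gramErase (hE.subset i hy)) _).trans ?_) (abs_nonneg _)
        (abs_nonneg _)
      exact mul_le_mul_of_nonneg_right (le_abs_self c) (by positivity)
    · rw [hFdef, Set.indicator_of_notMem hy, abs_zero]
      positivity
  have hJi : Integrable J π := by
    refine Integrable.of_bound
      (((hψm.comp hinv).mul (hMm.comp hinv)).indicator
        (hE.measurableSet_erase i)).aestronglyMeasurable (|φ| * |cM|) (ae_of_all _ fun y => ?_)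
    rw [Real.norm_eq_abs]
    by_cases hy : y ∈ Ei i
    · rw [hJdef, Set.indicator_of_mem hy, abs_mul]
      exact mul_le_mul ((hψb _ (hE.isResolvent_gramErase hy)).trans (le_abs_self _))
        ((hMb _ (hE.isResolvent_gramErase hy)).trans (le_abs_self _)) (abs_nonneg _)
        (abs_nonneg _)
    · rw [hJdef, Set.indicator_of_notMem hy, abs_zero]; positivity
  have hKi : Integrable K π := by
    refine Integrable.of_bound
      (((hψm.comp hinv).abs.mul ((hβm.comp hinv).add_const _)).indicator
        (hE.measurableSet_erase i)).aestronglyMeasurable (|φ| * (|cβ| + A ^ 2 / ρ))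
        (ae_of_all _ fun y => ?_)
    rw [Real.norm_eq_abs]
    by_cases hy : y ∈ Ei i
    · rw [hKdef, Set.indicator_of_mem hy, abs_mul, abs_abs]
      refine mul_le_mul ((hψb _ (hE.isResolvent_gramErase hy)).trans (le_abs_self _))
        ((abs_add_le _ _).trans ?_) (abs_nonneg _) (abs_nonneg _)
      rw [abs_of_nonneg (by positivity : 0 ≤ A ^ 2 / ρ)]
      exact add_le_add_left ((hβb _ (hE.isResolvent_gramErase hy)).trans (le_abs_self _)) _
    · rw [hKdef, Set.indicator_of_notMem hy, abs_zero]; positivity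
  have hDm := (hE.measurableSet_erase i).diff hE.measurableSet
  have hZi : Integrable ((Ei i \ E).indicator (1 : (Fin m → Fin d → ℝ) → ℝ)) π :=
    (integrable_const (1:ℝ)).indicator hDm
  have hZ := (integrable_comp_update hZi i).integral_prod_left
  have hI := (integrable_comp_update hFi i).integral_prod_left
  -- The conditional probability, given the other rows, of lying in `Ei i` but outside `E`; its mean
  -- is at most `δ`.
  set Z : (Fin m → Fin d → ℝ) → ℝ := fun y =>
    ∫ t, (Ei i \ E).indicator (1 : (Fin m → Fin d → ℝ) → ℝ) (Function.update y i t) ∂μ with hZdef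
  have hZint : ∫ y, Z y ∂π ≤ δ := by
    rw [hZdef, ← integral_eq_integral_update hZi i, integral_indicator_one hDm]
    exact hE.prob_diff_le i
  have key : ∀ y, |∫ t, F (Function.update y i t) ∂μ - J y| ≤
      K y + |φ| * ρ * Z y + D * normBound G a * A := by
    intro y
    have hτ : 0 ≤ normBound G a := Real.sqrt_nonneg _
    by_cases hy : y ∈ Ei i
    · have hupd : Measurable fun t : Fin d → ℝ => Function.update y i t := measurable_update y
      have hS : MeasurableSet {t | Function.update y i t ∈ E} := hupd hE.measurableSet
      have hB := hE.isResolvent_gramErase hy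
      have hFe : (fun t => F (Function.update y i t)) =
          {t | Function.update y i t ∈ E}.indicator fun t =>
            ψ (rankOneUpdate γ (gramErase γ G i y)⁻¹ t) * T (gramErase γ G i y)⁻¹ t := by
        funext t
        by_cases ht : Function.update y i t ∈ E
        · rw [hFdef, Set.indicator_of_mem ht, Set.indicator_of_mem (by exact ht),
            hE.inv_gram (hE.subset i ht), gramErase_update, Function.update_self]
        · rw [hFdef, Set.indicator_of_notMem ht, Set.indicator_of_notMem (by exact ht)]
      have hZe : Z y = μ.real {t | Function.update y i t ∈ E}ᶜ := by
        rw [← integral_indicator_one hS.compl, hZdef]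
        refine integral_congr_ae (ae_of_all _ fun t => ?_)
        have := (hE.update_mem_iff i y t).2 hy
        by_cases ht : Function.update y i t ∈ E <;> simp [Set.indicator, ht, this]
      have hL := abs_integral_indicator_mul_sub_le (hT _ hB) hS
        (hψm.comp ((measurable_rankOneUpdate γ).comp measurable_prodMk_left)) h.memLp_dot_self
        h.integral_dot_self_sq dotProduct_self_nonneg' hτ hA hD (fun t _ => hψd _ hB t) hρ
      rw [hFe, hJdef, hKdef, Set.indicator_of_mem hy, Set.indicator_of_mem hy, hZe]
      refine hL.trans ?_
      have h1 := mul_le_mul_of_nonneg_right ((hψb _ hB).trans (le_abs_self _))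
        (mul_nonneg hρ.le (measureReal_nonneg (μ := μ) (s := {t | Function.update y i t ∈ E}ᶜ)))
      linarith
    -- Membership in `Ei i` ignores row `i` and `E ⊆ Ei i`, so no resampled point can lie in `E`.
    · have hFe : ∀ t, F (Function.update y i t) = 0 := by
        intro t
        refine Set.indicator_of_notMem (fun ht => hy ?_) _
        exact (hE.update_mem_iff i y t).1 (hE.subset i ht)
      have hZ0 : 0 ≤ Z y := integral_nonneg fun t => Set.indicator_nonneg (by simp) _
      simp only [hFe, hJdef, hKdef, Set.indicator_of_notMem hy, integral_zero, sub_zero, abs_zero,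
        zero_add]
      positivity
  rw [← integral_indicator hE.measurableSet, ← integral_indicator (hE.measurableSet_erase i),
    ← integral_indicator (hE.measurableSet_erase i), ← hFdef, ← hJdef, ← hKdef,
    integral_eq_integral_update hFi i, ← integral_sub hI hJi]
  refine abs_integral_le_integral_abs.trans ((integral_mono (hI.sub hJi).abs
    ((hKi.add (hZ.const_mul _)).add (integrable_const _)) key).trans ?_)
  rw [integral_add' (hKi.add (hZ.const_mul _)) (integrable_const _),
    integral_add' hKi (hZ.const_mul _), integral_const_mul, abs_of_nonneg hφ]
  simp only [integral_const, probReal_univ, one_smul]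
  have := mul_le_mul_of_nonneg_left hZint (mul_nonneg hφ hρ.le)
  linarith

end LeaveOneOut

end LeaveOneOut

/-! ### Joint measurability of the row terms -/

section Measurability

variable {d : ℕ} {m γ : ℝ} {W G : Matrix (Fin d) (Fin d) ℝ}

theorem measurable_rowTerm_prod :
    Measurable fun p : Matrix (Fin d) (Fin d) ℝ × (Fin d → ℝ) => rowTerm m γ W G p.1 p.2 := by
  have h : Measurable fun p : Matrix (Fin d) (Fin d) ℝ × (Fin d → ℝ) =>
      (W * p.1 * G).trace / m - γ * (p.2 ⬝ᵥ (W * p.1) *ᵥ p.2) :=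
    Continuous.measurable (by fun_prop)
  have h2 : Measurable fun p : Matrix (Fin d) (Fin d) ℝ × (Fin d → ℝ) =>
    (rankOneUpdate γ p.1 p.2, p.2) := (measurable_rankOneUpdate γ).prodMk measurable_snd
  unfold rowTerm
  have h3 := h.comp h2
  simpa only [Function.comp_def] using h3

theorem measurable_rowTermSq_prod :
    Measurable fun p : Matrix (Fin d) (Fin d) ℝ × (Fin d → ℝ) => rowTermSq m γ W G p.1 p.2 := by
  have h : Measurable fun p : Matrix (Fin d) (Fin d) ℝ × (Fin d → ℝ) =>
      (W * (p.1 * p.1) * G).trace / m - γ * (p.2 ⬝ᵥ (W * (p.1 * p.1)) *ᵥ p.2) :=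
    Continuous.measurable (by fun_prop)
  have h2 : Measurable fun p : Matrix (Fin d) (Fin d) ℝ × (Fin d → ℝ) =>
    (rankOneUpdate γ p.1 p.2, p.2) := (measurable_rankOneUpdate γ).prodMk measurable_snd
  unfold rowTermSq
  have h3 := h.comp h2
  simpa only [Function.comp_def] using h3

end Measurability

/-! ### Crude growth bounds, needed for integrability only -/

section Growth

variable {d : ℕ} {μ : Measure (Fin d → ℝ)} {W G B : Matrix (Fin d) (Fin d) ℝ} {a ρ m γ : ℝ}

theorem norm_mul_le_mul {K L : Matrix (Fin d) (Fin d) ℝ} {k l : ℝ} (hK : ‖K‖ ≤ k) (hL : ‖L‖ ≤ l) :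
    ‖K * L‖ ≤ k * l :=
  (norm_mul_le _ _).trans (mul_le_mul hK hL (norm_nonneg _) ((norm_nonneg _).trans hK))

theorem abs_quadForm_le_of_norm {K : Matrix (Fin d) (Fin d) ℝ} {k : ℝ} (hK : ‖K‖ ≤ k)
    (x : Fin d → ℝ) : |x ⬝ᵥ K *ᵥ x| ≤ k * (x ⬝ᵥ x) :=
  (abs_dotProduct_mulVec_self_le K x).trans
    (mul_le_mul_of_nonneg_right hK (dotProduct_self_nonneg' x))

theorem RowLaw.abs_trace_mul_le_of_norm (h : RowLaw μ G a) {K : Matrix (Fin d) (Fin d) ℝ} {k : ℝ}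
    (hK : ‖K‖ ≤ k) : |(K * G).trace| ≤ k * G.trace :=
  (h.abs_trace_mul_le K).trans (mul_le_mul_of_nonneg_right hK h.trace_nonneg)

theorem abs_rowTerm_le_growth (h : RowLaw μ G a) (hB : IsResolvent B) (hm : 1 ≤ m)
    (hkm : 2 * G.trace ≤ m) (hγ : γ * (m - G.trace) = 1) (x : Fin d → ℝ) :
    |rowTerm m γ W G B x| ≤ 1000 * ‖W‖ * (1 + G.trace) * (1 + x ⬝ᵥ x) := by
  refine (abs_rowTerm_le h hB hm hkm hγ x).trans ?_
  have hw := norm_mul_le_mul (le_refl ‖W‖) hB.norm_le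
  have h1 := h.abs_trace_mul_le_of_norm hw
  have h2 := abs_quadForm_le_of_norm
    (norm_mul_le_mul (norm_mul_le_mul (hB.norm_mul_moment_le h) (le_refl ‖W‖)) hB.norm_le) x
  have h3 := abs_quadForm_le_of_norm hw x
  have hx := dotProduct_self_nonneg' x
  have hk := h.trace_nonneg
  have p1 := mul_nonneg (norm_nonneg W) hx
  have p2 := mul_nonneg (norm_nonneg W) hk
  have p3 := mul_nonneg p2 hx
  have p0 := norm_nonneg W
  refine (mul_le_of_le_one_left (by positivity) ((div_le_one (by linarith)).2 hm)).trans ?_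
  nlinarith

theorem abs_rowTermSq_le_growth (h : RowLaw μ G a) (hB : IsResolvent B) (hm : 1 ≤ m)
    (hkm : 2 * G.trace ≤ m) (hγ : γ * (m - G.trace) = 1) (x : Fin d → ℝ) :
    |rowTermSq m γ W G B x| ≤ 1000 * ‖W‖ * (1 + G.trace) * (1 + x ⬝ᵥ x) := by
  refine (abs_rowTermSq_le h hB hm hkm hγ x).trans ?_
  have hw := norm_mul_le_mul (le_refl ‖W‖) hB.norm_le
  have hw' := norm_mul_le_mul (le_refl ‖W‖) hB.norm_mul_self_le
  have h0 := h.abs_trace_mul_le_of_norm hw'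
  have h1 := abs_quadForm_le_of_norm
    (norm_mul_le_mul (norm_mul_le_mul (hB.norm_mul_moment_le h) (le_refl ‖W‖)) hB.norm_le) x
  have h2 := abs_quadForm_le_of_norm
    (norm_mul_le_mul (norm_mul_le_mul (hB.norm_mul_moment_le h) (le_refl ‖W‖))
      hB.norm_mul_self_le) x
  have h3 := abs_quadForm_le_of_norm
    (norm_mul_le_mul (norm_mul_le_mul (hB.norm_mul_self_mul_moment_le h) (le_refl ‖W‖))
      hB.norm_le) x
  have h4 := abs_quadForm_le_of_norm hw x
  have h5 := abs_quadForm_le_of_norm hw' x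
  have hx := dotProduct_self_nonneg' x
  have hk := h.trace_nonneg
  have p1 := mul_nonneg (norm_nonneg W) hx
  have p2 := mul_nonneg (norm_nonneg W) hk
  have p3 := mul_nonneg p2 hx
  have p0 := norm_nonneg W
  refine (mul_le_of_le_one_left (by positivity) ((div_le_one (by linarith)).2 hm)).trans ?_
  nlinarith

end Growth

/-! ### The row terms add up to the trace statistics -/

section Sum

variable {m d : ℕ} {γ : ℝ} {W G : Matrix (Fin d) (Fin d) ℝ}

/-- `1 - M = G - γ Σ yᵢyᵢᵀ`, with `G` shared equally among the `m` rows. -/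
theorem sum_trace_sub_quadForm (hm : (m : ℝ) ≠ 0) (K : Matrix (Fin d) (Fin d) ℝ)
    (y : Fin m → Fin d → ℝ) :
    ∑ i, ((K * G).trace / m - γ * (y i ⬝ᵥ K *ᵥ y i)) = (K * (1 - sketchGram γ G y)).trace := by
  have h1 : ∀ i, y i ⬝ᵥ K *ᵥ y i = (K * vecMulVec (y i) (y i)).trace := by
    intro i
    rw [Matrix.mul_vecMulVec, Matrix.trace_vecMulVec, dotProduct_comm]
  have h2 : (1 - sketchGram γ G y) = G - γ • ∑ i, vecMulVec (y i) (y i) := by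
    rw [sketchGram]; abel
  rw [h2, mul_sub, Matrix.mul_smul, Matrix.mul_sum, Matrix.trace_sub, Matrix.trace_smul,
    Matrix.trace_sum, Finset.sum_sub_distrib, ← Finset.mul_sum]
  simp only [h1, Finset.sum_const, Finset.card_univ, Fintype.card_fin, nsmul_eq_mul, smul_eq_mul]
  field_simp

/-- All updates equal the same `Q`, and `Q(1 - M) = Q - 1`. -/
theorem sum_rowTerm (hm : (m : ℝ) ≠ 0) {y : Fin m → Fin d → ℝ}
    (hu : IsUnit (sketchGram γ G y)) {B : Fin m → Matrix (Fin d) (Fin d) ℝ}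
    (hB : ∀ i, (sketchGram γ G y)⁻¹ = rankOneUpdate γ (B i) (y i)) :
    ∑ i, rowTerm m γ W G (B i) (y i) = (W * ((sketchGram γ G y)⁻¹ - 1)).trace := by
  simp only [rowTerm, ← hB]
  rw [sum_trace_sub_quadForm hm, mul_sub, mul_one, mul_assoc,
    Matrix.nonsing_inv_mul _ ((Matrix.isUnit_iff_isUnit_det _).1 hu), mul_sub]

theorem sum_rowTermSq (hm : (m : ℝ) ≠ 0) {y : Fin m → Fin d → ℝ}
    (hu : IsUnit (sketchGram γ G y)) {B : Fin m → Matrix (Fin d) (Fin d) ℝ}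
    (hB : ∀ i, (sketchGram γ G y)⁻¹ = rankOneUpdate γ (B i) (y i)) :
    ∑ i, rowTermSq m γ W G (B i) (y i) =
      (W * ((sketchGram γ G y)⁻¹ * (sketchGram γ G y)⁻¹ - (sketchGram γ G y)⁻¹)).trace := by
  simp only [rowTermSq, ← hB]
  rw [sum_trace_sub_quadForm hm, mul_sub, mul_one, mul_assoc, mul_assoc,
    Matrix.nonsing_inv_mul _ ((Matrix.isUnit_iff_isUnit_det _).1 hu), mul_sub, mul_one]

end Sum

/-! ### Summing the one-row comparison over all rows -/

section Statistic

variable {m d : ℕ}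

/-- A function of the resolvent that is bounded by `φ` and changes by at most `D xᵀx` under a
rank one update by `x`. -/
structure StableStatistic (γ φ D : ℝ) (ψ : Matrix (Fin d) (Fin d) ℝ → ℝ) : Prop where
  bound_nonneg : 0 ≤ φ
  stability_nonneg : 0 ≤ D
  measurable : Measurable ψ
  abs_le : ∀ B, IsResolvent B → |ψ B| ≤ φ
  abs_sub_le : ∀ B, IsResolvent B → ∀ x, |ψ (rankOneUpdate γ B x) - ψ B| ≤ D * (x ⬝ᵥ x)

theorem stableStatistic_const (γ c : ℝ) :
    StableStatistic γ |c| 0 (fun _ : Matrix (Fin d) (Fin d) ℝ => c) :=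
  ⟨abs_nonneg _, le_rfl, measurable_const, fun _ _ => le_rfl, fun _ _ _ => by simp⟩

variable {μ : Measure (Fin d → ℝ)} {G : Matrix (Fin d) (Fin d) ℝ} {a ρ γ δ : ℝ}
  {E : Set (Fin m → Fin d → ℝ)} {Ei : Fin m → Set (Fin m → Fin d → ℝ)}

local notation "π" => Measure.pi fun _ : Fin m => μ

theorem setIntegral_mul_le {X : Type*} [MeasurableSpace X] {ν : Measure X}
    [IsProbabilityMeasure ν] {S : Set X} (hS : MeasurableSet S) {f g : X → ℝ} {b c r s t : ℝ}
    (hf : Measurable f) (hg : Measurable g) (hfb : ∀ x ∈ S, |f x| ≤ b) (hgb : ∀ x ∈ S, |g x| ≤ c)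
    (hr : 0 ≤ r) (hs : 0 ≤ s) (ht : 0 ≤ t)
    (hfr : ∫ x in S, f x ^ 2 ∂ν ≤ r ^ 2) (hgs : ∫ x in S, g x ^ 2 ∂ν ≤ s ^ 2) :
    ∫ x in S, |f x| * (t + |g x|) ∂ν ≤ r * (t + s) := by
  have hfL : MemLp f 2 (ν.restrict S) := MemLp.of_bound hf.aestronglyMeasurable b
    ((ae_restrict_iff' hS).2 (ae_of_all _ hfb))
  have hgL : MemLp g 2 (ν.restrict S) := MemLp.of_bound hg.aestronglyMeasurable c
    ((ae_restrict_iff' hS).2 (ae_of_all _ hgb))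
  have h1 := integral_abs_mul_le (g := fun _ => t) hfL (memLp_const t) hr ht hfr (by
    simp only [integral_const, smul_eq_mul]
    exact mul_le_of_le_one_left (sq_nonneg t) (by simp))
  have h2 := integral_abs_mul_le hfL hgL hr hs hfr hgs
  have e : ∀ x, |f x| * (t + |g x|) = |f x * t| + |f x * g x| := by
    intro x
    rw [abs_mul, abs_mul, abs_of_nonneg ht]; ring
  simp only [e]
  have i1 : Integrable (fun x => |f x * t|) (ν.restrict S) :=
    (hfL.mul_const t |>.integrable (by norm_num)).abs
  have i2 : Integrable (fun x => |f x * g x|) (ν.restrict S) := (hfL.integrable_mul hgL).abs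
  rw [integral_add i1 i2]
  linarith

theorem RowLaw.abs_trace_sub_le (h : RowLaw μ G a) {B : Matrix (Fin d) (Fin d) ℝ}
    (hB : IsResolvent B) : |(B * G).trace - G.trace| ≤ 4 * G.trace := by
  have := h.abs_trace_mul_le_of_norm hB.norm_le
  have hk := h.trace_nonneg
  rw [abs_le] at *
  constructor <;> linarith

/-- Summing the one-row comparison over `m` rows turns `m⁻²` into `m⁻¹`. Cauchy–Schwarz decouples
the weight `ψ(B)` from `tr(BG) - tr G`, leaving only their `L²` norms `s` and `F`. -/
theorem LeaveOneOut.abs_setIntegral_sum_sub_le (h : RowLaw μ G a) (hE : LeaveOneOut μ G γ δ E Ei)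
    (hm : 1 ≤ (m : ℝ)) (hρ : 0 < ρ)
    {T : Matrix (Fin d) (Fin d) ℝ → (Fin d → ℝ) → ℝ} {M ψ : Matrix (Fin d) (Fin d) ℝ → ℝ}
    {c cM φ D s F : ℝ}
    (hT : ∀ B, IsResolvent B → HasMomentBounds μ (T B) (M B) (250 * ρ / m)
      (200 * ρ / (m : ℝ) ^ 2 * (√(a * G.trace) + |(B * G).trace - G.trace| + 1)))
    (hTm : Measurable fun p : Matrix (Fin d) (Fin d) ℝ × (Fin d → ℝ) => T p.1 p.2)
    (hTb : ∀ B, IsResolvent B → ∀ x, |T B x| ≤ c * (1 + x ⬝ᵥ x))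
    (hψ : StableStatistic γ φ (D / m) ψ)
    (hMm : Measurable M) (hMb : ∀ B, IsResolvent B → |M B| ≤ cM)
    (hs : 0 ≤ s) (hF : 0 ≤ F)
    (hψs : ∀ i, ∫ y in Ei i, ψ (gramErase γ G i y)⁻¹ ^ 2 ∂π ≤ s ^ 2)
    (hfF : ∀ i, ∫ y in Ei i, (((gramErase γ G i y)⁻¹ * G).trace - G.trace) ^ 2 ∂π ≤ F ^ 2) :
    |∫ y in E, ψ (sketchGram γ G y)⁻¹ * ∑ i, T (gramErase γ G i y)⁻¹ (y i) ∂π -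
      ∑ i, ∫ y in Ei i, ψ (gramErase γ G i y)⁻¹ * M (gramErase γ G i y)⁻¹ ∂π| ≤
      62700 * ρ / m * (s * (√(a * G.trace) + 1 + F)) + m * (φ * ρ * δ) +
        250 * D * normBound G a * ρ / m := by
  have := h.isProb
  have hσ : 0 ≤ √(a * G.trace) := Real.sqrt_nonneg _
  have hk := h.trace_nonneg
  have hm0 : (0:ℝ) < m := by linarith
  have hinv : ∀ i, Measurable fun y : Fin m → Fin d → ℝ => (gramErase γ G i y)⁻¹ := fun i =>
    measurable_matrix_inv.comp (measurable_gramErase γ G i)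
  have hfm : Measurable fun B : Matrix (Fin d) (Fin d) ℝ => (B * G).trace - G.trace := by
    refine Continuous.measurable ?_
    fun_prop
  have hβm : Measurable fun B : Matrix (Fin d) (Fin d) ℝ => 200 * ρ / (m : ℝ) ^ 2 *
      (√(a * G.trace) + |(B * G).trace - G.trace| + 1) := by fun_prop
  have hβb : ∀ B : Matrix (Fin d) (Fin d) ℝ, IsResolvent B → |200 * ρ / (m : ℝ) ^ 2 *
      (√(a * G.trace) + |(B * G).trace - G.trace| + 1)| ≤ 200 * ρ / (m : ℝ) ^ 2 *
      (√(a * G.trace) + 4 * G.trace + 1) := by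
    intro B hB
    rw [abs_of_nonneg (by positivity)]
    gcongr
    exact h.abs_trace_sub_le hB
  have hstep : ∀ i, |∫ y in E, ψ (sketchGram γ G y)⁻¹ * T (gramErase γ G i y)⁻¹ (y i) ∂π -
      ∫ y in Ei i, ψ (gramErase γ G i y)⁻¹ * M (gramErase γ G i y)⁻¹ ∂π| ≤
      62700 * ρ / (m : ℝ) ^ 2 * (s * (√(a * G.trace) + 1 + F)) + φ * ρ * δ +
        250 * D * normBound G a * ρ / (m : ℝ) ^ 2 := by
    intro i
    refine (hE.abs_setIntegral_sub_le h i (by positivity) hψ.stability_nonneg hρ hψ.bound_nonneg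
      hT hTm hTb hψ.measurable hψ.abs_le hψ.abs_sub_le hMm hMb hβm hβb).trans ?_
    have e : D / m * normBound G a * (250 * ρ / m) =
        250 * D * normBound G a * ρ / (m : ℝ) ^ 2 := by field_simp
    rw [e]
    gcongr ?_ + _ + _
    have h1 := setIntegral_mul_le (ν := π) (hE.measurableSet_erase i)
      (hψ.measurable.comp (hinv i)) (hfm.comp (hinv i))
      (fun y hy => hψ.abs_le _ (hE.isResolvent_gramErase hy))
      (fun y hy => h.abs_trace_sub_le (hE.isResolvent_gramErase hy)) hs hF
      (by positivity : 0 ≤ √(a * G.trace) + 1) (hψs i) (hfF i)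
    refine le_trans ?_ (mul_le_mul_of_nonneg_left h1 (by positivity))
    rw [← integral_const_mul]
    have hmeas : Measurable fun y : Fin m → Fin d → ℝ => |ψ (gramErase γ G i y)⁻¹| *
      (√(a * G.trace) + 1 + |((gramErase γ G i y)⁻¹ * G).trace - G.trace|) :=
      (hψ.measurable.comp (hinv i)).abs.mul (measurable_const.add (hfm.comp (hinv i)).abs)
    have hmeas' : Measurable fun y : Fin m → Fin d → ℝ => |ψ (gramErase γ G i y)⁻¹| *
      (200 * ρ / (m : ℝ) ^ 2 * (√(a * G.trace) +
        |((gramErase γ G i y)⁻¹ * G).trace - G.trace| + 1) + (250 * ρ / m) ^ 2 / ρ) :=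
      (hψ.measurable.comp (hinv i)).abs.mul ((hβm.comp (hinv i)).add_const _)
    have hpt : ∀ y, |ψ (gramErase γ G i y)⁻¹| *
      (200 * ρ / (m : ℝ) ^ 2 * (√(a * G.trace) +
        |((gramErase γ G i y)⁻¹ * G).trace - G.trace| + 1) + (250 * ρ / m) ^ 2 / ρ) ≤
        62700 * ρ / (m : ℝ) ^ 2 * (|ψ (gramErase γ G i y)⁻¹| *
      (√(a * G.trace) + 1 + |((gramErase γ G i y)⁻¹ * G).trace - G.trace|)) := by
      intro y
      -- The price of restricting to `E` has the order of the mean error, and `62700 = 62500 + 200`.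
      have e2 : (250 * ρ / m) ^ 2 / ρ = 62500 * ρ / (m : ℝ) ^ 2 := by field_simp; norm_num
      rw [e2]
      set g := |((gramErase γ G i y)⁻¹ * G).trace - G.trace|
      have hg : 0 ≤ g := abs_nonneg _
      have : 200 * ρ / (m : ℝ) ^ 2 * (√(a * G.trace) + g + 1) + 62500 * ρ / (m : ℝ) ^ 2 ≤
          62700 * ρ / (m : ℝ) ^ 2 * (√(a * G.trace) + 1 + g) := by
        have hq : 0 ≤ ρ / (m : ℝ) ^ 2 := by positivity
        have e3 : 62700 * ρ / (m : ℝ) ^ 2 * (√(a * G.trace) + 1 + g) -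
          (200 * ρ / (m : ℝ) ^ 2 * (√(a * G.trace) + g + 1) + 62500 * ρ / (m : ℝ) ^ 2) =
          62500 * (ρ / (m : ℝ) ^ 2) * (√(a * G.trace) + g) := by ring
        have : 0 ≤ 62500 * (ρ / (m : ℝ) ^ 2) * (√(a * G.trace) + g) := by positivity
        linarith
      have := mul_le_mul_of_nonneg_left this (abs_nonneg (ψ (gramErase γ G i y)⁻¹))
      linarith
    have hbd : Integrable (fun y : Fin m → Fin d → ℝ => 62700 * ρ / (m : ℝ) ^ 2 *
        (|ψ (gramErase γ G i y)⁻¹| *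
      (√(a * G.trace) + 1 + |((gramErase γ G i y)⁻¹ * G).trace - G.trace|)))
        ((π).restrict (Ei i)) := by
      refine Integrable.const_mul (Integrable.of_bound hmeas.aestronglyMeasurable
        (φ * (√(a * G.trace) + 1 + 4 * G.trace))
        ((ae_restrict_iff' (hE.measurableSet_erase i)).2 (ae_of_all _ fun y hy => ?_))) _
      have hB := hE.isResolvent_gramErase hy
      rw [Real.norm_of_nonneg (by positivity)]
      have := hψ.bound_nonneg
      gcongr
      · exact hψ.abs_le _ hB
      · exact h.abs_trace_sub_le hB
    refine integral_mono (hbd.mono hmeas'.aestronglyMeasurable (ae_of_all _ fun y => ?_)) hbd hpt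
    rw [Real.norm_of_nonneg (by positivity), Real.norm_eq_abs]
    exact (hpt y).trans (le_abs_self _)
  have hint : ∀ i, Integrable (fun y => ψ (sketchGram γ G y)⁻¹ * T (gramErase γ G i y)⁻¹ (y i))
      ((π).restrict E) := by
    intro i
    have hd : Integrable (fun y : Fin m → Fin d → ℝ => (φ * |c|) * (1 + y i ⬝ᵥ y i)) (π) :=
      ((integrable_const (1:ℝ)).add_fun (integrable_row h i)).const_mul _
    refine hd.restrict.mono (((hψ.measurable.comp (measurable_matrix_inv.comp
      (measurable_sketchGram γ G))).mul
        (hTm.comp ((hinv i).prodMk (measurable_pi_apply i)))).aestronglyMeasurable)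
      ((ae_restrict_iff' hE.measurableSet).2 (ae_of_all _ fun y hy => ?_))
    have h0 := dotProduct_self_nonneg' (y i)
    have hφ := hψ.bound_nonneg
    rw [Real.norm_eq_abs, Real.norm_of_nonneg (by positivity), abs_mul, mul_assoc]
    refine mul_le_mul (hψ.abs_le _ (hE.isResolvent_gram (hE.subset i hy)))
      ((hTb _ (hE.isResolvent_gramErase (hE.subset i hy)) _).trans ?_) (abs_nonneg _) hφ
    exact mul_le_mul_of_nonneg_right (le_abs_self c) (by positivity)
  simp only [Finset.mul_sum]
  rw [integral_finsetSum _ fun i _ => hint i, ← Finset.sum_sub_distrib]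
  refine (Finset.abs_sum_le_sum_abs _ _).trans ((Finset.sum_le_sum fun i _ => hstep i).trans ?_)
  rw [Finset.sum_const, Finset.card_univ, Fintype.card_fin, nsmul_eq_mul]
  refine le_of_eq ?_
  field_simp

end Statistic

/-! ### Stability of the trace statistics and passage between `Q` and `B` -/

section Statistics

variable {m d : ℕ} {μ : Measure (Fin d → ℝ)} {W G K B : Matrix (Fin d) (Fin d) ℝ}
  {a ρ γ δ : ℝ} {E : Set (Fin m → Fin d → ℝ)} {Ei : Fin m → Set (Fin m → Fin d → ℝ)}

local notation "π" => Measure.pi fun _ : Fin m => μ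

theorem IsResolvent.norm_sub_one_le (hB : IsResolvent B) : ‖B - 1‖ ≤ 4 := by
  have h1 : ‖(1 : Matrix (Fin d) (Fin d) ℝ)‖ ≤ 1 :=
    Matrix.PosSemidef.one.l2_opNorm_le zero_le_one (by simp)
  exact (norm_sub_le _ _).trans (by linarith [hB.norm_le])

theorem trace_rankOneUpdate_sub (hB : IsResolvent B) (W : Matrix (Fin d) (Fin d) ℝ)
    (x : Fin d → ℝ) :
    (W * rankOneUpdate γ B x).trace - (W * B).trace =
      -(γ / (1 + γ * (x ⬝ᵥ B *ᵥ x)) * (x ⬝ᵥ (B * W * B) *ᵥ x)) := by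
  have := trace_rankOneUpdate (γ := γ) hB.posSemidef.transpose_eq W 1 x
  simp only [mul_one] at this
  rw [this]; ring

theorem abs_trace_rankOneUpdate_sub_le (h : RowLaw μ G a) (hB : IsResolvent B)
    (hm : 1 ≤ (m : ℝ)) (hkm : 2 * G.trace ≤ m) (hγ : γ * (m - G.trace) = 1) (hW : ‖W‖ ≤ 1)
    (x : Fin d → ℝ) :
    |(W * rankOneUpdate γ B x).trace - (W * B).trace| ≤ 18 / m * (x ⬝ᵥ x) := by
  obtain ⟨-, hβ0, hβ, -⟩ := step_facts hm h.trace_nonneg hkm hγ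
    (hB.posSemidef.dotProduct_nonneg x) (hB.sq_le x)
  rw [trace_rankOneUpdate_sub hB, abs_neg, abs_mul, abs_of_nonneg hβ0]
  have h1 := abs_quadForm_le_of_norm (norm_mul_le_mul (norm_mul_le_mul hB.norm_le hW) hB.norm_le) x
  calc _ ≤ 2 / (m : ℝ) * (3 * 1 * 3 * (x ⬝ᵥ x)) := by gcongr
    _ = _ := by ring

/-- No cancellation is needed: a single update moves the trace by `O(ρ/m)` in `L²`, which is already
the precision wanted for comparing `Q` with `B`. -/
theorem hasMomentBounds_trace_rankOneUpdate_sub (h : RowLaw μ G a) (hB : IsResolvent B)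
    (hm : 1 ≤ (m : ℝ)) (hkm : 2 * G.trace ≤ m) (hγ : γ * (m - G.trace) = 1)
    (hW : TestBound μ W ρ) (hρ : 0 ≤ ρ) :
    HasMomentBounds μ (fun x => (W * rankOneUpdate γ B x).trace - (W * B).trace) 0 (18 * ρ / m)
      (18 * ρ / m) := by
  have := h.isProb
  have h2 := hW.integral_sq_le (by norm_num : (0:ℝ) < 3) (by norm_num : (0:ℝ) < 3) hB.norm_le
    hB.norm_le
  have hq := h.memLp_quadForm (B * W * B)
  have hle : ∀ x, |(W * rankOneUpdate γ B x).trace - (W * B).trace| ≤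
      2 / m * |x ⬝ᵥ (B * W * B) *ᵥ x| := by
    intro x
    obtain ⟨-, hβ0, hβ, -⟩ := step_facts hm h.trace_nonneg hkm hγ
      (hB.posSemidef.dotProduct_nonneg x) (hB.sq_le x)
    rw [trace_rankOneUpdate_sub hB, abs_neg, abs_mul, abs_of_nonneg hβ0]
    gcongr
  have hmeas : Measurable fun x => (W * rankOneUpdate γ B x).trace - (W * B).trace := by
    simp only [trace_rankOneUpdate_sub hB]
    fun_prop
  have hmem : MemLp (fun x => (W * rankOneUpdate γ B x).trace - (W * B).trace) 2 μ := by
    refine (memLp_const_mul_abs hq (2 / m)).mono hmeas.aestronglyMeasurable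
      (ae_of_all _ fun x => ?_)
    rw [Real.norm_eq_abs, Real.norm_eq_abs]
    exact (hle x).trans (le_abs_self _)
  have hsq : ∫ x, ((W * rankOneUpdate γ B x).trace - (W * B).trace) ^ 2 ∂μ ≤
      (18 * ρ / m) ^ 2 := by
    have B2 := (meanAbsLe_sq hq h2).const_mul (by positivity : 0 ≤ (2 / (m : ℝ)) ^ 2)
    refine (B2.integral_le_of_le hmem.integrable_sq fun x => ?_).trans (le_of_eq (by ring))
    have := pow_le_pow_left₀ (abs_nonneg _) (hle x) 2
    rwa [sq_abs, mul_pow, sq_abs] at this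
  refine ⟨hmem, hsq, ?_⟩
  rw [sub_zero]
  exact abs_integral_le_integral_abs.trans (integral_abs_le_of_sq hmem (by positivity) hsq)

/-- The computation gives `18/m`; the constant `200` is sized for the quadratic statistic, where
`162 + 18` appears. -/
theorem stableStatistic_trace (h : RowLaw μ G a) (hm : 1 ≤ (m : ℝ)) (hkm : 2 * G.trace ≤ m)
    (hγ : γ * (m - G.trace) = 1) (hK : ‖K‖ ≤ 1) :
    StableStatistic γ (4 * G.trace) (200 / m) (fun B => (K * G * (B - 1)).trace) where
  bound_nonneg := by have := h.trace_nonneg; positivity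
  stability_nonneg := by positivity
  measurable := by
    refine Continuous.measurable ?_
    fun_prop
  abs_le B hB := by
    have := h.abs_trace_mul_le_of_norm (norm_mul_le_mul hB.norm_sub_one_le hK)
    rwa [mul_one, mul_assoc, Matrix.trace_mul_comm] at this
  abs_sub_le B hB x := by
    have h1 := abs_trace_rankOneUpdate_sub_le h hB hm hkm hγ
      (by simpa using norm_mul_le_mul hK h.norm_le_one) x (W := K * G)
    simp only [mul_sub, Matrix.trace_sub] at h1 ⊢
    rw [sub_sub_sub_cancel_right]
    refine h1.trans (mul_le_mul_of_nonneg_right ?_ (dotProduct_self_nonneg' x))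
    gcongr
    norm_num

theorem stableStatistic_trace_sq (h : RowLaw μ G a) (hm : 1 ≤ (m : ℝ)) (hkm : 2 * G.trace ≤ m)
    (hγ : γ * (m - G.trace) = 1) {c : ℝ} (hc : |c| ≤ G.trace) :
    StableStatistic γ (13 * G.trace) (200 / m) (fun B => (G * (B * B - B)).trace - c) where
  bound_nonneg := by have := h.trace_nonneg; positivity
  stability_nonneg := by positivity
  measurable := by
    refine Continuous.measurable ?_
    fun_prop
  abs_le B hB := by
    have := h.abs_trace_mul_le_of_norm ((norm_sub_le _ _).trans
      (add_le_add hB.norm_mul_self_le hB.norm_le))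
    rw [Matrix.trace_mul_comm] at this
    refine (abs_sub _ _).trans ?_
    linarith
  abs_sub_le B hB x := by
    have h1 := abs_trace_rankOneUpdate_sub_le h hB hm hkm hγ h.norm_le_one x
    have hx := dotProduct_self_nonneg' x
    obtain ⟨-, hβ0, hβ, hβb⟩ := step_facts hm h.trace_nonneg hkm hγ
      (hB.posSemidef.dotProduct_nonneg x) (hB.sq_le x)
    have hb₂ := hB.posSemidef_mul_self.dotProduct_nonneg x
    have h2 : |(G * (rankOneUpdate γ B x * rankOneUpdate γ B x)).trace - (G * (B * B)).trace| ≤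
        162 / m * (x ⬝ᵥ x) := by
      have e := trace_rankOneUpdate_sq (γ := γ) hB.posSemidef.transpose_eq G 1 x
      simp only [mul_one] at e
      have q2 := abs_quadForm_le_of_norm (norm_mul_le_mul (norm_mul_le_mul hB.norm_le
        h.norm_le_one) hB.norm_mul_self_le) x
      have q3 := abs_quadForm_le_of_norm (norm_mul_le_mul (norm_mul_le_mul hB.norm_mul_self_le
        h.norm_le_one) hB.norm_le) x
      have q1 := abs_quadForm_le_of_norm (norm_mul_le_mul (norm_mul_le_mul hB.norm_le
        h.norm_le_one) hB.norm_le) x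
      rw [e]
      set β := γ / (1 + γ * (x ⬝ᵥ B *ᵥ x))
      set p1 := x ⬝ᵥ (B * G * B) *ᵥ x
      set p2 := x ⬝ᵥ (B * G * (B * B)) *ᵥ x
      set p3 := x ⬝ᵥ (B * B * G * B) *ᵥ x
      set b₂ := x ⬝ᵥ (B * B) *ᵥ x
      have e2 : (G * (B * B)).trace - β * (p2 + p3) + β ^ 2 * b₂ * p1 - (G * (B * B)).trace =
        β * ((β * b₂) * p1 - (p2 + p3)) := by ring
      rw [e2, abs_mul, abs_of_nonneg hβ0]
      -- The uniform bound `β b₂ ≤ 3` keeps the bracket quadratic, not quartic, in `x`; each of the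
      -- three terms contributes `27`.
      have h3 : |(β * b₂) * p1 - (p2 + p3)| ≤ 81 * (x ⬝ᵥ x) := by
        refine (abs_sub _ _).trans ?_
        rw [abs_mul, abs_of_nonneg (mul_nonneg hβ0 hb₂)]
        have := abs_add_le p2 p3
        have : (β * b₂) * |p1| ≤ 3 * (3 * 1 * 3 * (x ⬝ᵥ x)) :=
          mul_le_mul hβb q1 (abs_nonneg _) (by norm_num)
        linarith
      calc _ ≤ 2 / (m : ℝ) * (81 * (x ⬝ᵥ x)) := by gcongr
        _ = _ := by ring
    have e : (G * (rankOneUpdate γ B x * rankOneUpdate γ B x - rankOneUpdate γ B x)).trace - c -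
        ((G * (B * B - B)).trace - c) =
        ((G * (rankOneUpdate γ B x * rankOneUpdate γ B x)).trace - (G * (B * B)).trace) -
        ((G * rankOneUpdate γ B x).trace - (G * B).trace) := by
      simp only [mul_sub, Matrix.trace_sub]; ring
    rw [e]
    refine (abs_sub _ _).trans ((add_le_add h2 h1).trans ?_)
    rw [← add_mul, ← add_div]
    gcongr
    norm_num

theorem LeaveOneOut.integrable_row_sq (h : RowLaw μ G a) (i : Fin m) :
    Integrable (fun y : Fin m → Fin d → ℝ => (y i ⬝ᵥ y i) ^ 2) (π) := by
  have := h.isProb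
  exact (measurePreserving_eval (fun _ : Fin m => μ) i).integrable_comp_of_integrable
    h.memLp_dot_self.integrable_sq

theorem integral_comp_row [IsProbabilityMeasure μ] {f : (Fin d → ℝ) → ℝ} (hf : Measurable f)
    (i : Fin m) : ∫ y, f (y i) ∂π = ∫ x, f x ∂μ := by
  conv_rhs => rw [← (measurePreserving_eval (fun _ : Fin m => μ) i).map_eq]
  rw [integral_map (measurable_pi_apply i).aemeasurable hf.aestronglyMeasurable]

theorem measurable_dot_self : Measurable fun x : Fin d → ℝ => x ⬝ᵥ x := by
  simpa using measurable_quadForm (1 : Matrix (Fin d) (Fin d) ℝ)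

theorem integral_row_sq_le (h : RowLaw μ G a) (i : Fin m) :
    ∫ y, (y i ⬝ᵥ y i) ^ 2 ∂π ≤ normBound G a ^ 2 := by
  have := h.isProb
  rw [integral_comp_row (f := fun x => (x ⬝ᵥ x) ^ 2) (measurable_dot_self.pow_const 2)]
  exact h.integral_dot_self_sq

theorem integral_row_le (h : RowLaw μ G a) (i : Fin m) :
    ∫ y, y i ⬝ᵥ y i ∂π ≤ normBound G a := by
  have := h.isProb
  rw [integral_comp_row (f := fun x => x ⬝ᵥ x) measurable_dot_self]
  have h1 := integral_abs_le_of_sq (A := normBound G a) h.memLp_dot_self (Real.sqrt_nonneg _)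
    h.integral_dot_self_sq
  simpa only [abs_of_nonneg (dotProduct_self_nonneg' _)] using h1

variable {φ D : ℝ} {ψ : Matrix (Fin d) (Fin d) ℝ → ℝ}

theorem measurable_gramErase_inv (γ : ℝ) (G : Matrix (Fin d) (Fin d) ℝ) (i : Fin m) :
    Measurable fun y : Fin m → Fin d → ℝ => (gramErase γ G i y)⁻¹ :=
  measurable_matrix_inv.comp (measurable_gramErase γ G i)

theorem measurable_sketchGram_inv (γ : ℝ) (G : Matrix (Fin d) (Fin d) ℝ) :
    Measurable fun y : Fin m → Fin d → ℝ => (sketchGram γ G y)⁻¹ :=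
  measurable_matrix_inv.comp (measurable_sketchGram γ G)

theorem integrableOn_of_bound {X : Type*} [MeasurableSpace X] {ν : Measure X} [IsFiniteMeasure ν]
    {S : Set X} (hS : MeasurableSet S) {f : X → ℝ} (hf : Measurable f) {c : ℝ}
    (hc : ∀ x ∈ S, |f x| ≤ c) : IntegrableOn f S ν :=
  Integrable.of_bound hf.aestronglyMeasurable c ((ae_restrict_iff' hS).2 (ae_of_all _ hc))

theorem LeaveOneOut.integrableOn_erase [IsProbabilityMeasure μ] (hE : LeaveOneOut μ G γ δ E Ei)
    (hψ : Measurable ψ) (hb : ∀ B, IsResolvent B → |ψ B| ≤ φ) (i : Fin m) :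
    IntegrableOn (fun y => ψ (gramErase γ G i y)⁻¹) (Ei i) (π) :=
  integrableOn_of_bound (hE.measurableSet_erase i) (hψ.comp (measurable_gramErase_inv γ G i))
    fun _ hy => hb _ (hE.isResolvent_gramErase hy)

theorem LeaveOneOut.integrableOn [IsProbabilityMeasure μ] (hE : LeaveOneOut μ G γ δ E Ei)
    (hψ : Measurable ψ) (hb : ∀ B, IsResolvent B → |ψ B| ≤ φ) (i : Fin m) :
    IntegrableOn (fun y => ψ (sketchGram γ G y)⁻¹) E (π) :=
  integrableOn_of_bound hE.measurableSet (hψ.comp (measurable_sketchGram_inv γ G))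
    fun _ hy => hb _ (hE.isResolvent_gram (hE.subset i hy))

/-- On `E` stability compares `ψ(B)` with `ψ(Q)`; on `Ei i \ E` only the uniform bound `φ` is
available, at the price `φ² δ`. -/
theorem LeaveOneOut.setIntegral_erase_sq_le (h : RowLaw μ G a) (hE : LeaveOneOut μ G γ δ E Ei)
    (hψ : StableStatistic γ φ (D / m) ψ) (i : Fin m) :
    ∫ y in Ei i, ψ (gramErase γ G i y)⁻¹ ^ 2 ∂π ≤
      2 * ∫ y in E, ψ (sketchGram γ G y)⁻¹ ^ 2 ∂π + 2 * (D / m) ^ 2 * normBound G a ^ 2 +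
        φ ^ 2 * δ := by
  have := h.isProb
  have hφ := hψ.bound_nonneg
  have hb : ∀ B, IsResolvent B → |ψ B ^ 2| ≤ φ ^ 2 := fun B hB => by
    rw [abs_pow]; exact pow_le_pow_left₀ (abs_nonneg _) (hψ.abs_le B hB) 2
  have i1 := hE.integrableOn_erase (hψ.measurable.pow_const 2) hb i
  have i2 := hE.integrableOn (hψ.measurable.pow_const 2) hb i
  have hDm := (hE.measurableSet_erase i).diff hE.measurableSet
  have i3 : Integrable ((Ei i \ E).indicator (1 : (Fin m → Fin d → ℝ) → ℝ)) (π) :=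
    (integrable_const (1:ℝ)).indicator hDm
  have i4 := LeaveOneOut.integrable_row_sq (m := m) h i
  rw [← integral_indicator (hE.measurableSet_erase i), ← integral_indicator hE.measurableSet]
  have key : ∀ y, (Ei i).indicator (fun y => ψ (gramErase γ G i y)⁻¹ ^ 2) y ≤
      2 * E.indicator (fun y => ψ (sketchGram γ G y)⁻¹ ^ 2) y +
        2 * (D / m) ^ 2 * (y i ⬝ᵥ y i) ^ 2 +
        φ ^ 2 * (Ei i \ E).indicator (1 : (Fin m → Fin d → ℝ) → ℝ) y := by
    intro y
    by_cases hy : y ∈ Ei i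
    · have hB := hE.isResolvent_gramErase hy
      by_cases hy' : y ∈ E
      · have h1 := hψ.abs_sub_le _ hB (y i)
        rw [← hE.inv_gram hy] at h1
        have h2 := pow_le_pow_left₀ (abs_nonneg _) h1 2
        rw [sq_abs, mul_pow] at h2
        simp only [Set.indicator, Set.mem_sdiff, hy, hy', not_true_eq_false, and_false, if_false,
          if_true, mul_zero]
        nlinarith [sq_nonneg (ψ (gramErase γ G i y)⁻¹ - 2 * ψ (sketchGram γ G y)⁻¹)]
      · have h1 := (le_abs_self _).trans (hb _ hB)
        simp only [Set.indicator, hy, hy', Set.mem_sdiff, not_false_eq_true, and_self, if_true,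
          if_false, Pi.one_apply]
        have : 0 ≤ 2 * (D / m) ^ 2 * (y i ⬝ᵥ y i) ^ 2 := by positivity
        linarith
    · have hy' : y ∉ E := fun h' => hy (hE.subset i h')
      simp only [Set.indicator, hy, hy', Set.mem_sdiff, false_and, if_false]
      positivity
  refine (integral_mono (i1.integrable_indicator (hE.measurableSet_erase i))
    ((((i2.integrable_indicator hE.measurableSet).const_mul 2).add_fun (i4.const_mul _)).add_fun
      (i3.const_mul _)) key).trans ?_
  rw [integral_add (((i2.integrable_indicator hE.measurableSet).const_mul 2).add_fun
    (i4.const_mul _)) (i3.const_mul _), integral_add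
    ((i2.integrable_indicator hE.measurableSet).const_mul 2) (i4.const_mul _),
    integral_const_mul, integral_const_mul, integral_const_mul, integral_indicator_one hDm]
  gcongr
  · exact integral_row_sq_le h i
  · exact hE.prob_diff_le i

theorem LeaveOneOut.abs_setIntegral_erase_sub_le (h : RowLaw μ G a)
    (hE : LeaveOneOut μ G γ δ E Ei) (hψ : StableStatistic γ φ (D / m) ψ) (i : Fin m) :
    |∫ y in Ei i, ψ (gramErase γ G i y)⁻¹ ∂π - ∫ y in E, ψ (sketchGram γ G y)⁻¹ ∂π| ≤
      D / m * normBound G a + φ * δ := by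
  have := h.isProb
  have hφ := hψ.bound_nonneg
  have hD := hψ.stability_nonneg
  have i1 := hE.integrableOn_erase hψ.measurable hψ.abs_le i
  have i2 := hE.integrableOn hψ.measurable hψ.abs_le i
  have hDm := (hE.measurableSet_erase i).diff hE.measurableSet
  have i3 : Integrable ((Ei i \ E).indicator (1 : (Fin m → Fin d → ℝ) → ℝ)) (π) :=
    (integrable_const (1:ℝ)).indicator hDm
  have i4 := integrable_row (m := m) h i
  rw [← integral_indicator (hE.measurableSet_erase i), ← integral_indicator hE.measurableSet,
    ← integral_sub (i1.integrable_indicator (hE.measurableSet_erase i))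
      (i2.integrable_indicator hE.measurableSet)]
  have key : ∀ y, |(Ei i).indicator (fun y => ψ (gramErase γ G i y)⁻¹) y -
      E.indicator (fun y => ψ (sketchGram γ G y)⁻¹) y| ≤
        D / m * (y i ⬝ᵥ y i) + φ * (Ei i \ E).indicator (1 : (Fin m → Fin d → ℝ) → ℝ) y := by
    intro y
    have hx := mul_nonneg hD (dotProduct_self_nonneg' (y i))
    by_cases hy : y ∈ Ei i
    · have hB := hE.isResolvent_gramErase hy
      by_cases hy' : y ∈ E
      · have h1 := hψ.abs_sub_le _ hB (y i)
        rw [← hE.inv_gram hy, abs_sub_comm] at h1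
        simpa only [Set.indicator, hy, hy', Set.mem_sdiff, not_true_eq_false, and_false, if_false,
          if_true, mul_zero, add_zero] using h1
      · have h1 := hψ.abs_le _ hB
        simp only [Set.indicator, hy, hy', Set.mem_sdiff, not_false_eq_true, and_self, if_true,
          if_false, Pi.one_apply, sub_zero]
        linarith
    · have hy' : y ∉ E := fun h' => hy (hE.subset i h')
      simp only [Set.indicator, hy, hy', Set.mem_sdiff, false_and, if_false, sub_zero, abs_zero]
      linarith
  refine abs_integral_le_integral_abs.trans ((integral_mono
    ((i1.integrable_indicator (hE.measurableSet_erase i)).sub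
      (i2.integrable_indicator hE.measurableSet)).abs
    ((i4.const_mul _).add_fun (i3.const_mul _)) key).trans ?_)
  rw [integral_add (i4.const_mul _) (i3.const_mul _), integral_const_mul, integral_const_mul,
    integral_indicator_one hDm]
  gcongr
  · exact integral_row_le h i
  · exact hE.prob_diff_le i

end Statistics

/-! ### Self-bounding second moment estimates for linear trace statistics -/

section Model

variable {m d : ℕ} {μ : Measure (Fin d → ℝ)} {W G K : Matrix (Fin d) (Fin d) ℝ}
  {a ρ γ δ : ℝ} {E : Set (Fin m → Fin d → ℝ)} {Ei : Fin m → Set (Fin m → Fin d → ℝ)}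

local notation "π" => Measure.pi fun _ : Fin m => μ

/-- The standing assumptions on the normalized sketch. -/
structure SketchModel (μ : Measure (Fin d → ℝ)) (G : Matrix (Fin d) (Fin d) ℝ) (a γ δ : ℝ)
    (E : Set (Fin m → Fin d → ℝ)) (Ei : Fin m → Set (Fin m → Fin d → ℝ)) : Prop where
  row : RowLaw μ G a
  loo : LeaveOneOut μ G γ δ E Ei
  one_le : 1 ≤ (m : ℝ)
  stepSize : γ * (m - G.trace) = 1
  trace_pos : 0 < G.trace
  large : 10 ^ 13 * (a * G.trace) ≤ m
  delta_nonneg : 0 ≤ δ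
  delta_le : δ ≤ 1 / (m : ℝ) ^ 3

/-- AM–GM with the coefficients of `s²` and `F²` kept small enough to be absorbed into the left side
of the variance inequalities. -/
theorem mul_sum_le_of_small {A s σ F : ℝ} (hA : 0 ≤ A) (hA' : A ≤ 1 / 16) :
    A * (s * (σ + 1 + F)) ≤ s ^ 2 / 8 + σ ^ 2 / 32 + F ^ 2 / 32 + 4 * A ^ 2 := by
  have h1 : A * (s * σ) ≤ 1 / 16 * ((s ^ 2 + σ ^ 2) / 2) := by
    have : s * σ ≤ (s ^ 2 + σ ^ 2) / 2 := by nlinarith [sq_nonneg (s - σ)]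
    exact (mul_le_mul_of_nonneg_left this hA).trans
      (mul_le_mul_of_nonneg_right hA' (by positivity))
  have h2 : A * (s * F) ≤ 1 / 16 * ((s ^ 2 + F ^ 2) / 2) := by
    have : s * F ≤ (s ^ 2 + F ^ 2) / 2 := by nlinarith [sq_nonneg (s - F)]
    exact (mul_le_mul_of_nonneg_left this hA).trans
      (mul_le_mul_of_nonneg_right hA' (by positivity))
  nlinarith [sq_nonneg (s / 4 - 2 * A)]

namespace SketchModel

theorem trace_le (M : SketchModel μ G a γ δ E Ei) : G.trace ≤ a * G.trace :=
  le_mul_of_one_le_left M.trace_pos.le M.row.one_le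

theorem trace_le_smul (M : SketchModel μ G a γ δ E Ei) : 10 ^ 13 * G.trace ≤ m := by
  have := M.trace_le
  have := M.large
  linarith

theorem two_mul_trace_le (M : SketchModel μ G a γ δ E Ei) : 2 * G.trace ≤ m := by
  have := M.trace_le_smul
  have := M.trace_pos
  linarith

theorem normBound_pos (M : SketchModel μ G a γ δ E Ei) : 0 < normBound G a := by
  have := M.trace_pos
  have := M.row.one_le
  exact Real.sqrt_pos.2 (by positivity)

theorem normBound_sq_div_sq_le (M : SketchModel μ G a γ δ E Ei) :
    normBound G a ^ 2 / (m : ℝ) ^ 2 ≤ 2 * (a * G.trace) := by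
  have h1 := M.one_le
  have h2 := M.trace_le_smul
  have h3 := M.trace_pos
  have h4 := M.trace_le
  rw [M.row.normBound_sq, div_le_iff₀ (by positivity)]
  have : (m:ℝ) ≤ m ^ 2 := by nlinarith
  nlinarith [mul_le_mul_of_nonneg_left this (by linarith : 0 ≤ a * G.trace)]

theorem normBound_sq_div_le (M : SketchModel μ G a γ δ E Ei) :
    normBound G a ^ 2 / (m : ℝ) ≤ 2 * (a * G.trace) := by
  have h1 := M.one_le
  have h2 := M.trace_le_smul
  have h3 := M.trace_pos
  have h4 := M.trace_le
  rw [M.row.normBound_sq, div_le_iff₀ (by positivity)]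
  nlinarith [mul_le_mul_of_nonneg_left h1 (by linarith : 0 ≤ a * G.trace)]

/-- Writing `k = tr G`, the term `ak ≤ 10⁻¹³ m ≤ 10⁻¹³ m²` dominates under the root. The size of the
constant in `large` brings `62700 * normBound G a / m` below the `1/16` required for absorption. -/
theorem normBound_div_le (M : SketchModel μ G a γ δ E Ei) :
    normBound G a / (m : ℝ) ≤ 1 / (2 * 10 ^ 6) := by
  have h1 := M.one_le
  have h2 := M.trace_le_smul
  have h3 := M.trace_pos
  have h4 := M.large
  rw [div_le_iff₀ (by linarith), normBound, Real.sqrt_le_left (by positivity)]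
  nlinarith

theorem delta_mul_le (M : SketchModel μ G a γ δ E Ei) : (m : ℝ) ^ 2 * δ ≤ 1 / m := by
  have h1 := M.one_le
  have := mul_le_mul_of_nonneg_left M.delta_le (by positivity : (0:ℝ) ≤ (m:ℝ) ^ 2)
  refine this.trans (le_of_eq ?_)
  field_simp

theorem delta_mul_le_one (M : SketchModel μ G a γ δ E Ei) : (m : ℝ) ^ 2 * δ ≤ 1 :=
  M.delta_mul_le.trans ((div_le_one (by linarith [M.one_le])).2 M.one_le)

theorem trace_sq_mul_delta_le (M : SketchModel μ G a γ δ E Ei) :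
    G.trace ^ 2 * δ ≤ G.trace := by
  have h1 := M.delta_mul_le_one
  have h2 := M.trace_le_smul
  have h3 := M.trace_pos
  have h4 := M.delta_nonneg
  have h5 := M.one_le
  have h6 : G.trace ≤ (m:ℝ) ^ 2 := by nlinarith
  nlinarith [mul_le_mul_of_nonneg_right h6 (mul_nonneg h3.le h4)]

theorem mul_trace_mul_normBound_mul_delta_le (M : SketchModel μ G a γ δ E Ei) :
    m * (G.trace * normBound G a * δ) ≤ G.trace := by
  have h1 := M.delta_mul_le_one
  have h3 := M.trace_pos
  have h4 := M.delta_nonneg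
  have h5 := M.one_le
  have h6 := M.normBound_div_le
  rw [div_le_iff₀ (by linarith)] at h6
  have h7 : normBound G a ≤ m := by linarith
  have h8 := mul_le_mul_of_nonneg_right h7 (by positivity : 0 ≤ m * (G.trace * δ))
  nlinarith [mul_le_mul_of_nonneg_left h1 h3.le]

/-- The weighted identity for `Q - 1`. With `ψ = 1` it bounds a bias; with `ψ` equal to the trace
statistic itself it bounds a second moment. -/
theorem abs_setIntegral_mul_trace_le (M : SketchModel μ G a γ δ E Ei)
    {ψ : Matrix (Fin d) (Fin d) ℝ → ℝ} {φ D s F : ℝ} (hW : TestBound μ W ρ) (hρ : 0 < ρ)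
    (hψ : StableStatistic γ φ (D / m) ψ) (hs : 0 ≤ s) (hF : 0 ≤ F)
    (hψs : ∀ i, ∫ y in Ei i, ψ (gramErase γ G i y)⁻¹ ^ 2 ∂π ≤ s ^ 2)
    (hfF : ∀ i, ∫ y in Ei i, (((gramErase γ G i y)⁻¹ * G).trace - G.trace) ^ 2 ∂π ≤ F ^ 2) :
    |∫ y in E, ψ (sketchGram γ G y)⁻¹ * (W * ((sketchGram γ G y)⁻¹ - 1)).trace ∂π| ≤
      62700 * ρ / m * (s * (√(a * G.trace) + 1 + F)) + m * (φ * ρ * δ) +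
        250 * D * normBound G a * ρ / m := by
  have h := M.loo.abs_setIntegral_sum_sub_le M.row M.one_le hρ (M := fun _ => 0) (cM := 0)
    (fun B hB => hasMomentBounds_rowTerm M.row hB hW hρ.le M.one_le M.two_mul_trace_le M.stepSize)
    measurable_rowTerm_prod
    (fun B hB x => abs_rowTerm_le_growth M.row hB M.one_le M.two_mul_trace_le M.stepSize x)
    hψ measurable_const (fun _ _ => by simp) hs hF hψs hfF
  simp only [mul_zero, integral_zero, Finset.sum_const_zero, sub_zero] at h
  have hm0 : (m : ℝ) ≠ 0 := by linarith [M.one_le]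
  have : Nonempty (Fin m) := Fin.pos_iff_nonempty.1 (Nat.pos_of_ne_zero (by exact_mod_cast hm0))
  convert h using 2
  refine setIntegral_congr_fun M.loo.measurableSet fun y hy => ?_
  rw [sum_rowTerm hm0 (M.loo.posDef_gram (M.loo.subset (Classical.arbitrary _) hy)).isUnit
    fun i => M.loo.inv_gram (M.loo.subset i hy)]

/-- The weighted identity for `Q² - Q`; the subtracted sum is the mean that does not cancel. -/
theorem abs_setIntegral_mul_trace_sq_sub_le (M : SketchModel μ G a γ δ E Ei)
    {ψ : Matrix (Fin d) (Fin d) ℝ → ℝ} {φ D s F : ℝ} (hW : TestBound μ W ρ) (hρ : 0 < ρ)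
    (hψ : StableStatistic γ φ (D / m) ψ) (hs : 0 ≤ s) (hF : 0 ≤ F)
    (hψs : ∀ i, ∫ y in Ei i, ψ (gramErase γ G i y)⁻¹ ^ 2 ∂π ≤ s ^ 2)
    (hfF : ∀ i, ∫ y in Ei i, (((gramErase γ G i y)⁻¹ * G).trace - G.trace) ^ 2 ∂π ≤ F ^ 2) :
    |∫ y in E, ψ (sketchGram γ G y)⁻¹ * (W * ((sketchGram γ G y)⁻¹ * (sketchGram γ G y)⁻¹ -
        (sketchGram γ G y)⁻¹)).trace ∂π -
      ∑ i, ∫ y in Ei i, ψ (gramErase γ G i y)⁻¹ * (1 / (m : ℝ) ^ 2 *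
        (((gramErase γ G i y)⁻¹ * (gramErase γ G i y)⁻¹ * G).trace *
          (W * (gramErase γ G i y)⁻¹ * G).trace)) ∂π| ≤
      62700 * ρ / m * (s * (√(a * G.trace) + 1 + F)) + m * (φ * ρ * δ) +
        250 * D * normBound G a * ρ / m := by
  have hm0 : (m : ℝ) ≠ 0 := by linarith [M.one_le]
  have hk := M.trace_pos
  have h := M.loo.abs_setIntegral_sum_sub_le M.row M.one_le hρ
    (M := fun B => 1 / (m : ℝ) ^ 2 * ((B * B * G).trace * (W * B * G).trace))
    (cM := 1 / (m : ℝ) ^ 2 * ((9 * G.trace) * (‖W‖ * 3 * G.trace)))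
    (fun B hB => hasMomentBounds_rowTermSq M.row hB hW hρ.le M.one_le M.two_mul_trace_le
      M.stepSize)
    measurable_rowTermSq_prod
    (fun B hB x => abs_rowTermSq_le_growth M.row hB M.one_le M.two_mul_trace_le M.stepSize x)
    hψ (Continuous.measurable (by fun_prop)) (fun B hB => by
      rw [abs_mul, abs_mul, abs_of_nonneg (by positivity : 0 ≤ 1 / (m : ℝ) ^ 2)]
      gcongr
      · exact M.row.abs_trace_mul_le_of_norm hB.norm_mul_self_le
      · exact M.row.abs_trace_mul_le_of_norm (norm_mul_le_mul le_rfl hB.norm_le)) hs hF hψs hfF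
  have : Nonempty (Fin m) := Fin.pos_iff_nonempty.1 (Nat.pos_of_ne_zero (by exact_mod_cast hm0))
  convert h using 3
  refine setIntegral_congr_fun M.loo.measurableSet fun y hy => ?_
  rw [sum_rowTermSq hm0 (M.loo.posDef_gram (M.loo.subset (Classical.arbitrary _) hy)).isUnit
    fun i => M.loo.inv_gram (M.loo.subset i hy)]

theorem trace_mul_sub_one (B : Matrix (Fin d) (Fin d) ℝ) :
    (1 * G * (B - 1)).trace = (B * G).trace - G.trace := by
  rw [one_mul, mul_sub, mul_one, Matrix.trace_sub, Matrix.trace_mul_comm]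

theorem setIntegral_erase_sq_le_of_le (M : SketchModel μ G a γ δ E Ei) {c V : ℝ}
    {ψ : Matrix (Fin d) (Fin d) ℝ → ℝ} (hc : c ^ 2 ≤ 169)
    (hψ : StableStatistic γ (c * G.trace) (200 / m) ψ)
    (hV : ∫ y in E, ψ (sketchGram γ G y)⁻¹ ^ 2 ∂π ≤ V) (i : Fin m) :
    ∫ y in Ei i, ψ (gramErase γ G i y)⁻¹ ^ 2 ∂π ≤ 2 * V + 200000 * (a * G.trace) := by
  refine (M.loo.setIntegral_erase_sq_le M.row hψ i).trans ?_
  have h1 := M.normBound_sq_div_sq_le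
  have h2 := M.trace_sq_mul_delta_le
  have h3 := M.trace_le
  have h4 := M.delta_nonneg
  have h5 : 0 ≤ G.trace ^ 2 * δ := by positivity
  have e : 2 * (200 / (m : ℝ)) ^ 2 * normBound G a ^ 2 =
    80000 * (normBound G a ^ 2 / (m : ℝ) ^ 2) := by ring
  rw [e]
  nlinarith [mul_le_mul_of_nonneg_right hc h5]

/-- The common part of the self-improving second moment estimates. -/
theorem remainder_le (M : SketchModel μ G a γ δ E Ei) {c s F : ℝ} (hc : c ≤ 13) :
    62700 * normBound G a / m * (s * (√(a * G.trace) + 1 + F)) +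
      m * (c * G.trace * normBound G a * δ) + 250 * 200 * normBound G a * normBound G a / m ≤
    s ^ 2 / 8 + F ^ 2 / 32 + 10 ^ 11 * (a * G.trace) := by
  have h1 := M.normBound_sq_div_sq_le
  have h2 := M.normBound_sq_div_le
  have h3 := M.mul_trace_mul_normBound_mul_delta_le
  have h4 := M.normBound_div_le
  have h5 := M.normBound_pos
  have h6 := M.trace_pos
  have h7 := M.trace_le
  have h8 := M.delta_nonneg
  have hm := M.one_le
  have hσ : √(a * G.trace) ^ 2 = a * G.trace := Real.sq_sqrt (by linarith)
  have e1 : 62700 * normBound G a / m = 62700 * (normBound G a / m) := by ring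
  have e2 : 250 * 200 * normBound G a * normBound G a / m =
    50000 * (normBound G a ^ 2 / m) := by ring
  have e3 : m * (c * G.trace * normBound G a * δ) =
    c * (m * (G.trace * normBound G a * δ)) := by ring
  have h9 : 0 ≤ m * (G.trace * normBound G a * δ) := by positivity
  have h10 := mul_sum_le_of_small (s := s) (σ := √(a * G.trace)) (F := F)
    (by positivity : 0 ≤ 62700 * (normBound G a / m)) (by linarith)
  have e4 : (62700 * (normBound G a / m)) ^ 2 =
    62700 ^ 2 * (normBound G a ^ 2 / (m : ℝ) ^ 2) := by ring
  rw [hσ, e4] at h10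
  rw [e1, e2, e3]
  have h11 := mul_le_mul_of_nonneg_right hc h9
  nlinarith

/-- Self-improvement: weighting the identity by the statistic itself bounds `V` by a fraction of `V`
plus `O(a tr G)`. The uniform bound on the statistic makes `V` finite beforehand, so absorption is
legitimate. -/
theorem setIntegral_trace_sq_le (M : SketchModel μ G a γ δ E Ei) :
    ∫ y in E, (1 * G * ((sketchGram γ G y)⁻¹ - 1)).trace ^ 2 ∂π ≤ 10 ^ 12 * (a * G.trace) := by
  have hK : ‖(1 : Matrix (Fin d) (Fin d) ℝ)‖ ≤ 1 :=
    Matrix.PosSemidef.one.l2_opNorm_le zero_le_one (by simp)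
  have hψ := stableStatistic_trace M.row M.one_le M.two_mul_trace_le M.stepSize hK
  set V := ∫ y in E, (1 * G * ((sketchGram γ G y)⁻¹ - 1)).trace ^ 2 ∂π with hV
  have hV0 : 0 ≤ V := integral_nonneg fun _ => sq_nonneg _
  have hx : 0 ≤ a * G.trace := M.trace_pos.le.trans M.trace_le
  have hs := M.setIntegral_erase_sq_le_of_le (by norm_num) hψ hV.ge
  set s := √(2 * V + 200000 * (a * G.trace)) with hsdef
  have hs2 : s ^ 2 = 2 * V + 200000 * (a * G.trace) := Real.sq_sqrt (by positivity)
  rw [← hs2] at hs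
  have hW := M.row.testBound_of_norm_le_one (W := 1 * G)
    (by simpa using M.row.norm_le_one)
  -- The weight and the fluctuation `tr(BG) - tr G` coincide here, so `F = s`.
  have h := M.abs_setIntegral_mul_trace_le hW M.normBound_pos hψ (Real.sqrt_nonneg _)
    (Real.sqrt_nonneg _) hs (by simpa only [trace_mul_sub_one] using hs)
  have h2 := (le_abs_self _).trans (h.trans (M.remainder_le (by norm_num)))
  simp only [← sq, ← hV] at h2
  rw [← hsdef, hs2] at h2
  linarith

theorem setIntegral_erase_trace_sq_le (M : SketchModel μ G a γ δ E Ei) (i : Fin m) :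
    ∫ y in Ei i, (((gramErase γ G i y)⁻¹ * G).trace - G.trace) ^ 2 ∂π ≤
      (√(3 * 10 ^ 12 * (a * G.trace))) ^ 2 := by
  have hK : ‖(1 : Matrix (Fin d) (Fin d) ℝ)‖ ≤ 1 :=
    Matrix.PosSemidef.one.l2_opNorm_le zero_le_one (by simp)
  have hψ := stableStatistic_trace M.row M.one_le M.two_mul_trace_le M.stepSize hK
  have hx : 0 ≤ a * G.trace := M.trace_pos.le.trans M.trace_le
  have := M.setIntegral_erase_sq_le_of_le (by norm_num) hψ M.setIntegral_trace_sq_le i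
  rw [Real.sq_sqrt (by positivity)]
  simp only [trace_mul_sub_one] at this
  linarith

/-- The same absorption with `G²` in place of `G`, now with `F` already known; it is needed to
replace `tr(GBG)` by `tr(G²)` in the second moment. -/
theorem setIntegral_trace_mul_sq_le (M : SketchModel μ G a γ δ E Ei) :
    ∫ y in E, (G * G * ((sketchGram γ G y)⁻¹ - 1)).trace ^ 2 ∂π ≤ 10 ^ 12 * (a * G.trace) := by
  have hψ := stableStatistic_trace M.row M.one_le M.two_mul_trace_le M.stepSize M.row.norm_le_one
  set V := ∫ y in E, (G * G * ((sketchGram γ G y)⁻¹ - 1)).trace ^ 2 ∂π with hV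
  have hV0 : 0 ≤ V := integral_nonneg fun _ => sq_nonneg _
  have hx : 0 ≤ a * G.trace := M.trace_pos.le.trans M.trace_le
  have hs := M.setIntegral_erase_sq_le_of_le (by norm_num) hψ hV.ge
  set s := √(2 * V + 200000 * (a * G.trace)) with hsdef
  have hs2 : s ^ 2 = 2 * V + 200000 * (a * G.trace) := Real.sq_sqrt (by positivity)
  rw [← hs2] at hs
  have hW := M.row.testBound_of_norm_le_one (W := G * G)
    (by simpa using norm_mul_le_mul M.row.norm_le_one M.row.norm_le_one)
  have h := M.abs_setIntegral_mul_trace_le hW M.normBound_pos hψ (Real.sqrt_nonneg _)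
    (Real.sqrt_nonneg _) hs M.setIntegral_erase_trace_sq_le
  have h2 := (le_abs_self _).trans (h.trans (M.remainder_le (by norm_num)))
  have e : ∫ y in E, (G * G * ((sketchGram γ G y)⁻¹ - 1)).trace *
      (G * G * ((sketchGram γ G y)⁻¹ - 1)).trace ∂π = V := by
    rw [hV]
    exact integral_congr_ae (ae_of_all _ fun y => (sq _).symm)
  rw [e, ← hsdef, hs2, Real.sq_sqrt (by positivity)] at h2
  linarith

theorem setIntegral_erase_trace_mul_sq_le (M : SketchModel μ G a γ δ E Ei) (i : Fin m) :
    ∫ y in Ei i, (G * G * ((gramErase γ G i y)⁻¹ - 1)).trace ^ 2 ∂π ≤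
      (√(3 * 10 ^ 12 * (a * G.trace))) ^ 2 := by
  have hψ := stableStatistic_trace M.row M.one_le M.two_mul_trace_le M.stepSize M.row.norm_le_one
  have hx : 0 ≤ a * G.trace := M.trace_pos.le.trans M.trace_le
  have := M.setIntegral_erase_sq_le_of_le (by norm_num) hψ M.setIntegral_trace_mul_sq_le i
  rw [Real.sq_sqrt (by positivity)]
  linarith

end SketchModel

end Model

/-! ### The self-consistent trace of the squared resolvent -/

section SecondMoment

variable {m d : ℕ} {μ : Measure (Fin d → ℝ)} {G : Matrix (Fin d) (Fin d) ℝ}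
  {a γ δ : ℝ} {E : Set (Fin m → Fin d → ℝ)} {Ei : Fin m → Set (Fin m → Fin d → ℝ)}

local notation "π" => Measure.pi fun _ : Fin m => μ

/-- The coefficient of `G` in the expansion of the second inverse moment. -/
noncomputable def secondMomentCoeff (m : ℕ) (G : Matrix (Fin d) (Fin d) ℝ) : ℝ :=
  G.trace / (m - (G * G).trace)

/-- The recentered statistic `tr(G(B² - B))`. -/
noncomputable def centeredTrace (m : ℕ) (G B : Matrix (Fin d) (Fin d) ℝ) : ℝ :=
  (G * (B * B - B)).trace - secondMomentCoeff m G * (G * G).trace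

theorem RowLaw.trace_mul_self_nonneg (h : RowLaw μ G a) : 0 ≤ (G * G).trace := by
  have := (Matrix.posSemidef_conjTranspose_mul_self G).trace_nonneg
  rwa [h.posSemidef.isHermitian.eq] at this

theorem RowLaw.trace_mul_self_le (h : RowLaw μ G a) : (G * G).trace ≤ G.trace := by
  have := h.abs_trace_mul_le_of_norm h.norm_le_one
  rw [one_mul] at this
  exact (le_abs_self _).trans this

namespace SketchModel

/-- The fixed point equation for `c = secondMomentCoeff m G`: heuristically `tr(GQ²) ≈ tr(GQ) +
tr(GQ²) tr(G²)/m`, solved by `tr(GQ²) = mc`. -/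
theorem secondMomentCoeff_mul (M : SketchModel μ G a γ δ E Ei) :
    m * secondMomentCoeff m G = G.trace + secondMomentCoeff m G * (G * G).trace := by
  have h1 := M.row.trace_mul_self_le
  have h2 := M.trace_le_smul
  have h3 := M.trace_pos
  have : (m : ℝ) - (G * G).trace ≠ 0 := by linarith
  rw [secondMomentCoeff]
  field_simp
  ring

theorem secondMomentCoeff_nonneg (M : SketchModel μ G a γ δ E Ei) :
    0 ≤ secondMomentCoeff m G := by
  have h1 := M.row.trace_mul_self_le
  have h2 := M.trace_le_smul
  have h3 := M.trace_pos
  exact div_nonneg h3.le (by linarith)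

theorem secondMomentCoeff_le (M : SketchModel μ G a γ δ E Ei) :
    m * secondMomentCoeff m G ≤ 2 * G.trace := by
  have h1 := M.row.trace_mul_self_le
  have h2 := M.trace_le_smul
  have h3 := M.trace_pos
  have h4 := M.secondMomentCoeff_nonneg
  have h5 := M.secondMomentCoeff_mul
  have h6 := M.one_le
  have : (G * G).trace * secondMomentCoeff m G ≤ (m / 2) * secondMomentCoeff m G :=
    mul_le_mul_of_nonneg_right (by linarith) h4
  linarith

theorem secondMomentCoeff_le_one (M : SketchModel μ G a γ δ E Ei) :
    secondMomentCoeff m G ≤ 1 := by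
  have h2 := M.two_mul_trace_le
  have h4 := M.secondMomentCoeff_le
  have h6 := M.one_le
  by_contra hc
  nlinarith

theorem secondMomentCoeff_mul_trace_nonneg (M : SketchModel μ G a γ δ E Ei) :
    0 ≤ secondMomentCoeff m G * (G * G).trace :=
  mul_nonneg M.secondMomentCoeff_nonneg M.row.trace_mul_self_nonneg

theorem secondMomentCoeff_mul_trace_le (M : SketchModel μ G a γ δ E Ei) :
    secondMomentCoeff m G * (G * G).trace ≤ G.trace :=
  (mul_le_of_le_one_left M.row.trace_mul_self_nonneg M.secondMomentCoeff_le_one).trans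
    M.row.trace_mul_self_le

theorem stableStatistic_centeredTrace (M : SketchModel μ G a γ δ E Ei) :
    StableStatistic γ (13 * G.trace) (200 / m) (centeredTrace m G) :=
  stableStatistic_trace_sq M.row M.one_le M.two_mul_trace_le M.stepSize
    ((abs_of_nonneg M.secondMomentCoeff_mul_trace_nonneg).trans_le M.secondMomentCoeff_mul_trace_le)

/-- Isolates the deterministic value `mc` of `tr(B²G)`; the other two terms are fluctuations
controlled in `L²`. -/
theorem trace_mul_self_mul (M : SketchModel μ G a γ δ E Ei) (B : Matrix (Fin d) (Fin d) ℝ) :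
    (B * B * G).trace =
      centeredTrace m G B + ((B * G).trace - G.trace) + m * secondMomentCoeff m G := by
  rw [M.secondMomentCoeff_mul, centeredTrace, mul_sub, Matrix.trace_sub, Matrix.trace_mul_comm G B,
    Matrix.trace_mul_comm G]
  ring

theorem trace_sandwich (B : Matrix (Fin d) (Fin d) ℝ) :
    (G * B * G).trace = (G * G * (B - 1)).trace + (G * G).trace := by
  rw [mul_sub, mul_one, Matrix.trace_sub, Matrix.trace_mul_comm, ← mul_assoc]
  ring

theorem integrableOn_erase_sq (M : SketchModel μ G a γ δ E Ei) {φ D : ℝ}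
    {ψ : Matrix (Fin d) (Fin d) ℝ → ℝ} (hψ : StableStatistic γ φ D ψ) (i : Fin m) :
    IntegrableOn (fun y => ψ (gramErase γ G i y)⁻¹ ^ 2) (Ei i) (π) := by
  have := M.row.isProb
  refine M.loo.integrableOn_erase (hψ.measurable.pow_const 2) (φ := φ ^ 2) (fun B hB => ?_) i
  rw [abs_pow]
  exact pow_le_pow_left₀ (abs_nonneg _) (hψ.abs_le B hB) 2

theorem stableStatistic_trace_sub (M : SketchModel μ G a γ δ E Ei) :
    StableStatistic γ (4 * G.trace) (200 / m) (fun B => (B * G).trace - G.trace) := by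
  have hK : ‖(1 : Matrix (Fin d) (Fin d) ℝ)‖ ≤ 1 :=
    Matrix.PosSemidef.one.l2_opNorm_le zero_le_one (by simp)
  have hψ := stableStatistic_trace M.row M.one_le M.two_mul_trace_le M.stepSize hK
  simpa only [trace_mul_sub_one] using hψ

theorem stableStatistic_trace_mul_sub (M : SketchModel μ G a γ δ E Ei) :
    StableStatistic γ (4 * G.trace) (200 / m) (fun B => (G * G * (B - 1)).trace) :=
  stableStatistic_trace M.row M.one_le M.two_mul_trace_le M.stepSize M.row.norm_le_one

/-- To leading order the surviving term is linear in the statistic, with coefficient `c tr(G²)/m`;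
what remains is quadratic in fluctuations and has the small prefactor `tr G / m²`. -/
theorem abs_setIntegral_centeredTrace_mul_sub_le (M : SketchModel μ G a γ δ E Ei) {s : ℝ}
    (hs : ∀ i, ∫ y in Ei i, centeredTrace m G (gramErase γ G i y)⁻¹ ^ 2 ∂π ≤ s ^ 2) (i : Fin m) :
    |∫ y in Ei i, centeredTrace m G (gramErase γ G i y)⁻¹ * (1 / (m : ℝ) ^ 2 *
        (((gramErase γ G i y)⁻¹ * (gramErase γ G i y)⁻¹ * G).trace *
          (G * (gramErase γ G i y)⁻¹ * G).trace)) ∂π -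
      secondMomentCoeff m G * (G * G).trace / m *
        ∫ y in Ei i, centeredTrace m G (gramErase γ G i y)⁻¹ ∂π| ≤
      G.trace / (m : ℝ) ^ 2 * (6 * s ^ 2 + 12 * 10 ^ 12 * (a * G.trace)) := by
  have := M.row.isProb
  have hk := M.trace_pos
  have hm0 : (m : ℝ) ≠ 0 := by linarith [M.one_le]
  have hh := M.stableStatistic_centeredTrace
  have hX : 0 ≤ a * G.trace := hk.le.trans M.trace_le
  have j1 := M.integrableOn_erase_sq hh i
  have j2 := M.integrableOn_erase_sq M.stableStatistic_trace_sub i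
  have j3 := M.integrableOn_erase_sq M.stableStatistic_trace_mul_sub i
  have b2 := M.setIntegral_erase_trace_sq_le i
  have b3 := M.setIntegral_erase_trace_mul_sq_le i
  rw [Real.sq_sqrt (by positivity)] at b2 b3
  have i1 := M.loo.integrableOn_erase hh.measurable hh.abs_le i
  have hMm : Measurable fun B : Matrix (Fin d) (Fin d) ℝ => centeredTrace m G B *
      (1 / (m : ℝ) ^ 2 * ((B * B * G).trace * (G * B * G).trace)) :=
    hh.measurable.mul (Continuous.measurable (by fun_prop))
  have hM3 : ∀ B, IsResolvent B → |(G * B * G).trace| ≤ 3 * G.trace := fun B hB =>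
    M.row.abs_trace_mul_le_of_norm (by simpa using norm_mul_le_mul M.row.norm_le_one hB.norm_le)
  have i2 := M.loo.integrableOn_erase hMm
    (φ := 13 * G.trace * (1 / (m : ℝ) ^ 2 * (9 * G.trace * (3 * G.trace)))) (fun B hB => by
      rw [abs_mul, abs_mul, abs_mul, abs_of_nonneg (by positivity : 0 ≤ 1 / (m : ℝ) ^ 2)]
      gcongr
      · exact hh.abs_le B hB
      · exact M.row.abs_trace_mul_le_of_norm hB.norm_mul_self_le
      · exact hM3 B hB) i
  rw [← integral_const_mul, ← integral_sub i2 (i1.const_mul _)]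
  have hsum : IntegrableOn (fun y => G.trace / (m : ℝ) ^ 2 *
      (6 * centeredTrace m G (gramErase γ G i y)⁻¹ ^ 2 +
        (2 * (((gramErase γ G i y)⁻¹ * G).trace - G.trace) ^ 2 +
        2 * (G * G * ((gramErase γ G i y)⁻¹ - 1)).trace ^ 2))) (Ei i) (π) :=
    ((j1.const_mul 6).add_fun ((j2.const_mul 2).add_fun (j3.const_mul 2))).const_mul _
  refine (abs_integral_le_integral_abs.trans (setIntegral_mono_on
    (i2.sub (i1.const_mul _)).abs hsum (M.loo.measurableSet_erase i) fun y hy => ?_)).trans ?_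
  · have hB := M.loo.isResolvent_gramErase hy
    simp only [Pi.sub_apply]
    set B := (gramErase γ G i y)⁻¹
    have q1 := hM3 B hB
    have q2 := M.secondMomentCoeff_le
    have q3 := M.secondMomentCoeff_nonneg
    have q4 : 0 ≤ m * secondMomentCoeff m G := by positivity
    have e : centeredTrace m G B * (1 / (m : ℝ) ^ 2 * ((B * B * G).trace * (G * B * G).trace)) -
        secondMomentCoeff m G * (G * G).trace / m * centeredTrace m G B =
        1 / (m : ℝ) ^ 2 * (centeredTrace m G B *
          (centeredTrace m G B + ((B * G).trace - G.trace)) * (G * B * G).trace +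
          m * secondMomentCoeff m G *
            (centeredTrace m G B * (G * G * (B - 1)).trace)) := by
      rw [M.trace_mul_self_mul, trace_sandwich]
      field_simp
      ring
    rw [e, abs_mul, abs_of_nonneg (by positivity : 0 ≤ 1 / (m : ℝ) ^ 2), div_mul_eq_mul_div,
      div_mul_eq_mul_div, one_mul]
    refine div_le_div_of_nonneg_right ?_ (by positivity)
    generalize centeredTrace m G B = h at *
    generalize (B * G).trace - G.trace = f at *
    generalize (G * G * (B - 1)).trace = f2 at *
    generalize (G * B * G).trace = g at *
    generalize m * secondMomentCoeff m G = κ at *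
    refine (abs_add_le _ _).trans ?_
    rw [abs_mul _ g, abs_mul κ, abs_of_nonneg q4]
    have p1 : |h * (h + f)| ≤ 3 / 2 * h ^ 2 + 1 / 2 * f ^ 2 := by
      rw [abs_le]; constructor <;> nlinarith [sq_nonneg (h + f), sq_nonneg (h - f), sq_nonneg f, sq_nonneg h]
    have p2 : |h * f2| ≤ 1 / 2 * h ^ 2 + 1 / 2 * f2 ^ 2 := by
      rw [abs_le]; constructor <;> nlinarith [sq_nonneg (h + f2), sq_nonneg (h - f2)]
    have p3 : |h * (h + f)| * |g| ≤ (3 / 2 * h ^ 2 + 1 / 2 * f ^ 2) * (3 * G.trace) :=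
      mul_le_mul p1 q1 (abs_nonneg _) (by positivity)
    have p4 : κ * |h * f2| ≤ 2 * G.trace * (1 / 2 * h ^ 2 + 1 / 2 * f2 ^ 2) :=
      mul_le_mul q2 p2 (abs_nonneg _) (by positivity)
    nlinarith [mul_nonneg hk.le (sq_nonneg h), mul_nonneg hk.le (sq_nonneg f),
      mul_nonneg hk.le (sq_nonneg f2)]
  · rw [integral_const_mul, integral_add (j1.const_mul 6)
      ((j2.const_mul 2).add_fun (j3.const_mul 2)), integral_add (j2.const_mul 2) (j3.const_mul 2),
      integral_const_mul, integral_const_mul, integral_const_mul]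
    have := hs i
    refine mul_le_mul_of_nonneg_left ?_ (by positivity)
    linarith

/-- The centering is chosen so that the linear terms cancel: weighting by `h = centeredTrace` gives
`∫h² + c₂∫h` with `c₂ = c tr(G²)`, and the surviving sum is again `c₂∫h` up to small errors. The
rest is absorbed as for the linear statistic. -/
theorem setIntegral_centeredTrace_sq_le (M : SketchModel μ G a γ δ E Ei) :
    ∫ y in E, centeredTrace m G (sketchGram γ G y)⁻¹ ^ 2 ∂π ≤ 10 ^ 12 * (a * G.trace) := by
  have := M.row.isProb
  have hh := M.stableStatistic_centeredTrace
  have hk := M.trace_pos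
  have hm := M.one_le
  have hm0 : (m : ℝ) ≠ 0 := by linarith
  have hX : 0 ≤ a * G.trace := hk.le.trans M.trace_le
  set V := ∫ y in E, centeredTrace m G (sketchGram γ G y)⁻¹ ^ 2 ∂π with hV
  have hV0 : 0 ≤ V := integral_nonneg fun _ => sq_nonneg _
  have hs := M.setIntegral_erase_sq_le_of_le (by norm_num) hh hV.ge
  set s := √(2 * V + 200000 * (a * G.trace)) with hsdef
  have hs2 : s ^ 2 = 2 * V + 200000 * (a * G.trace) := Real.sq_sqrt (by positivity)
  rw [← hs2] at hs
  have hW := M.row.testBound_of_norm_le_one M.row.norm_le_one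
  have h := (M.abs_setIntegral_mul_trace_sq_sub_le hW M.normBound_pos hh (Real.sqrt_nonneg _)
    (Real.sqrt_nonneg _) hs M.setIntegral_erase_trace_sq_le).trans (M.remainder_le le_rfl)
  rw [← hsdef, hs2, Real.sq_sqrt (by positivity)] at h
  set c₂ := secondMomentCoeff m G * (G * G).trace with hc₂
  set I := ∫ y in E, centeredTrace m G (sketchGram γ G y)⁻¹ ∂π with hI
  have : Nonempty (Fin m) := Fin.pos_iff_nonempty.1 (Nat.pos_of_ne_zero (by exact_mod_cast hm0))
  have i0 := M.loo.integrableOn hh.measurable hh.abs_le (Classical.arbitrary _)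
  have i1 := M.loo.integrableOn (hh.measurable.pow_const 2) (φ := (13 * G.trace) ^ 2)
    (fun B hB => by
      rw [abs_pow]; exact pow_le_pow_left₀ (abs_nonneg _) (hh.abs_le B hB) 2) (Classical.arbitrary _)
  have e : ∫ y in E, centeredTrace m G (sketchGram γ G y)⁻¹ * (G * ((sketchGram γ G y)⁻¹ *
      (sketchGram γ G y)⁻¹ - (sketchGram γ G y)⁻¹)).trace ∂π = V + c₂ * I := by
    rw [hV, hI, ← integral_const_mul, ← integral_add i1 (i0.const_mul _)]
    refine integral_congr_ae (ae_of_all _ fun y => ?_)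
    simp only [centeredTrace]
    ring
  rw [e] at h
  have hsum := Finset.abs_sum_le_sum_abs (s := Finset.univ) (fun i : Fin m =>
    (∫ y in Ei i, centeredTrace m G (gramErase γ G i y)⁻¹ * (1 / (m : ℝ) ^ 2 *
        (((gramErase γ G i y)⁻¹ * (gramErase γ G i y)⁻¹ * G).trace *
          (G * (gramErase γ G i y)⁻¹ * G).trace)) ∂π) - c₂ / m * I)
  rw [Finset.sum_sub_distrib, Finset.sum_const, Finset.card_univ, Fintype.card_fin,
    nsmul_eq_mul] at hsum
  have hc0 := M.secondMomentCoeff_mul_trace_nonneg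
  have hc1 := M.secondMomentCoeff_mul_trace_le
  have hterm : ∀ i : Fin m, |(∫ y in Ei i, centeredTrace m G (gramErase γ G i y)⁻¹ *
      (1 / (m : ℝ) ^ 2 * (((gramErase γ G i y)⁻¹ * (gramErase γ G i y)⁻¹ * G).trace *
          (G * (gramErase γ G i y)⁻¹ * G).trace)) ∂π) - c₂ / m * I| ≤
      G.trace / (m : ℝ) ^ 2 * (6 * s ^ 2 + 12 * 10 ^ 12 * (a * G.trace)) +
        c₂ / m * (200 / m * normBound G a + 13 * G.trace * δ) := fun i => by
    refine (abs_sub_le _ (c₂ / m *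
      ∫ y in Ei i, centeredTrace m G (gramErase γ G i y)⁻¹ ∂π) _).trans
      (add_le_add (M.abs_setIntegral_centeredTrace_mul_sub_le hs i) ?_)
    rw [← mul_sub, abs_mul, abs_of_nonneg (by positivity)]
    exact mul_le_mul_of_nonneg_left (M.loo.abs_setIntegral_erase_sub_le M.row hh i) (by positivity)
  have hsum2 := hsum.trans (Finset.sum_le_sum fun i _ => hterm i)
  rw [Finset.sum_const, Finset.card_univ, Fintype.card_fin, nsmul_eq_mul] at hsum2
  have e1 : (m : ℝ) * (c₂ / m * I) = c₂ * I := by field_simp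
  have e2 : (m : ℝ) * (G.trace / (m : ℝ) ^ 2 * (6 * s ^ 2 + 12 * 10 ^ 12 * (a * G.trace)) +
      c₂ / m * (200 / m * normBound G a + 13 * G.trace * δ)) =
      G.trace / m * (6 * s ^ 2 + 12 * 10 ^ 12 * (a * G.trace)) +
      c₂ * (200 * (normBound G a / m)) + c₂ * (13 * G.trace * δ) := by field_simp; ring
  rw [e1, e2, hs2] at hsum2
  -- This makes the quadratic remainder, a multiple of `V`, absorbable.
  have r1 : G.trace / m ≤ 1 / 10 ^ 13 := by
    rw [div_le_iff₀ (by linarith)]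
    linarith [M.trace_le_smul]
  have r2 := mul_le_mul_of_nonneg_right r1
    (by positivity : 0 ≤ 6 * (2 * V + 200000 * (a * G.trace)) + 12 * 10 ^ 12 * (a * G.trace))
  have r3 : c₂ * (200 * (normBound G a / m)) ≤ G.trace * (200 * (1 / (2 * 10 ^ 6))) :=
    mul_le_mul hc1 (by linarith [M.normBound_div_le]) (by have := M.normBound_pos; positivity) hk.le
  have hδ := M.delta_nonneg
  have r4 : c₂ * (13 * G.trace * δ) ≤ G.trace * (13 * G.trace * δ) :=
    mul_le_mul_of_nonneg_right hc1 (by positivity)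
  have r5 := M.trace_sq_mul_delta_le
  have r6 := M.trace_le
  have h' := (le_abs_self _).trans h
  have hsum3 := (le_abs_self _).trans hsum2
  nlinarith

theorem setIntegral_erase_centeredTrace_sq_le (M : SketchModel μ G a γ δ E Ei) (i : Fin m) :
    ∫ y in Ei i, centeredTrace m G (gramErase γ G i y)⁻¹ ^ 2 ∂π ≤
      (√(3 * 10 ^ 12 * (a * G.trace))) ^ 2 := by
  have hX : 0 ≤ a * G.trace := M.trace_pos.le.trans M.trace_le
  have := M.setIntegral_erase_sq_le_of_le (by norm_num) M.stableStatistic_centeredTrace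
    M.setIntegral_centeredTrace_sq_le i
  rw [Real.sq_sqrt (by positivity)]
  linarith

end SketchModel

end SecondMoment

/-! ### Bias of the first and second inverse moments as bilinear forms -/

section BilinearForms

variable {m d : ℕ} {μ : Measure (Fin d → ℝ)} {G B : Matrix (Fin d) (Fin d) ℝ}
  {a γ δ : ℝ} {E : Set (Fin m → Fin d → ℝ)} {Ei : Fin m → Set (Fin m → Fin d → ℝ)}
  {u v : Fin d → ℝ}

local notation "π" => Measure.pi fun _ : Fin m => μ

theorem trace_vecMulVec_mul (B : Matrix (Fin d) (Fin d) ℝ) (u v : Fin d → ℝ) :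
    (vecMulVec v u * B).trace = u ⬝ᵥ B *ᵥ v := by
  rw [Matrix.vecMulVec_mul, Matrix.trace_vecMulVec, dotProduct_comm, Matrix.dotProduct_mulVec]

theorem norm_vecMulVec_le_one (hu : u ⬝ᵥ u ≤ 1) (hv : v ⬝ᵥ v ≤ 1) : ‖vecMulVec v u‖ ≤ 1 := by
  refine l2_opNorm_le_of_bilin zero_le_one fun x y hx hy => ?_
  rw [Matrix.vecMulVec_mulVec, op_smul_eq_smul, dotProduct_smul, smul_eq_mul, abs_mul]
  refine mul_le_one₀ ?_ (abs_nonneg _) ?_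
  · exact (abs_dotProduct_le_norm _ _).trans
      (mul_le_one₀ (norm_toLp_le_one hu) (norm_nonneg _) (norm_toLp_le_one hy))
  · exact (abs_dotProduct_le_norm _ _).trans
      (mul_le_one₀ (norm_toLp_le_one hx) (norm_nonneg _) (norm_toLp_le_one hv))

theorem abs_dotProduct_mulVec_le_norm (B : Matrix (Fin d) (Fin d) ℝ) (hu : u ⬝ᵥ u ≤ 1)
    (hv : v ⬝ᵥ v ≤ 1) : |u ⬝ᵥ B *ᵥ v| ≤ ‖B‖ := by
  refine (abs_dotProduct_mulVec_le B u v).trans (mul_le_of_le_one_right (norm_nonneg _) ?_)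
  exact mul_le_one₀ (norm_toLp_le_one hu) (norm_nonneg _) (norm_toLp_le_one hv)

namespace SketchModel

theorem bilin_bound_pos (M : SketchModel μ G a γ δ E Ei) : 0 < √(2 * a * min 1 G.trace) := by
  have := M.trace_pos
  have := M.row.one_le
  exact Real.sqrt_pos.2 (by positivity)

theorem bilin_bound_le (M : SketchModel μ G a γ δ E Ei) :
    √(2 * a * min 1 G.trace) ≤ 2 * (a * √G.trace) := by
  have hk := M.trace_pos
  have ha := M.row.one_le
  rw [Real.sqrt_le_left (by positivity), mul_pow, mul_pow, Real.sq_sqrt hk.le]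
  have : min 1 G.trace ≤ G.trace := min_le_right _ _
  have h1 : 2 * a * min 1 G.trace ≤ 2 * a * G.trace := by gcongr
  have h2 := mul_le_mul_of_nonneg_right ha (by positivity : 0 ≤ a * G.trace)
  nlinarith

/-- Uses `min 1 k ≤ 1`, while the estimate without the extra factor uses `min 1 k ≤ k`. Keeping the
minimum gives the rate `√k` for both small and large `k`. -/
theorem bilin_bound_mul_sqrt_le (M : SketchModel μ G a γ δ E Ei) :
    √(2 * a * min 1 G.trace) * √(a * G.trace) ≤ 2 * (a * √G.trace) := by
  have hk := M.trace_pos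
  have ha := M.row.one_le
  have h1 : √(2 * a * min 1 G.trace) ≤ √(2 * a) :=
    Real.sqrt_le_sqrt (mul_le_of_le_one_right (by positivity) (min_le_left _ _))
  refine (mul_le_mul_of_nonneg_right h1 (Real.sqrt_nonneg _)).trans ?_
  rw [← Real.sqrt_mul (by positivity), Real.sqrt_le_left (by positivity), mul_pow, mul_pow,
    Real.sq_sqrt hk.le]
  nlinarith [mul_pos (mul_pos hk (by linarith : 0 < a)) (by linarith : 0 < a)]

theorem sqrt_const_mul_le (M : SketchModel μ G a γ δ E Ei) :
    √(3 * 10 ^ 12 * (a * G.trace)) ≤ 2 * 10 ^ 6 * √(a * G.trace) := by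
  have hX : 0 ≤ a * G.trace := M.trace_pos.le.trans M.trace_le
  rw [Real.sqrt_le_left (by positivity), mul_pow, Real.sq_sqrt hX]
  linarith

theorem mul_delta_le (M : SketchModel μ G a γ δ E Ei) : m * δ ≤ 1 / m := by
  have h1 := M.delta_mul_le
  have h2 := M.one_le
  have h3 := mul_nonneg (by linarith : (0:ℝ) ≤ m) M.delta_nonneg
  nlinarith [mul_le_mul_of_nonneg_right h2 h3]

theorem prob_le_one (M : SketchModel μ G a γ δ E Ei) (i : Fin m) : (π).real (Ei i) ≤ 1 := by
  have := M.row.isProb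
  exact measureReal_le_one

/-- The remainder for bilinear test matrices and the constant statistic. -/
theorem bilin_remainder_le (M : SketchModel μ G a γ δ E Ei) :
    62700 * √(2 * a * min 1 G.trace) / m *
        (1 * (√(a * G.trace) + 1 + √(3 * 10 ^ 12 * (a * G.trace)))) +
      m * (|1| * √(2 * a * min 1 G.trace) * δ) +
      250 * 0 * normBound G a * √(2 * a * min 1 G.trace) / m ≤ 10 ^ 12 * (a * √G.trace / m) := by
  have h1 := M.bilin_bound_le
  have h2 := M.bilin_bound_mul_sqrt_le
  have h3 := M.bilin_bound_pos
  have h4 := M.sqrt_const_mul_le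
  have h5 := M.mul_delta_le
  have hm := M.one_le
  have hm0 : (m : ℝ) ≠ 0 := by linarith
  have hk := M.trace_pos
  have ha := M.row.one_le
  set ρ := √(2 * a * min 1 G.trace)
  set q := a * √G.trace with hq
  have hq0 : 0 ≤ q := by positivity
  have h6 : m * (|1| * ρ * δ) ≤ 2 * q * (1 / m) := by
    rw [abs_one, one_mul, ← mul_assoc, mul_comm (m:ℝ), mul_assoc]
    exact mul_le_mul h1 h5 (mul_nonneg (by linarith) M.delta_nonneg) (by positivity)
  have h7 : ρ * (√(a * G.trace) + 1 + √(3 * 10 ^ 12 * (a * G.trace))) ≤ 5 * 10 ^ 6 * q := by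
    have := mul_le_mul_of_nonneg_left h4 h3.le
    nlinarith
  have h8 := mul_le_mul_of_nonneg_left h7 (by positivity : (0:ℝ) ≤ 62700 / m)
  have e1 : 62700 * ρ / m * (1 * (√(a * G.trace) + 1 + √(3 * 10 ^ 12 * (a * G.trace)))) =
    62700 / m * (ρ * (√(a * G.trace) + 1 + √(3 * 10 ^ 12 * (a * G.trace)))) := by ring
  have e2 : 62700 / (m:ℝ) * (5 * 10 ^ 6 * q) = 62700 * 5 * 10 ^ 6 * (q / m) := by ring
  have e3 : 2 * q * (1 / m) = 2 * (q / m) := by ring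
  have h9 : 0 ≤ q / m := by positivity
  rw [e1]
  rw [e2] at h8
  rw [e3] at h6
  simp only [mul_zero, zero_mul, zero_div, add_zero]
  linarith

theorem setIntegral_one_sq_le (M : SketchModel μ G a γ δ E Ei) (i : Fin m) :
    ∫ _ in Ei i, (1:ℝ) ^ 2 ∂π ≤ 1 ^ 2 := by
  simpa using M.prob_le_one i

/-- Bound on the bias of the first inverse moment. -/
theorem abs_setIntegral_bilin_le (M : SketchModel μ G a γ δ E Ei) (hu : u ⬝ᵥ u ≤ 1)
    (hv : v ⬝ᵥ v ≤ 1) :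
    |∫ y in E, u ⬝ᵥ ((sketchGram γ G y)⁻¹ - 1) *ᵥ v ∂π| ≤ 10 ^ 12 * (a * √G.trace / m) := by
  -- Constant weight `1`, with the zero stability constant in the shape `D / m` and `D = 0`.
  have hψ : StableStatistic γ |1| (0 / m) (fun _ : Matrix (Fin d) (Fin d) ℝ => (1:ℝ)) := by
    simpa only [zero_div] using stableStatistic_const γ 1
  have h := (M.abs_setIntegral_mul_trace_le (M.row.testBound_vecMulVec hu hv) M.bilin_bound_pos hψ
    zero_le_one (Real.sqrt_nonneg _) M.setIntegral_one_sq_le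
    M.setIntegral_erase_trace_sq_le).trans M.bilin_remainder_le
  simpa only [one_mul, trace_vecMulVec_mul] using h

theorem abs_setIntegral_bilin_sq_sub_sum_le (M : SketchModel μ G a γ δ E Ei) (hu : u ⬝ᵥ u ≤ 1)
    (hv : v ⬝ᵥ v ≤ 1) :
    |∫ y in E, u ⬝ᵥ ((sketchGram γ G y)⁻¹ * (sketchGram γ G y)⁻¹ -
        (sketchGram γ G y)⁻¹) *ᵥ v ∂π -
      ∑ i, ∫ y in Ei i, 1 / (m : ℝ) ^ 2 *
        (((gramErase γ G i y)⁻¹ * (gramErase γ G i y)⁻¹ * G).trace *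
          (u ⬝ᵥ (gramErase γ G i y)⁻¹ *ᵥ (G *ᵥ v))) ∂π| ≤ 10 ^ 12 * (a * √G.trace / m) := by
  have hψ : StableStatistic γ |1| (0 / m) (fun _ : Matrix (Fin d) (Fin d) ℝ => (1:ℝ)) := by
    simpa only [zero_div] using stableStatistic_const γ 1
  have h := (M.abs_setIntegral_mul_trace_sq_sub_le (M.row.testBound_vecMulVec hu hv)
    M.bilin_bound_pos hψ zero_le_one (Real.sqrt_nonneg _) M.setIntegral_one_sq_le
    M.setIntegral_erase_trace_sq_le).trans M.bilin_remainder_le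
  simpa only [one_mul, trace_vecMulVec_mul, mul_assoc (vecMulVec v u), Matrix.mulVec_mulVec]
    using h

/-- The one-row comparison applied to the change of the bilinear form itself, with zero mean term
and constant weight. -/
theorem abs_setIntegral_bilin_sub_erase_le (M : SketchModel μ G a γ δ E Ei) (hu : u ⬝ᵥ u ≤ 1)
    (hv : v ⬝ᵥ v ≤ 1) (i : Fin m) :
    |∫ y in E, (u ⬝ᵥ (sketchGram γ G y)⁻¹ *ᵥ v - u ⬝ᵥ (gramErase γ G i y)⁻¹ *ᵥ v) ∂π| ≤
      10 ^ 12 * (a * √G.trace / m) := by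
  have := M.row.isProb
  have hm := M.one_le
  have hm0 : (m : ℝ) ≠ 0 := by linarith
  have hρ := M.bilin_bound_pos
  have hkm := M.two_mul_trace_le
  have h1 := M.bilin_bound_le
  set ρ := √(2 * a * min 1 G.trace)
  have hW := norm_vecMulVec_le_one hu hv
  have h := M.loo.abs_setIntegral_sub_le M.row i (A := 18 * ρ / m) (D := 0) (ρ := ρ) (φ := 1)
    (c := 18 / m) (cM := 0) (cβ := 18 * ρ / m)
    (T := fun B x => (vecMulVec v u * rankOneUpdate γ B x).trace - (vecMulVec v u * B).trace)
    (M := fun _ => 0) (β := fun _ => 18 * ρ / m) (ψ := fun _ => 1) (by positivity) le_rfl hρ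
    zero_le_one
    (fun B hB => hasMomentBounds_trace_rankOneUpdate_sub M.row hB hm hkm M.stepSize
      (M.row.testBound_vecMulVec hu hv) hρ.le)
    (by
      have e : Measurable fun B : Matrix (Fin d) (Fin d) ℝ => (vecMulVec v u * B).trace :=
        Continuous.measurable (by fun_prop)
      exact (e.comp (measurable_rankOneUpdate γ)).sub (e.comp measurable_fst))
    (fun B hB x => by
      refine (abs_trace_rankOneUpdate_sub_le M.row hB hm hkm M.stepSize hW x).trans ?_
      gcongr
      linarith)
    measurable_const (fun _ _ => by simp) (fun _ _ _ => by simp) measurable_const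
    (fun _ _ => by simp) measurable_const (fun _ _ => le_of_eq (abs_of_nonneg (by positivity)))
  simp only [mul_zero, integral_zero, sub_zero, abs_one, one_mul, zero_mul, add_zero,
    integral_const, smul_eq_mul, measureReal_restrict_apply_univ] at h
  have e : ∫ y in E, (u ⬝ᵥ (sketchGram γ G y)⁻¹ *ᵥ v - u ⬝ᵥ (gramErase γ G i y)⁻¹ *ᵥ v) ∂π =
      ∫ y in E, ((vecMulVec v u * rankOneUpdate γ (gramErase γ G i y)⁻¹ (y i)).trace -
        (vecMulVec v u * (gramErase γ G i y)⁻¹).trace) ∂π := by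
    refine setIntegral_congr_fun M.loo.measurableSet fun y hy => ?_
    simp only [← M.loo.inv_gram (M.loo.subset i hy), trace_vecMulVec_mul]
  rw [e]
  refine h.trans ?_
  set q := a * √G.trace
  have hq : 0 ≤ q := by linarith
  have p1 := M.prob_le_one i
  have e2 : 18 * ρ / m + (18 * ρ / m) ^ 2 / ρ = ρ * (18 / m + 324 / m * (1 / m)) := by
    field_simp; ring
  have hm1 : 1 / (m:ℝ) ≤ 1 := by rw [div_le_one (by linarith)]; exact hm
  have hp : 0 ≤ 1 / (m:ℝ) := by positivity
  have p2 : 18 / m + 324 / m * (1 / m) ≤ 342 * (1 / (m:ℝ)) := by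
    have := mul_le_mul_of_nonneg_left hm1 (by positivity : 0 ≤ 324 / (m:ℝ))
    have e3 : 342 * (1 / (m:ℝ)) = 18 / m + 324 / m * 1 := by ring
    linarith
  have p3 : δ ≤ 1 / m := by
    have := mul_le_mul_of_nonneg_right hm M.delta_nonneg
    linarith [M.mul_delta_le]
  have p4 : ρ * (18 / m + 324 / m * (1 / m)) ≤ 2 * q * (342 * (1 / m)) :=
    mul_le_mul h1 p2 (by positivity) (by positivity)
  have p5 : ρ * δ ≤ 2 * q * (1 / m) := mul_le_mul h1 p3 M.delta_nonneg (by positivity)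
  have p6 := mul_le_mul p1 p4 (by positivity) zero_le_one
  rw [e2]
  have e4 : q / m = q * (1 / m) := by ring
  rw [e4]
  nlinarith [mul_nonneg hq hp]

theorem integrableOn_erase_bilin (M : SketchModel μ G a γ δ E Ei) (hu : u ⬝ᵥ u ≤ 1)
    (hv : v ⬝ᵥ v ≤ 1) (i : Fin m) :
    IntegrableOn (fun y => u ⬝ᵥ (gramErase γ G i y)⁻¹ *ᵥ v) (Ei i) (π) := by
  have := M.row.isProb
  refine M.loo.integrableOn_erase (ψ := fun B => u ⬝ᵥ B *ᵥ v)
    (Continuous.measurable (by fun_prop)) (φ := 3)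
    (fun B hB => (abs_dotProduct_mulVec_le_norm B hu hv).trans hB.norm_le) i

theorem integrableOn_bilin (M : SketchModel μ G a γ δ E Ei) (hu : u ⬝ᵥ u ≤ 1)
    (hv : v ⬝ᵥ v ≤ 1) (i : Fin m) :
    IntegrableOn (fun y => u ⬝ᵥ (sketchGram γ G y)⁻¹ *ᵥ v) E (π) := by
  have := M.row.isProb
  refine M.loo.integrableOn (ψ := fun B => u ⬝ᵥ B *ᵥ v)
    (Continuous.measurable (by fun_prop)) (φ := 3)
    (fun B hB => (abs_dotProduct_mulVec_le_norm B hu hv).trans hB.norm_le) i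

/-- Passes through `Q`: the bias of `Q`, the comparison of `Q` with `B` on `E`, and `‖B‖ ≤ 3` on `Ei
i \ E`. -/
theorem abs_setIntegral_erase_bilin_sub_le (M : SketchModel μ G a γ δ E Ei) (hu : u ⬝ᵥ u ≤ 1)
    (hv : v ⬝ᵥ v ≤ 1) (i : Fin m) :
    |∫ y in Ei i, u ⬝ᵥ (gramErase γ G i y)⁻¹ *ᵥ v ∂π - (π).real E * (u ⬝ᵥ v)| ≤
      2 * 10 ^ 12 * (a * √G.trace / m) + 3 * δ := by
  have := M.row.isProb
  have h1 := M.abs_setIntegral_bilin_sub_erase_le hu hv i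
  have h2 := M.abs_setIntegral_bilin_le hu hv
  have i1 := M.integrableOn_erase_bilin hu hv i
  have i2 := M.integrableOn_bilin hu hv i
  have i3 := i1.mono_set (M.loo.subset i)
  have hd := setIntegral_sdiff M.loo.measurableSet i1 (M.loo.subset i)
  have h3 : |∫ y in Ei i \ E, u ⬝ᵥ (gramErase γ G i y)⁻¹ *ᵥ v ∂π| ≤ 3 * δ := by
    have := norm_setIntegral_le_of_norm_le_const (C := 3) (measure_lt_top (π) (Ei i \ E))
      (f := fun y => u ⬝ᵥ (gramErase γ G i y)⁻¹ *ᵥ v) fun y hy =>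
        (abs_dotProduct_mulVec_le_norm _ hu hv).trans
          (M.loo.isResolvent_gramErase hy.1).norm_le
    refine this.trans ?_
    exact mul_le_mul_of_nonneg_left (M.loo.prob_diff_le i) (by norm_num)
  have e2 : ∫ y in E, u ⬝ᵥ ((sketchGram γ G y)⁻¹ - 1) *ᵥ v ∂π =
      ∫ y in E, u ⬝ᵥ (sketchGram γ G y)⁻¹ *ᵥ v ∂π - (π).real E * (u ⬝ᵥ v) := by
    simp only [Matrix.sub_mulVec, Matrix.one_mulVec, dotProduct_sub]
    rw [integral_sub i2 (integrable_const _), setIntegral_const, smul_eq_mul]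
  rw [integral_sub i2 i3] at h1
  rw [e2] at h2
  rw [hd] at h3
  rw [abs_le] at *
  constructor <;> linarith

theorem integrableOn_erase_abs (M : SketchModel μ G a γ δ E Ei) {φ D : ℝ}
    {ψ : Matrix (Fin d) (Fin d) ℝ → ℝ} (hψ : StableStatistic γ φ D ψ) (i : Fin m) :
    IntegrableOn (fun y => |ψ (gramErase γ G i y)⁻¹|) (Ei i) (π) := by
  have := M.row.isProb
  exact (M.loo.integrableOn_erase hψ.measurable hψ.abs_le i).abs

theorem setIntegral_erase_abs_le (M : SketchModel μ G a γ δ E Ei) {φ D : ℝ}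
    {ψ : Matrix (Fin d) (Fin d) ℝ → ℝ} (hψ : StableStatistic γ φ D ψ) (i : Fin m)
    (h : ∫ y in Ei i, ψ (gramErase γ G i y)⁻¹ ^ 2 ∂π ≤ (√(3 * 10 ^ 12 * (a * G.trace))) ^ 2) :
    ∫ y in Ei i, |ψ (gramErase γ G i y)⁻¹| ∂π ≤ 2 * 10 ^ 6 * (a * √G.trace) := by
  have := M.row.isProb
  have h1 := setIntegral_mul_le (M.loo.measurableSet_erase i)
    (hψ.measurable.comp (measurable_gramErase_inv γ G i)) (measurable_const (a := (0:ℝ)))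
    (fun y hy => hψ.abs_le _ (M.loo.isResolvent_gramErase hy)) (c := 0) (by simp)
    (Real.sqrt_nonneg _) le_rfl zero_le_one h (s := 0) (by simp)
  simp only [abs_zero, add_zero, mul_one, Function.comp_def] at h1
  refine h1.trans (M.sqrt_const_mul_le.trans ?_)
  have ha := M.row.one_le
  have hk := M.trace_pos
  refine mul_le_mul_of_nonneg_left ?_ (by norm_num)
  rw [Real.sqrt_le_left (by positivity), mul_pow, Real.sq_sqrt hk.le]
  nlinarith [mul_le_mul_of_nonneg_right ha (by positivity : 0 ≤ a * G.trace)]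

/-- `tr(B²G)` is replaced by `mc` at the cost of two `L¹` fluctuations; then the first moment bias
turns `uᵀBGv` into `uᵀGv`. -/
theorem abs_setIntegral_erase_mul_bilin_sub_le (M : SketchModel μ G a γ δ E Ei) (hu : u ⬝ᵥ u ≤ 1)
    (hv : v ⬝ᵥ v ≤ 1) (i : Fin m) :
    |∫ y in Ei i, 1 / (m : ℝ) ^ 2 *
        (((gramErase γ G i y)⁻¹ * (gramErase γ G i y)⁻¹ * G).trace *
          (u ⬝ᵥ (gramErase γ G i y)⁻¹ *ᵥ (G *ᵥ v))) ∂π -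
      secondMomentCoeff m G / m * ((π).real E * (u ⬝ᵥ G *ᵥ v))| ≤
    1 / m * (10 ^ 9 * (a * √G.trace / m)) := by
  have := M.row.isProb
  have hm := M.one_le
  have hm0 : (m : ℝ) ≠ 0 := by linarith
  have hk := M.trace_pos
  have ha := M.row.one_le
  have hw := mulVec_dotProduct_self_le M.row.norm_le_one hv
  have hh := M.stableStatistic_centeredTrace
  have hf := M.stableStatistic_trace_sub
  have j1 := M.integrableOn_erase_abs hh i
  have j2 := M.integrableOn_erase_abs hf i
  have b1 := M.setIntegral_erase_abs_le hh i (M.setIntegral_erase_centeredTrace_sq_le i)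
  have b2 := M.setIntegral_erase_abs_le hf i (M.setIntegral_erase_trace_sq_le i)
  have i1 := M.integrableOn_erase_bilin hu hw i
  have h1 := M.abs_setIntegral_erase_bilin_sub_le hu hw i
  have hc := M.secondMomentCoeff_nonneg
  have hc2 := M.secondMomentCoeff_le
  set c := secondMomentCoeff m G
  have i2 := M.loo.integrableOn_erase (i := i)
    (ψ := fun B => 1 / (m : ℝ) ^ 2 * ((B * B * G).trace * (u ⬝ᵥ B *ᵥ (G *ᵥ v))))
    (Continuous.measurable (by fun_prop)) (φ := 1 / (m : ℝ) ^ 2 * (9 * G.trace * 3))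
    (fun B hB => by
      rw [abs_mul, abs_mul, abs_of_nonneg (by positivity : 0 ≤ 1 / (m : ℝ) ^ 2)]
      gcongr
      · exact M.row.abs_trace_mul_le_of_norm hB.norm_mul_self_le
      · exact (abs_dotProduct_mulVec_le_norm B hu hw).trans hB.norm_le)
  have hsum : IntegrableOn (fun y => 3 / (m : ℝ) ^ 2 * (|centeredTrace m G (gramErase γ G i y)⁻¹| +
      |((gramErase γ G i y)⁻¹ * G).trace - G.trace|)) (Ei i) (π) := (j1.add_fun j2).const_mul _
  have h2 : |∫ y in Ei i, 1 / (m : ℝ) ^ 2 *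
        (((gramErase γ G i y)⁻¹ * (gramErase γ G i y)⁻¹ * G).trace *
          (u ⬝ᵥ (gramErase γ G i y)⁻¹ *ᵥ (G *ᵥ v))) ∂π -
      c / m * ∫ y in Ei i, u ⬝ᵥ (gramErase γ G i y)⁻¹ *ᵥ (G *ᵥ v) ∂π| ≤
      3 / (m : ℝ) ^ 2 * (2 * 10 ^ 6 * (a * √G.trace) + 2 * 10 ^ 6 * (a * √G.trace)) := by
    rw [← integral_const_mul, ← integral_sub i2 (i1.const_mul _)]
    refine (abs_integral_le_integral_abs.trans (setIntegral_mono_on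
      (i2.sub (i1.const_mul _)).abs hsum (M.loo.measurableSet_erase i) fun y hy => ?_)).trans ?_
    · have hB := M.loo.isResolvent_gramErase hy
      simp only [Pi.sub_apply]
      set B := (gramErase γ G i y)⁻¹
      have q := (abs_dotProduct_mulVec_le_norm B hu hw).trans hB.norm_le
      have e : 1 / (m : ℝ) ^ 2 * ((B * B * G).trace * (u ⬝ᵥ B *ᵥ (G *ᵥ v))) -
          c / m * (u ⬝ᵥ B *ᵥ (G *ᵥ v)) =
          1 / (m : ℝ) ^ 2 * ((u ⬝ᵥ B *ᵥ (G *ᵥ v)) *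
            (centeredTrace m G B + ((B * G).trace - G.trace))) := by
        rw [M.trace_mul_self_mul]
        field_simp
        ring
      rw [e, abs_mul, abs_mul, abs_of_nonneg (by positivity : 0 ≤ 1 / (m : ℝ) ^ 2)]
      calc _ ≤ 1 / (m : ℝ) ^ 2 * (3 * (|centeredTrace m G B| + |(B * G).trace - G.trace|)) := by
            gcongr
            exact abs_add_le _ _
        _ = _ := by ring
    · rw [integral_const_mul, integral_add j1 j2]
      gcongr
  have h3 : |c / m * ∫ y in Ei i, u ⬝ᵥ (gramErase γ G i y)⁻¹ *ᵥ (G *ᵥ v) ∂π -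
      c / m * ((π).real E * (u ⬝ᵥ G *ᵥ v))| ≤
      c / m * (2 * 10 ^ 12 * (a * √G.trace / m) + 3 * δ) := by
    rw [← mul_sub, abs_mul, abs_of_nonneg (by positivity)]
    exact mul_le_mul_of_nonneg_left h1 (by positivity)
  refine (abs_sub_le _ _ _).trans ((add_le_add h2 h3).trans ?_)
  have r1 : c ≤ 2 / 10 ^ 13 := by
    have := M.trace_le_smul
    by_contra hlt
    push Not at hlt
    nlinarith
  have hq0 : 0 ≤ a * √G.trace / m := by positivity
  -- `mc ≤ 2 tr G` has one factor `√(tr G)` too many; `√(tr G) ≤ m` and `mδ ≤ 1` remove it.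
  have r2 : c * δ ≤ 2 * (a * √G.trace / m) := by
    have s1 : √G.trace ≤ m := by
      rw [Real.sqrt_le_left (by linarith)]
      have := M.trace_le_smul
      nlinarith
    have s2 : m * (c * δ) ≤ 2 * √G.trace := by
      have t1 : m * c * δ ≤ 2 * G.trace * δ := mul_le_mul_of_nonneg_right hc2 M.delta_nonneg
      have t2 : m * δ ≤ 1 := M.mul_delta_le.trans ((div_le_one (by linarith)).2 hm)
      have t3 : √G.trace * δ ≤ 1 := (mul_le_mul_of_nonneg_right s1 M.delta_nonneg).trans t2
      have t4 := mul_le_mul_of_nonneg_left t3 (Real.sqrt_nonneg G.trace)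
      have t5 := Real.mul_self_sqrt hk.le
      nlinarith
    have s3 : √G.trace ≤ a * √G.trace := le_mul_of_one_le_left (Real.sqrt_nonneg _) ha
    rw [← mul_div_assoc, le_div_iff₀ (by linarith)]
    linarith
  have r3 := mul_le_mul_of_nonneg_right r1 hq0
  have e1 : 3 / (m : ℝ) ^ 2 * (2 * 10 ^ 6 * (a * √G.trace) + 2 * 10 ^ 6 * (a * √G.trace)) +
      c / m * (2 * 10 ^ 12 * (a * √G.trace / m) + 3 * δ) =
      1 / m * (12 * 10 ^ 6 * (a * √G.trace / m) + (2 * 10 ^ 12 * (c * (a * √G.trace / m)) +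
        3 * (c * δ))) := by field_simp; ring
  rw [e1]
  refine mul_le_mul_of_nonneg_left ?_ (by positivity)
  linarith

/-- Bound on the bias of the second inverse moment. -/
theorem abs_setIntegral_bilin_sq_sub_le (M : SketchModel μ G a γ δ E Ei) (hu : u ⬝ᵥ u ≤ 1)
    (hv : v ⬝ᵥ v ≤ 1) :
    |∫ y in E, u ⬝ᵥ ((sketchGram γ G y)⁻¹ * (sketchGram γ G y)⁻¹ -
        (1 + secondMomentCoeff m G • G)) *ᵥ v ∂π| ≤ 3 * 10 ^ 12 * (a * √G.trace / m) := by
  have := M.row.isProb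
  have hm := M.one_le
  have hm0 : (m : ℝ) ≠ 0 := by linarith
  have : Nonempty (Fin m) := Fin.pos_iff_nonempty.1 (Nat.pos_of_ne_zero (by exact_mod_cast hm0))
  have h1 := M.abs_setIntegral_bilin_le hu hv
  have h2 := M.abs_setIntegral_bilin_sq_sub_sum_le hu hv
  have hsum := (Finset.abs_sum_le_sum_abs (s := Finset.univ) (fun i : Fin m =>
    (∫ y in Ei i, 1 / (m : ℝ) ^ 2 * (((gramErase γ G i y)⁻¹ * (gramErase γ G i y)⁻¹ * G).trace *
          (u ⬝ᵥ (gramErase γ G i y)⁻¹ *ᵥ (G *ᵥ v))) ∂π) -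
    secondMomentCoeff m G / m * ((π).real E * (u ⬝ᵥ G *ᵥ v)))).trans
    (Finset.sum_le_sum fun i _ => M.abs_setIntegral_erase_mul_bilin_sub_le hu hv i)
  rw [Finset.sum_sub_distrib, Finset.sum_const, Finset.sum_const, Finset.card_univ,
    Fintype.card_fin, nsmul_eq_mul, nsmul_eq_mul] at hsum
  have e1 : (m : ℝ) * (secondMomentCoeff m G / m * ((π).real E * (u ⬝ᵥ G *ᵥ v))) =
    secondMomentCoeff m G * ((π).real E * (u ⬝ᵥ G *ᵥ v)) := by field_simp
  have e2 : (m : ℝ) * (1 / m * (10 ^ 9 * (a * √G.trace / m))) = 10 ^ 9 * (a * √G.trace / m) := by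
    field_simp
  rw [e1, e2] at hsum
  have j1 := M.loo.integrableOn (ψ := fun B => u ⬝ᵥ (B * B - B) *ᵥ v)
    (Continuous.measurable (by fun_prop)) (φ := 12)
    (fun B hB => (abs_dotProduct_mulVec_le_norm _ hu hv).trans ((norm_sub_le _ _).trans
      ((add_le_add hB.norm_mul_self_le hB.norm_le).trans (by norm_num)))) (Classical.arbitrary _)
  have j2 := M.loo.integrableOn (ψ := fun B => u ⬝ᵥ (B - 1) *ᵥ v)
    (Continuous.measurable (by fun_prop)) (φ := 4)
    (fun B hB => (abs_dotProduct_mulVec_le_norm _ hu hv).trans hB.norm_sub_one_le)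
    (Classical.arbitrary _)
  -- `Q² - 1 - cG = (Q² - Q) + (Q - 1) - cG`.
  have e : ∫ y in E, u ⬝ᵥ ((sketchGram γ G y)⁻¹ * (sketchGram γ G y)⁻¹ -
        (1 + secondMomentCoeff m G • G)) *ᵥ v ∂π =
      ∫ y in E, u ⬝ᵥ ((sketchGram γ G y)⁻¹ * (sketchGram γ G y)⁻¹ -
        (sketchGram γ G y)⁻¹) *ᵥ v ∂π + ∫ y in E, u ⬝ᵥ ((sketchGram γ G y)⁻¹ - 1) *ᵥ v ∂π -
        secondMomentCoeff m G * ((π).real E * (u ⬝ᵥ G *ᵥ v)) := by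
    have e3 : secondMomentCoeff m G * ((π).real E * (u ⬝ᵥ G *ᵥ v)) =
      ∫ _ in E, secondMomentCoeff m G * (u ⬝ᵥ G *ᵥ v) ∂π := by
      rw [setIntegral_const, smul_eq_mul]; ring
    rw [e3, ← integral_add j1 j2, ← integral_sub (j1.add_fun j2) (integrable_const _)]
    refine integral_congr_ae (ae_of_all _ fun y => ?_)
    simp only [Matrix.sub_mulVec, Matrix.add_mulVec, dotProduct_sub, dotProduct_add,
      Matrix.smul_mulVec, dotProduct_smul, smul_eq_mul]
    ring
  have hq0 : 0 ≤ a * √G.trace / m := by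
    have := M.row.one_le
    positivity
  rw [e]
  rw [abs_le] at *
  constructor <;> linarith

end SketchModel

end BilinearForms

/-! ### From the subspace embedding of one third to the leave-one-out events -/

section Thirds

variable {m l d : ℕ} {μ : Measure (Fin d → ℝ)} {G : Matrix (Fin d) (Fin d) ℝ} {a γ δ η : ℝ}

local notation "π" => Measure.pi fun _ : Fin m => μ

/-- The rescaled Gram matrix of a third of the rows. -/
noncomputable def thirdGram (γ : ℝ) (z : Fin l → Fin d → ℝ) : Matrix (Fin d) (Fin d) ℝ :=
  (3 * γ) • ∑ r, vecMulVec (z r) (z r)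

/-- The set of thirds that embed the subspace up to `η`. -/
def thirdSet (γ η : ℝ) (G : Matrix (Fin d) (Fin d) ℝ) : Set (Fin l → Fin d → ℝ) :=
  {z | ‖thirdGram γ z - G‖ ≤ η}

/-- The event that the `j`-th third of the rows embeds the subspace. -/
def thirdEvent (e : Fin 3 × Fin l ≃ Fin m) (γ η : ℝ) (G : Matrix (Fin d) (Fin d) ℝ) (j : Fin 3) :
    Set (Fin m → Fin d → ℝ) :=
  {y | (fun r => y (e (j, r))) ∈ thirdSet γ η G}

theorem dotProduct_smul_sum_mulVec {ι : Type*} (γ : ℝ) (s : Finset ι) (y : ι → Fin d → ℝ)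
    (x : Fin d → ℝ) :
    x ⬝ᵥ (γ • ∑ j ∈ s, vecMulVec (y j) (y j)) *ᵥ x = γ * ∑ j ∈ s, (y j ⬝ᵥ x) ^ 2 := by
  rw [Matrix.smul_mulVec, dotProduct_smul, smul_eq_mul, Matrix.sum_mulVec, dotProduct_sum]
  congr 1
  refine Finset.sum_congr rfl fun j _ => ?_
  rw [Matrix.vecMulVec_mulVec, op_smul_eq_smul, dotProduct_smul, smul_eq_mul,
    dotProduct_comm x (y j), sq]

theorem measurableSet_thirdSet (γ η : ℝ) (G : Matrix (Fin d) (Fin d) ℝ) :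
    MeasurableSet (thirdSet γ η G : Set (Fin l → Fin d → ℝ)) := by
  have : Continuous fun z : Fin l → Fin d → ℝ => ‖thirdGram γ z - G‖ := by
    unfold thirdGram
    fun_prop
  exact measurableSet_le this.measurable measurable_const

theorem measurable_reindex (f : Fin l → Fin m) :
    Measurable fun (y : Fin m → Fin d → ℝ) r => y (f r) :=
  measurable_pi_lambda _ fun r => measurable_pi_apply (f r)

theorem measurableSet_thirdEvent (e : Fin 3 × Fin l ≃ Fin m) (γ η : ℝ)
    (G : Matrix (Fin d) (Fin d) ℝ) (j : Fin 3) : MeasurableSet (thirdEvent e γ η G j) :=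
  measurable_reindex (fun r => e (j, r)) (measurableSet_thirdSet γ η G)

theorem map_reindex_pi [IsProbabilityMeasure μ] {f : Fin l → Fin m} (hf : f.Injective) :
    (π).map (fun y r => y (f r)) = Measure.pi fun _ : Fin l => μ := by
  have h1 : iIndepFun (fun (i : Fin m) (y : Fin m → Fin d → ℝ) => y i) (π) :=
    iIndepFun_pi (X := fun _ x => x) fun _ => aemeasurable_id
  have h2 := h1.precomp hf
  rw [iIndepFun_iff_map_fun_eq_pi_map fun i => (measurable_pi_apply _).aemeasurable] at h2
  rw [h2]
  congr 1
  funext i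
  exact (measurePreserving_eval (fun _ : Fin m => μ) (f i)).map_eq

/-- The rows are i.i.d., so the three thirds have the same law and a hypothesis on the first one
serves for all. -/
theorem measureReal_thirdEvent [IsProbabilityMeasure μ] (e : Fin 3 × Fin l ≃ Fin m) (γ η : ℝ)
    (G : Matrix (Fin d) (Fin d) ℝ) (j : Fin 3) :
    (π).real (thirdEvent e γ η G j) = (Measure.pi fun _ : Fin l => μ).real (thirdSet γ η G) := by
  rw [← map_reindex_pi (μ := μ) (f := fun r => e (j, r))
    (fun r r' h => (Prod.ext_iff.1 (e.injective h)).2),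
    map_measureReal_apply (measurable_reindex _) (measurableSet_thirdSet γ η G)]
  rfl

theorem sum_eq_sum_thirds (e : Fin 3 × Fin l ≃ Fin m) {A : Type*} [AddCommMonoid A]
    (f : Fin m → A) : ∑ i, f i = ∑ j, ∑ r, f (e (j, r)) := by
  rw [← e.sum_comp, Fintype.sum_prod_type]

theorem sub_le_thirdGram {z : Fin l → Fin d → ℝ} (hz : z ∈ thirdSet γ η G) (x : Fin d → ℝ) :
    x ⬝ᵥ G *ᵥ x - η * (x ⬝ᵥ x) ≤ 3 * γ * ∑ r, (z r ⬝ᵥ x) ^ 2 := by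
  rw [← dotProduct_smul_sum_mulVec]
  have h := (abs_le.1 (abs_quadForm_le_of_norm hz x)).1
  rw [Matrix.sub_mulVec, dotProduct_sub] at h
  simp only [thirdGram] at h
  linarith

/-- The part `1 - G` carries no noise, so `M - 1` is the average of the three embedding errors. -/
theorem sketchGram_sub_one (e : Fin 3 × Fin l ≃ Fin m) (y : Fin m → Fin d → ℝ) :
    sketchGram γ G y - 1 =
      (1 / 3 : ℝ) • ∑ j, (thirdGram γ (fun r => y (e (j, r))) - G) := by
  simp only [sketchGram, thirdGram, sum_eq_sum_thirds e, Finset.sum_sub_distrib, smul_sub,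
    ← Finset.smul_sum, smul_smul, Finset.sum_const, Finset.card_univ, Fintype.card_fin]
  rw [show (1 / 3 : ℝ) * (3 * γ) = γ by ring]
  rw [← Nat.cast_smul_eq_nsmul ℝ, smul_smul]
  norm_num
  abel

theorem norm_sketchGram_sub_one_le {e : Fin 3 × Fin l ≃ Fin m} {y : Fin m → Fin d → ℝ}
    (hy : ∀ j, y ∈ thirdEvent e γ η G j) : ‖sketchGram γ G y - 1‖ ≤ η := by
  rw [sketchGram_sub_one e, norm_smul, Real.norm_of_nonneg (by norm_num)]
  have h := (norm_sum_le Finset.univ fun j => thirdGram γ (fun r => y (e (j, r))) - G).trans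
    (Finset.sum_le_sum fun j _ => hy j)
  simp only [Finset.sum_const, Finset.card_univ, Fintype.card_fin, nsmul_eq_mul] at h
  push_cast at h
  linarith

theorem sum_thirds_le_sum_erase (e : Fin 3 × Fin l ≃ Fin m) {f : Fin m → ℝ} (hf : ∀ i, 0 ≤ f i)
    (i : Fin m) : ∑ j ∈ Finset.univ.erase (e.symm i).1, ∑ r, f (e (j, r)) ≤
      ∑ j ∈ Finset.univ.erase i, f j := by
  have h1 := Finset.sum_erase_add Finset.univ f (Finset.mem_univ i)
  rw [sum_eq_sum_thirds e, ← Finset.sum_erase_add Finset.univ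
    (fun j => ∑ r, f (e (j, r))) (Finset.mem_univ (e.symm i).1)] at h1
  have h2 := Finset.single_le_sum (f := fun r => f (e ((e.symm i).1, r)))
    (fun _ _ => hf _) (Finset.mem_univ (e.symm i).2)
  simp only [Prod.mk.eta, Equiv.apply_symm_apply] at h2
  linarith

/-- Discarding the whole third that contains row `i` only lowers the matrix. The two others
contribute at least `(2/3)(G - η)`, and `(2/3)(G - 1/2) + (1 - G) = 2/3 - G/3 ≥ 1/3` since `G ≤ 1`.
-/
theorem le_gramErase_of_thirds (h : RowLaw μ G a) (e : Fin 3 × Fin l ≃ Fin m) (hγ : 0 ≤ γ)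
    (hη : η ≤ 1 / 2) {y : Fin m → Fin d → ℝ} (i : Fin m)
    (hy : ∀ j, j ≠ (e.symm i).1 → y ∈ thirdEvent e γ η G j) (x : Fin d → ℝ) :
    (1 / 3) * (x ⬝ᵥ x) ≤ x ⬝ᵥ gramErase γ G i y *ᵥ x := by
  rw [gramErase, Matrix.add_mulVec, dotProduct_add, dotProduct_smul_sum_mulVec,
    Matrix.sub_mulVec, dotProduct_sub, Matrix.one_mulVec]
  have h3 : ∑ j ∈ Finset.univ.erase (e.symm i).1, (x ⬝ᵥ G *ᵥ x - η * (x ⬝ᵥ x)) ≤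
      ∑ j ∈ Finset.univ.erase (e.symm i).1, 3 * γ * ∑ r, (y (e (j, r)) ⬝ᵥ x) ^ 2 :=
    Finset.sum_le_sum fun j hj => sub_le_thirdGram (z := fun r => y (e (j, r)))
      (hy j (Finset.ne_of_mem_erase hj)) x
  rw [Finset.sum_const, Finset.card_erase_of_mem (Finset.mem_univ _), Finset.card_univ,
    Fintype.card_fin, ← Finset.mul_sum, nsmul_eq_mul] at h3
  have h5 := mul_le_mul_of_nonneg_left
    (sum_thirds_le_sum_erase e (f := fun r => (y r ⬝ᵥ x) ^ 2) (fun _ => sq_nonneg _) i) hγ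
  have h6 := h.le_one x
  have h7 := mul_le_mul_of_nonneg_right hη (dotProduct_self_nonneg' x)
  generalize ∑ j ∈ Finset.univ.erase (e.symm i).1, ∑ r, (y (e (j, r)) ⬝ᵥ x) ^ 2 = p at *
  generalize ∑ j ∈ Finset.univ.erase i, (y j ⬝ᵥ x) ^ 2 = q at *
  norm_num at h3
  linarith

/-- Subspace embedding for each third gives the leave-one-out events. -/
theorem leaveOneOut_of_thirds (h : RowLaw μ G a) (e : Fin 3 × Fin l ≃ Fin m) (hγ : 0 ≤ γ)
    (hη : η ≤ 1 / 2)
    (hp : 1 - δ / 3 ≤ (Measure.pi fun _ : Fin l => μ).real (thirdSet γ η G)) :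
    LeaveOneOut μ G γ δ (⋂ j, thirdEvent e γ η G j)
      (fun i => ⋂ j, ⋂ _ : j ≠ (e.symm i).1, thirdEvent e γ η G j) where
  stepSize_nonneg := hγ
  transpose_eq := h.posSemidef.transpose_eq
  measurableSet := MeasurableSet.iInter fun j => measurableSet_thirdEvent e γ η G j
  measurableSet_erase _ := MeasurableSet.iInter fun j => MeasurableSet.iInter fun _ =>
    measurableSet_thirdEvent e γ η G j
  subset _ := Set.iInter_mono fun _ => Set.subset_iInter fun _ => subset_rfl
  update_mem_iff i y t := by
    simp only [Set.mem_iInter]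
    refine forall_congr' fun j => forall_congr' fun hj => ?_
    have : ∀ r, Function.update y i t (e (j, r)) = y (e (j, r)) := fun r =>
      Function.update_of_ne (fun heq => hj (by simp [← heq])) _ _
    simp only [thirdEvent, Set.mem_ofPred_eq, this]
  le_gramErase i y hy x := le_gramErase_of_thirds h e hγ hη i (by simpa using hy) x
  prob_compl_le := by
    have := h.isProb
    rw [Set.compl_iInter]
    refine (measureReal_iUnion_fintype_le _).trans ?_
    have : ∀ j, (π).real (thirdEvent e γ η G j)ᶜ ≤ δ / 3 := fun j => by
      rw [probReal_compl_eq_one_sub (measurableSet_thirdEvent e γ η G j),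
        measureReal_thirdEvent]
      linarith
    refine (Finset.sum_le_sum fun j _ => this j).trans (le_of_eq ?_)
    simp
    ring

end Thirds

/-! ### Change of coordinates by the square root of the Hessian -/

section Normalization

variable {m n d : ℕ} {A : Matrix (Fin n) (Fin d) ℝ} {C : Matrix (Fin d) (Fin d) ℝ}

theorem posSemidef_transpose_mul_self (A : Matrix (Fin n) (Fin d) ℝ) : (Aᵀ * A).PosSemidef := by
  simpa using Matrix.posSemidef_conjTranspose_mul_self A

theorem posSemidef_hessian (A : Matrix (Fin n) (Fin d) ℝ) (hC : C.PosSemidef) :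
    (hessian A C).PosSemidef :=
  (posSemidef_transpose_mul_self A).add hC

theorem sqrt_hessian_mul_self (A : Matrix (Fin n) (Fin d) ℝ) (hC : C.PosSemidef) :
    CFC.sqrt (hessian A C) * CFC.sqrt (hessian A C) = hessian A C :=
  CFC.sqrt_mul_sqrt_self _ (Matrix.nonneg_iff_posSemidef.2 (posSemidef_hessian A hC))

theorem transpose_sqrt_hessian : (CFC.sqrt (hessian A C))ᵀ = CFC.sqrt (hessian A C) :=
  (Matrix.nonneg_iff_posSemidef.1 (CFC.sqrt_nonneg _)).transpose_eq

theorem isUnit_sqrt_hessian (hC : C.PosSemidef) (hH : IsUnit (hessian A C)) :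
    IsUnit (CFC.sqrt (hessian A C)) :=
  (CFC.isUnit_sqrt_iff _ (Matrix.nonneg_iff_posSemidef.2 (posSemidef_hessian A hC))).2 hH

theorem transpose_normalized : (normalized A C)ᵀ = (CFC.sqrt (hessian A C))⁻¹ * Aᵀ := by
  rw [normalized, Matrix.transpose_mul, Matrix.transpose_nonsing_inv, transpose_sqrt_hessian]

/-- Conjugating `H = AᵀA + C` by `H^{-1/2}` gives `1`. Thus `1 - UᵀU` is exactly the contribution of
`C`, and it is positive semidefinite. -/
theorem one_sub_gram (hC : C.PosSemidef) (hH : IsUnit (hessian A C)) :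
    1 - (normalized A C)ᵀ * normalized A C =
      (CFC.sqrt (hessian A C))⁻¹ * C * (CFC.sqrt (hessian A C))⁻¹ := by
  have hR := (Matrix.isUnit_iff_isUnit_det _).1 (isUnit_sqrt_hessian hC hH)
  have hRR := sqrt_hessian_mul_self A hC
  rw [transpose_normalized, normalized]
  set R := CFC.sqrt (hessian A C)
  have h1 : R⁻¹ * hessian A C * R⁻¹ = 1 := by
    rw [← hRR, ← Matrix.mul_assoc, Matrix.nonsing_inv_mul _ hR, one_mul, Matrix.mul_nonsing_inv _ hR]
  rw [hessian, mul_add, add_mul] at h1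
  rw [← h1]
  simp only [Matrix.mul_assoc, add_sub_cancel_left]

theorem gram_le_one (hC : C.PosSemidef) (hH : IsUnit (hessian A C)) (x : Fin d → ℝ) :
    x ⬝ᵥ ((normalized A C)ᵀ * normalized A C) *ᵥ x ≤ x ⬝ᵥ x := by
  have h := hC.conjTranspose_mul_mul_same (CFC.sqrt (hessian A C))⁻¹
  rw [Matrix.conjTranspose_eq_transpose_of_trivial, Matrix.transpose_nonsing_inv,
    transpose_sqrt_hessian, ← one_sub_gram hC hH] at h
  have := h.dotProduct_nonneg x
  rw [Matrix.sub_mulVec, dotProduct_sub, Matrix.one_mulVec] at this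
  linarith

/-- The rows of the sketched matrix in normalized coordinates, rescaled by `c`. -/
def normalizedRows (c : ℝ) (U : Matrix (Fin n) (Fin d) ℝ) (S : Fin m → Fin n → ℝ) :
    Fin m → Fin d → ℝ :=
  fun r => c • Uᵀ *ᵥ S r

theorem transpose_mul_self_eq_sum (T : Matrix (Fin m) (Fin d) ℝ) :
    Tᵀ * T = ∑ r, vecMulVec (T r) (T r) := by
  ext i j
  simp [Matrix.mul_apply, Matrix.sum_apply, Matrix.vecMulVec_apply]

theorem sum_normalizedRows (c : ℝ) (U : Matrix (Fin n) (Fin d) ℝ) (S : Matrix (Fin m) (Fin n) ℝ) :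
    ∑ r, vecMulVec (normalizedRows c U S r) (normalizedRows c U S r) =
      c ^ 2 • (Uᵀ * Sᵀ * S * U) := by
  have h := transpose_mul_self_eq_sum (S * U)
  have e : ∀ r, (S * U) r = Uᵀ *ᵥ S r := fun r => by
    rw [Matrix.mul_apply_eq_vecMul, Matrix.mulVec_transpose]
  rw [Matrix.transpose_mul, ← Matrix.mul_assoc] at h
  rw [h, Finset.smul_sum]
  refine Finset.sum_congr rfl fun r _ => ?_
  rw [e]
  change vecMulVec (c • Uᵀ *ᵥ S r) (c • Uᵀ *ᵥ S r) = _
  rw [Matrix.smul_vecMulVec, Matrix.vecMulVec_smul, smul_smul, sq]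

theorem sketchGram_normalizedRows {c γ : ℝ} (hc : γ * c ^ 2 = 1) (hC : C.PosSemidef)
    (hH : IsUnit (hessian A C)) (S : Matrix (Fin m) (Fin n) ℝ) :
    sketchGram γ ((normalized A C)ᵀ * normalized A C) (normalizedRows c (normalized A C) S) =
      (CFC.sqrt (hessian A C))⁻¹ * sketchedHessian A C S * (CFC.sqrt (hessian A C))⁻¹ := by
  rw [sketchGram, sum_normalizedRows, smul_smul, hc, one_smul, one_sub_gram hC hH,
    transpose_normalized, normalized, sketchedHessian, mul_add, add_mul]
  simp only [Matrix.mul_assoc]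

theorem inv_sketchGram_normalizedRows {c γ : ℝ} (hc : γ * c ^ 2 = 1) (hC : C.PosSemidef)
    (hH : IsUnit (hessian A C)) (S : Matrix (Fin m) (Fin n) ℝ) :
    (sketchGram γ ((normalized A C)ᵀ * normalized A C) (normalizedRows c (normalized A C) S))⁻¹ =
      sketchedInverse A C S := by
  have hR := (Matrix.isUnit_iff_isUnit_det _).1 (isUnit_sqrt_hessian hC hH)
  rw [sketchGram_normalizedRows hc hC hH, Matrix.mul_inv_rev, Matrix.mul_inv_rev,
    Matrix.nonsing_inv_nonsing_inv _ hR, sketchedInverse, Matrix.mul_assoc]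

theorem isUnit_sketchedHessian {c γ : ℝ} (hc : γ * c ^ 2 = 1) (hC : C.PosSemidef)
    (hH : IsUnit (hessian A C)) {S : Matrix (Fin m) (Fin n) ℝ}
    (h : IsUnit (sketchGram γ ((normalized A C)ᵀ * normalized A C)
      (normalizedRows c (normalized A C) S))) : IsUnit (sketchedHessian A C S) := by
  have hR := isUnit_sqrt_hessian hC hH
  have hR' := (Matrix.isUnit_iff_isUnit_det _).1 hR
  have e : sketchedHessian A C S = CFC.sqrt (hessian A C) *
      sketchGram γ ((normalized A C)ᵀ * normalized A C) (normalizedRows c (normalized A C) S) *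
        CFC.sqrt (hessian A C) := by
    rw [sketchGram_normalizedRows hc hC hH, Matrix.mul_assoc, Matrix.mul_assoc, Matrix.nonsing_inv_mul _ hR',
      mul_one, ← Matrix.mul_assoc, Matrix.mul_nonsing_inv _ hR', one_mul]
  rw [e]
  exact (hR.mul h).mul hR

theorem thirdGram_normalizedRows {c γ : ℝ} (hc : γ * c ^ 2 = 1) (U : Matrix (Fin n) (Fin d) ℝ)
    (S : Matrix (Fin m) (Fin n) ℝ) :
    thirdGram γ (fun r : Fin (m / 3) =>
      normalizedRows c U S (Fin.castLE (Nat.div_le_self m 3) r)) =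
      Uᵀ * (firstThird S)ᵀ * firstThird S * U := by
  have h := sum_normalizedRows c U (S.submatrix (Fin.castLE (Nat.div_le_self m 3)) id)
  have e : Uᵀ * (firstThird S)ᵀ * firstThird S * U =
      (3:ℝ) • (Uᵀ * (S.submatrix (Fin.castLE (Nat.div_le_self m 3)) id)ᵀ *
        S.submatrix (Fin.castLE (Nat.div_le_self m 3)) id * U) := by
    rw [firstThird, Matrix.transpose_smul, Matrix.mul_smul, Matrix.mul_smul, Matrix.smul_mul,
      Matrix.smul_mul, Matrix.smul_mul, smul_smul, Real.mul_self_sqrt (by norm_num)]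
  rw [e, thirdGram]
  refine (congrArg ((3 * γ) • ·) h).trans ?_
  simp only [smul_smul]
  rw [mul_assoc, hc, mul_one]

end Normalization

/-! ### Law and independence of the normalized rows -/

section Law

variable {Ω Ω' : Type*} [MeasurableSpace Ω] [MeasurableSpace Ω'] {P : Measure Ω} {P' : Measure Ω'}
  {m n d : ℕ} {U : Matrix (Fin n) (Fin d) ℝ} {s : Ω' → Fin n → ℝ} {α : ℝ}

theorem measurable_transpose_mulVec (U : Matrix (Fin n) (Fin d) ℝ) :
    Measurable fun x : Fin n → ℝ => Uᵀ *ᵥ x :=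
  Continuous.measurable (by fun_prop)

theorem dotProduct_mulVec_transpose_mulVec (B : Matrix (Fin d) (Fin d) ℝ) (x : Fin n → ℝ) :
    (Uᵀ *ᵥ x) ⬝ᵥ B *ᵥ (Uᵀ *ᵥ x) = x ⬝ᵥ (U * B * Uᵀ) *ᵥ x := by
  rw [Matrix.mulVec_transpose U x, ← Matrix.dotProduct_mulVec, ← Matrix.mulVec_transpose,
    Matrix.mulVec_mulVec, Matrix.mulVec_mulVec]

theorem mulVec_transpose_mul_eq (x : Fin n → ℝ) (i j : Fin d) :
    (Uᵀ *ᵥ x) i * (Uᵀ *ᵥ x) j = ∑ p, ∑ q, U p i * U q j * (x p * x q) := by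
  simp only [Matrix.mulVec, dotProduct, Matrix.transpose_apply, Finset.sum_mul_sum]
  refine Finset.sum_congr rfl fun p _ => Finset.sum_congr rfl fun q _ => ?_
  ring

/-- The law of a normalized row. -/
theorem rowLaw_map [IsProbabilityMeasure P'] (hs : Measurable s) (hI : Isotropic P' s)
    (hV : VarianceCondition P' U s α) (hU : ∀ x : Fin d → ℝ, x ⬝ᵥ (Uᵀ * U) *ᵥ x ≤ x ⬝ᵥ x) :
    RowLaw (P'.map fun ω => Uᵀ *ᵥ s ω) (Uᵀ * U) (|α| + 1) := by
  have hm : Measurable fun ω => Uᵀ *ᵥ s ω := (measurable_transpose_mulVec U).comp hs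
  have hint : ∀ (i j : Fin d) p q, Integrable (fun ω => U p i * U q j * (s ω p * s ω q)) P' :=
    fun i j p q => (hI p q).1.const_mul _
  refine ⟨Measure.isProbabilityMeasure_map hm.aemeasurable, posSemidef_transpose_mul_self U, hU,
    by linarith [abs_nonneg α], fun i j => ?_, fun i j => ?_, fun B hB => ?_, fun B hB => ?_⟩
  · rw [integrable_map_measure (Continuous.aestronglyMeasurable (by fun_prop)) hm.aemeasurable]
    simp only [Function.comp_def, mulVec_transpose_mul_eq]
    exact integrable_finsetSum _ fun p _ => integrable_finsetSum _ fun q _ => hint i j p q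
  · rw [integral_map hm.aemeasurable (Continuous.aestronglyMeasurable (by fun_prop))]
    simp only [mulVec_transpose_mul_eq]
    rw [integral_finsetSum _ fun p _ => integrable_finsetSum _ fun q _ => hint i j p q]
    simp only [integral_finsetSum _ fun q _ => hint i j _ q, integral_const_mul, (hI _ _).2,
      Matrix.one_apply, mul_ite, mul_one, mul_zero, Finset.sum_ite_eq, Finset.mem_univ, if_true,
      Matrix.mul_apply, Matrix.transpose_apply]
  · rw [memLp_map_measure_iff (measurable_quadForm B).aestronglyMeasurable hm.aemeasurable]
    simpa only [Function.comp_def, dotProduct_mulVec_transpose_mulVec] using (hV B hB).1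
  · rw [variance_map (measurable_quadForm B).aemeasurable hm.aemeasurable]
    simp only [Function.comp_def, dotProduct_mulVec_transpose_mulVec]
    refine (hV B hB).2.trans ?_
    have e : (U * B ^ 2 * Uᵀ).trace = (B * B * (Uᵀ * U)).trace := by
      rw [Matrix.trace_mul_comm, ← Matrix.mul_assoc, ← Matrix.mul_assoc, Matrix.trace_mul_comm (Uᵀ * U), sq,
        Matrix.mul_assoc, Matrix.mul_assoc, Matrix.mul_assoc]
    -- Nonnegativity is what permits enlarging `α` to `|α| + 1`, which is at least `1` as the row
    -- law demands.
    have h0 : 0 ≤ (U * B ^ 2 * Uᵀ).trace := by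
      have := (posSemidef_transpose_mul_self (B * Uᵀ)).trace_nonneg
      rw [Matrix.transpose_mul, Matrix.transpose_transpose, hB.transpose_eq] at this
      simpa only [sq, Matrix.mul_assoc] using this
    rw [← e]
    exact mul_le_mul_of_nonneg_right (by linarith [le_abs_self α]) h0

theorem measurable_normalizedRows {S : Ω → Matrix (Fin m) (Fin n) ℝ} {c c' : ℝ}
    (hS : HasIIDRows P P' S c' s) : Measurable fun ω => normalizedRows c U (S ω) :=
  measurable_pi_lambda _ fun r =>
    ((measurable_transpose_mulVec U).comp (hS.measurable_row r)).const_smul c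

/-- The normalized rows are independent with the normalized law. -/
theorem map_normalizedRows [IsProbabilityMeasure P]
    {S : Ω → Matrix (Fin m) (Fin n) ℝ} {c c' : ℝ}
    (hS : HasIIDRows P P' S c' s) (hc : c * c' = 1) :
    P.map (fun ω => normalizedRows c U (S ω)) =
      Measure.pi fun _ : Fin m => P'.map fun ω => Uᵀ *ᵥ s ω := by
  have hg : Measurable fun x : Fin n → ℝ => c • Uᵀ *ᵥ x :=
    (measurable_transpose_mulVec U).const_smul c
  have h1 := hS.indep.comp (fun _ x => c • Uᵀ *ᵥ x) fun _ => hg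
  rw [iIndepFun_iff_map_fun_eq_pi_map fun i => (hg.comp (hS.measurable_row i)).aemeasurable] at h1
  refine h1.trans ?_
  congr 1
  funext i
  refine ((hS.identDistrib i).comp hg).map_eq.trans ?_
  congr 1
  funext ω
  simp only [Function.comp_apply]
  rw [Matrix.mulVec_smul, smul_smul, hc, one_smul]

end Law

/-! ### Conditional matrix expectations tested against vectors -/

section MatrixExpectation

variable {Ω : Type*} [MeasurableSpace Ω] {P : Measure Ω} {d : ℕ}
  {F : Ω → Matrix (Fin d) (Fin d) ℝ} {E : Set Ω}

theorem dotProduct_mulVec_eq_sum_sum (K : Matrix (Fin d) (Fin d) ℝ) (u v : Fin d → ℝ) :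
    u ⬝ᵥ K *ᵥ v = ∑ i, ∑ j, u i * v j * K i j := by
  simp only [Matrix.mulVec, dotProduct, Finset.mul_sum]
  refine Finset.sum_congr rfl fun i _ => Finset.sum_congr rfl fun j _ => ?_
  ring

theorem dotProduct_matrixExp_mulVec (hF : EntrywiseIntegrable P F) (u v : Fin d → ℝ) :
    u ⬝ᵥ matrixExp P F *ᵥ v = ∫ ω, u ⬝ᵥ F ω *ᵥ v ∂P := by
  simp only [dotProduct_mulVec_eq_sum_sum]
  rw [integral_finsetSum _ fun i _ => integrable_finsetSum _ fun j _ => (hF i j).const_mul _]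
  refine Finset.sum_congr rfl fun i _ => ?_
  rw [integral_finsetSum _ fun j _ => (hF i j).const_mul _]
  refine Finset.sum_congr rfl fun j _ => ?_
  rw [integral_const_mul]
  rfl

theorem integrable_dotProduct_mulVec (hF : EntrywiseIntegrable P F) (u v : Fin d → ℝ) :
    Integrable (fun ω => u ⬝ᵥ F ω *ᵥ v) P := by
  simp only [dotProduct_mulVec_eq_sum_sum]
  exact integrable_finsetSum _ fun i _ => integrable_finsetSum _ fun j _ => (hF i j).const_mul _

theorem abs_apply_le_norm (K : Matrix (Fin d) (Fin d) ℝ) (i j : Fin d) : |K i j| ≤ ‖K‖ := by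
  have h := abs_dotProduct_mulVec_le_norm K (u := Pi.single i 1) (v := Pi.single j 1)
    (by simp) (by simp)
  simpa using h

theorem entrywiseIntegrable_cond [IsFiniteMeasure P] (hE : MeasurableSet E) (hF : Measurable F)
    (hP : P E ≠ 0) {c : ℝ} (hc : ∀ ω ∈ E, ‖F ω‖ ≤ c) : EntrywiseIntegrable P[|E] F := by
  intro i j
  have hm : Measurable fun K : Matrix (Fin d) (Fin d) ℝ => K i j :=
    Continuous.measurable (by fun_prop)
  exact (integrableOn_of_bound hE (hm.comp hF)
    fun ω hω => (abs_apply_le_norm _ i j).trans (hc ω hω)).smul_measure (by simpa using hP)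

/-- Conditioning divides the integral over the event by its probability, at least `1/2`; hence the
factor `2`. -/
theorem norm_matrixExp_cond_sub_le [IsProbabilityMeasure P] (hP : 1 / 2 ≤ P.real E)
    (hF : EntrywiseIntegrable P[|E] F) {K : Matrix (Fin d) (Fin d) ℝ} {ε : ℝ} (hε : 0 ≤ ε)
    (h : ∀ u v : Fin d → ℝ, u ⬝ᵥ u ≤ 1 → v ⬝ᵥ v ≤ 1 →
      |∫ ω in E, u ⬝ᵥ (F ω - K) *ᵥ v ∂P| ≤ ε) : ‖matrixExp P[|E] F - K‖ ≤ 2 * ε := by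
  have hP0 : P E ≠ 0 := fun h0 => by
    rw [measureReal_def, h0] at hP
    norm_num at hP
  have := cond_isProbabilityMeasure hP0
  refine l2_opNorm_le_of_bilin (by positivity) fun u v hu hv => ?_
  have e : u ⬝ᵥ (matrixExp P[|E] F - K) *ᵥ v = (P.real E)⁻¹ * ∫ ω in E, u ⬝ᵥ (F ω - K) *ᵥ v ∂P := by
    have h1 : u ⬝ᵥ (matrixExp P[|E] F - K) *ᵥ v = ∫ ω, u ⬝ᵥ (F ω - K) *ᵥ v ∂P[|E] := by
      simp only [Matrix.sub_mulVec, dotProduct_sub]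
      rw [integral_sub (integrable_dotProduct_mulVec hF u v) (integrable_const _),
        dotProduct_matrixExp_mulVec hF, integral_const, probReal_univ, one_smul]
    rw [h1, ProbabilityTheory.cond, integral_smul_measure, ENNReal.toReal_inv, smul_eq_mul]
    rfl
  rw [e, abs_mul, abs_of_nonneg (by positivity)]
  refine mul_le_mul ?_ (h u v hu hv) (abs_nonneg _) (by norm_num)
  rw [inv_le_comm₀ (by linarith) (by norm_num)]
  linarith

end MatrixExpectation

/-! ### Transport to the original sketch and the main theorem -/

section Conclusion

variable {Ω Ω' : Type*} [MeasurableSpace Ω] [MeasurableSpace Ω'] {P : Measure Ω} {P' : Measure Ω'}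
  {m n d : ℕ} {A : Matrix (Fin n) (Fin d) ℝ} {C : Matrix (Fin d) (Fin d) ℝ}
  {S : Ω → Matrix (Fin m) (Fin n) ℝ} {s : Ω' → Fin n → ℝ} {α η δ : ℝ}

/-- The equivalence between `Fin m` and three blocks of `m / 3` consecutive indices. -/
def thirdsEquiv (hm : 3 ∣ m) : Fin 3 × Fin (m / 3) ≃ Fin m :=
  finProdFinEquiv.trans (finCongr (Nat.mul_div_cancel' hm))

theorem thirdsEquiv_zero (hm : 3 ∣ m) (r : Fin (m / 3)) :
    thirdsEquiv hm (0, r) = Fin.castLE (Nat.div_le_self m 3) r := by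
  ext
  simp [thirdsEquiv]

theorem effDim_nonneg (A : Matrix (Fin n) (Fin d) ℝ) (C : Matrix (Fin d) (Fin d) ℝ) :
    0 ≤ effDim A C :=
  (posSemidef_transpose_mul_self (normalized A C)).trace_nonneg

theorem normalized_eq_zero (h : effDim A C = 0) : normalized A C = 0 := by
  rw [effDim, ← Matrix.conjTranspose_eq_transpose_of_trivial] at h
  exact Matrix.trace_conjTranspose_mul_self_eq_zero_iff.1 h

theorem secondMomentCoeff_gram (A : Matrix (Fin n) (Fin d) ℝ) (C : Matrix (Fin d) (Fin d) ℝ) :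
    secondMomentCoeff m ((normalized A C)ᵀ * normalized A C) =
      effDim A C / ((m : ℝ) - effDim₂ A C) := by
  rw [secondMomentCoeff, effDim, effDim₂, sq]

/-- From `M⁻¹ - 1 = M⁻¹(1 - M)`; this is the origin of the absolute constant `C₁ = 3`. -/
theorem norm_inv_sub_one_le {M : Matrix (Fin d) (Fin d) ℝ} (hM : IsUnit M)
    (h : ‖M⁻¹‖ ≤ 3) (h1 : ‖M - 1‖ ≤ η) : ‖M⁻¹ - 1‖ ≤ 3 * η := by
  have e : M⁻¹ - 1 = M⁻¹ * (1 - M) := by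
    rw [mul_sub, mul_one, Matrix.nonsing_inv_mul _ ((Matrix.isUnit_iff_isUnit_det _).1 hM)]
  rw [e]
  refine norm_mul_le_mul h ?_
  rwa [norm_sub_rev]

/-- Subspace embedding, transported to the law of the normalized rows. -/
theorem le_measureReal_thirdSet [IsProbabilityMeasure P] [IsProbabilityMeasure P']
    {U : Matrix (Fin n) (Fin d) ℝ} {c c' γ p : ℝ} (hm : 3 ∣ m) (hs : Measurable s)
    (hS : HasIIDRows P P' S c' s) (hc : c * c' = 1) (hγ : γ * c ^ 2 = 1)
    (h : SubspaceEmbedding P U (fun ω => firstThird (S ω)) η p) :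
    p ≤ (Measure.pi fun _ : Fin (m / 3) => P'.map fun ω => Uᵀ *ᵥ s ω).real
      (thirdSet γ η (Uᵀ * U)) := by
  have : IsProbabilityMeasure (P'.map fun ω => Uᵀ *ᵥ s ω) :=
    Measure.isProbabilityMeasure_map ((measurable_transpose_mulVec U).comp hs).aemeasurable
  rw [← measureReal_thirdEvent (thirdsEquiv hm) γ η (Uᵀ * U) 0, ← map_normalizedRows hS hc,
    map_measureReal_apply (measurable_normalizedRows hS) (measurableSet_thirdEvent _ _ _ _ _)]
  refine h.trans (le_of_eq (congrArg P.real (Set.ext fun ω => ?_)))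
  have e : thirdGram γ (fun r => normalizedRows c U (S ω) (thirdsEquiv hm (0, r))) =
      Uᵀ * (firstThird (S ω))ᵀ * firstThird (S ω) * U := by
    simp only [thirdsEquiv_zero]
    exact thirdGram_normalizedRows hγ U (S ω)
  change _ ↔ ‖thirdGram γ (fun r => normalizedRows c U (S ω) (thirdsEquiv hm (0, r))) - Uᵀ * U‖ ≤ η
  rw [e]
  rfl

theorem setIntegral_comp_inv [IsProbabilityMeasure P] {c c' γ : ℝ} {U : Matrix (Fin n) (Fin d) ℝ}
    (hS : HasIIDRows P P' S c' s) (hc : c * c' = 1) (G : Matrix (Fin d) (Fin d) ℝ)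
    {E : Set (Fin m → Fin d → ℝ)} (hE : MeasurableSet E) {f : Matrix (Fin d) (Fin d) ℝ → ℝ}
    (hf : Measurable f) :
    ∫ ω in (fun ω => normalizedRows c U (S ω)) ⁻¹' E,
      f (sketchGram γ G (normalizedRows c U (S ω)))⁻¹ ∂P =
    ∫ y in E, f (sketchGram γ G y)⁻¹ ∂(Measure.pi fun _ : Fin m => P'.map fun ω => Uᵀ *ᵥ s ω) := by
  rw [← map_normalizedRows hS hc]
  exact (setIntegral_map hE (hf.comp (measurable_sketchGram_inv γ G)).aestronglyMeasurable
    (measurable_normalizedRows hS).aemeasurable).symm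

end Conclusion

theorem mainTheorem4 :
    ∃ C₁ : ℝ, 0 < C₁ ∧ ∀ α : ℝ, ∃ C₀ C₂ : ℝ, 0 < C₀ ∧ 0 < C₂ ∧
      ∀ (m n d : ℕ) (A : Matrix (Fin n) (Fin d) ℝ) (C : Matrix (Fin d) (Fin d) ℝ)
        (Ω : Type*) [MeasurableSpace Ω] (P : Measure Ω) [IsProbabilityMeasure P]
        (Ω' : Type*) [MeasurableSpace Ω'] (P' : Measure Ω') [IsProbabilityMeasure P']
        (S : Ω → Matrix (Fin m) (Fin n) ℝ) (s : Ω' → Fin n → ℝ) (η δ : ℝ),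
        0 < m → 3 ∣ m →
        C.PosSemidef → IsUnit (hessian A C) →
        Measurable s → Isotropic P' s →
        HasIIDRows P P' S (1 / √((m : ℝ) - effDim A C)) s →
        η ≤ 1 / 2 → δ ≤ 1 / (m : ℝ) ^ 3 →
        SubspaceEmbedding P (normalized A C) (fun ω => firstThird (S ω)) η (1 - δ / 3) →
        VarianceCondition P' (normalized A C) s α →
        C₀ * effDim A C ≤ m →
        ∃ E : Set Ω, MeasurableSet E ∧ 1 - δ ≤ P.real E ∧
          (∀ ω ∈ E, IsUnit (sketchedHessian A C (S ω)) ∧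
            ‖sketchedInverse A C (S ω) - 1‖ ≤ C₁ * η) ∧
          EntrywiseIntegrable P[|E] (fun ω => sketchedInverse A C (S ω)) ∧
          EntrywiseIntegrable P[|E] (fun ω => sketchedInverse A C (S ω) ^ 2) ∧
          ‖matrixExp P[|E] (fun ω => sketchedInverse A C (S ω)) - 1‖
            ≤ C₂ * (√(effDim A C) / m) ∧
          ‖matrixExp P[|E] (fun ω => sketchedInverse A C (S ω) ^ 2)
              - (1 + (effDim A C / ((m : ℝ) - effDim₂ A C)) •
                  ((normalized A C)ᵀ * normalized A C))‖
            ≤ C₂ * (√(effDim A C) / m) := by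
  -- `C₁` is the bound on `‖Q‖`; `C₀` is the constant of `SketchModel.large` with `a = |α| + 1`;
  -- `C₂` is the constant `3 * 10 ^ 12` of the second moment, doubled by conditioning.
  refine ⟨3, by norm_num, fun α => ⟨10 ^ 13 * (|α| + 1), 6 * 10 ^ 12 * (|α| + 1), by positivity,
    by positivity, ?_⟩⟩
  intro m n d A C Ω _ P _ Ω' _ P' _ S s η δ hm0 hm3 hC hH hs hI hS hη hδ hSE hV hk
  have hm : (3 : ℝ) ≤ m := by exact_mod_cast Nat.le_of_dvd hm0 hm3
  have hk0 := effDim_nonneg A C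
  have hα := abs_nonneg α
  have hkm : effDim A C < m := by nlinarith
  set c := √((m : ℝ) - effDim A C) with hcdef
  set γ := 1 / ((m : ℝ) - effDim A C) with hγdef
  have hc0 : 0 < c := Real.sqrt_pos.2 (by linarith)
  have hc1 : c * (1 / c) = 1 := by field_simp
  have hγ0 : 0 ≤ γ := div_nonneg zero_le_one (by linarith)
  have hγ1 : γ * ((m : ℝ) - effDim A C) = 1 := one_div_mul_cancel (by linarith)
  have hγc : γ * c ^ 2 = 1 := by rwa [hcdef, Real.sq_sqrt (by linarith)]
  have hrow := rowLaw_map hs hI hV (gram_le_one hC hH)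
  have hpr := le_measureReal_thirdSet hm3 hs hS hc1 hγc hSE
  have hloo := leaveOneOut_of_thirds hrow (thirdsEquiv hm3) hγ0 hη hpr
  have hQ : ∀ ω, (sketchGram γ ((normalized A C)ᵀ * normalized A C)
      (normalizedRows c (normalized A C) (S ω)))⁻¹ = sketchedInverse A C (S ω) :=
    fun ω => inv_sketchGram_normalizedRows hγc hC hH (S ω)
  have hμ := hrow.isProb
  -- Forced by the embedding hypothesis, since a probability is at most `1`.
  have hδ0 : 0 ≤ δ := by
    have := hpr.trans measureReal_le_one
    linarith
  have hδ1 : δ ≤ 1 / 2 := by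
    refine hδ.trans (one_div_le_one_div_of_le (by norm_num) ?_)
    nlinarith [pow_le_pow_left₀ (by norm_num : (0:ℝ) ≤ 3) hm 3]
  have hYm := measurable_normalizedRows (c := c) (U := normalized A C) hS
  have htr : 10 ^ 12 * ((|α| + 1) * √(effDim A C) / m) * 6 =
    6 * 10 ^ 12 * (|α| + 1) * (√(effDim A C) / m) := by ring
  set E₀ := ⋂ j, thirdEvent (thirdsEquiv hm3) γ η ((normalized A C)ᵀ * normalized A C) j with hE₀
  have hE₀m := hloo.measurableSet
  have hi : Nonempty (Fin m) := Fin.pos_iff_nonempty.1 hm0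
  have hres : ∀ ω ∈ (fun ω => normalizedRows c (normalized A C) (S ω)) ⁻¹' E₀,
      IsResolvent (sketchedInverse A C (S ω)) := fun ω hω =>
    hQ ω ▸ hloo.isResolvent_gram (hloo.subset (Classical.arbitrary _) hω)
  have hE : MeasurableSet ((fun ω => normalizedRows c (normalized A C) (S ω)) ⁻¹' E₀) := hYm hE₀m
  have hPE : 1 - δ ≤ P.real ((fun ω => normalizedRows c (normalized A C) (S ω)) ⁻¹' E₀) := by
    rw [← map_measureReal_apply hYm hE₀m, map_normalizedRows hS hc1]
    have := hloo.prob_compl_le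
    rw [probReal_compl_eq_one_sub hE₀m] at this
    linarith
  have hPE2 : 1 / 2 ≤ P.real ((fun ω => normalizedRows c (normalized A C) (S ω)) ⁻¹' E₀) := by
    linarith
  have hPE0 : P ((fun ω => normalizedRows c (normalized A C) (S ω)) ⁻¹' E₀) ≠ 0 := fun h0 => by
    rw [measureReal_def, h0] at hPE2
    norm_num at hPE2
  have hQm : Measurable fun ω => sketchedInverse A C (S ω) := by
    simp only [← hQ]
    exact (measurable_sketchGram_inv γ _).comp hYm
  have hQ2m : Measurable fun ω => sketchedInverse A C (S ω) ^ 2 := by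
    have : Measurable fun K : Matrix (Fin d) (Fin d) ℝ => K ^ 2 :=
      Continuous.measurable (by fun_prop)
    exact this.comp hQm
  have hbias : ∀ u v : Fin d → ℝ, u ⬝ᵥ u ≤ 1 → v ⬝ᵥ v ≤ 1 →
      |∫ ω in (fun ω => normalizedRows c (normalized A C) (S ω)) ⁻¹' E₀,
        u ⬝ᵥ (sketchedInverse A C (S ω) - 1) *ᵥ v ∂P| ≤
        10 ^ 12 * ((|α| + 1) * √(effDim A C) / m) ∧
      |∫ ω in (fun ω => normalizedRows c (normalized A C) (S ω)) ⁻¹' E₀,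
        u ⬝ᵥ (sketchedInverse A C (S ω) ^ 2 - (1 + (effDim A C / ((m : ℝ) - effDim₂ A C)) •
          ((normalized A C)ᵀ * normalized A C))) *ᵥ v ∂P| ≤
        3 * 10 ^ 12 * ((|α| + 1) * √(effDim A C) / m) := by
    intro u v hu hv
    -- When the effective dimension vanishes, `U = 0` and `Q = 1` identically; the quantitative
    -- argument requires it to be positive.
    rcases hk0.eq_or_lt with hzero | hpos
    · have hU := normalized_eq_zero hzero.symm
      have h1 : ∀ ω, sketchedInverse A C (S ω) = 1 := fun ω => by
        rw [← hQ, sketchGram, sum_normalizedRows, hU]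
        simp
      simp [h1, hU, ← hzero]
    · have M : SketchModel _ ((normalized A C)ᵀ * normalized A C) (|α| + 1) γ δ E₀ _ :=
        ⟨hrow, hloo, by linarith, hγ1, hpos, by rw [← mul_assoc]; exact hk, hδ0, hδ⟩
      have b1 := M.abs_setIntegral_bilin_le hu hv
      have b2 := M.abs_setIntegral_bilin_sq_sub_le hu hv
      rw [← setIntegral_comp_inv hS hc1 _ hE₀m (f := fun B => u ⬝ᵥ (B - 1) *ᵥ v)
        (Continuous.measurable (by fun_prop))] at b1
      rw [← setIntegral_comp_inv hS hc1 _ hE₀m (f := fun B => u ⬝ᵥ (B * B - (1 + secondMomentCoeff m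
        ((normalized A C)ᵀ * normalized A C) • ((normalized A C)ᵀ * normalized A C))) *ᵥ v)
        (Continuous.measurable (by fun_prop)), secondMomentCoeff_gram] at b2
      simp only [hQ, ← sq] at b1 b2
      exact ⟨b1, b2⟩
  have hq : 0 ≤ (|α| + 1) * √(effDim A C) / m := by positivity
  have hint1 := entrywiseIntegrable_cond hE hQm hPE0 fun ω hω => (hres ω hω).norm_le
  have hint2 := entrywiseIntegrable_cond hE hQ2m hPE0 (c := 9) fun ω hω => by
    rw [sq]; exact (hres ω hω).norm_mul_self_le
  refine ⟨_, hE, hPE, fun ω hω => ?_, hint1, hint2, ?_, ?_⟩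
  · have hu := (hloo.posDef_gram (hloo.subset (Classical.arbitrary _) hω)).isUnit
    refine ⟨isUnit_sketchedHessian hγc hC hH hu, ?_⟩
    rw [← hQ]
    refine norm_inv_sub_one_le hu ((hQ ω).symm ▸ (hres ω hω).norm_le) ?_
    exact norm_sketchGram_sub_one_le (e := thirdsEquiv hm3) (Set.mem_iInter.1 hω)
  · refine (norm_matrixExp_cond_sub_le hPE2 hint1 (by positivity)
      fun u v hu hv => (hbias u v hu hv).1).trans ?_
    rw [← htr]
    linarith
  · refine (norm_matrixExp_cond_sub_le hPE2 hint2 (by positivity)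
      fun u v hu hv => (hbias u v hu hv).2).trans ?_
    rw [← htr]
    linarith
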